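/- Let $k\ge 3$. A $k$-polygon graph is the intersection graph of chords of a convex $k$-gon, where every chord has its endpoints in the interiors of two different sides and all endpoints are distinct. Let $G$ be a $k$-polygon graph with $n\ge 1$ vertices, given by such an intersection model $J$, whose $2n$ endpoints are labelled $1,\dots,2n$ in counterclockwise order around the polygon and are marked with their sides $S_1,\dots,S_k$ (counterclockwise, indices modulo $k$). For a set $S$ of chords let $N_J[S]$ be the set of chords that lie in $S$ or intersect a chord of $S$; for $i\ne j$ let $J_{ij}$ be the set of chords with one endpoint on $S_i$ and one on $S_j$, and for $D\subseteq J$ let $D_{ij}=D\cap J_{ij}$. The *outer boundary* of $D$ is $O=\bigcup_{\{i,j\}}O_{ij}$, where $O_{ij}=\emptyset$ if $D_{ij}=\emptyset$; otherwise, if $j=i+1$ modulo $k$, $O_{ij}$ consists of the chord of $D_{ij}$ with the leftmost (first in counterclockwise order) endpoint on $S_i$ and the chord of $D_{ij}$ with the rightmost (last) endpoint on $S_j$; and if the two sides are not consecutive, $O_{ij}$ consists of the chords of $D_{ij}$ with the leftmost and the rightmost endpoint on $S_i$ and those with the leftmost and the rightmost endpoint on $S_j$. Algorithm 2: for each possible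 $O$ (each outer boundary of some $D\subseteq J$), determine for each pair of different sides $S_i,S_j$ a minimum set $D'_{ij}\subseteq J_{ij}$ with $J'_{ij}\subseteq N_J[D'_{ij}]$, where $J'_{ij}=J_{ij}\setminus N_J[O]$; put $D'=\bigcup D'_{ij}$; if $N_J[D'\cup O]=J$, then $D'\cup O$ is a candidate. Return a candidate of minimum size. **Theorem.** Every run of Algorithm 2 returns a minimum dominating set of $G$. Moreover, Algorithm 2 can be carried out, by one program for all $k$ on a word RAM (words of $O(\log n)$ bits for fixed $k$), in $$O\!\left(n\left(\frac{n}{k^2-k}\right)^{2k^2-4k}\right)$$ time for each fixed $k$ (the implied constants may depend on $k$), where the program also writes out, for each iteration, $O$ and the sets $D'_{ij}$, and finally the returned set. For each fixed $k\ge3$ this bound is of smaller order, as $n\to\infty$, than the earlier bound $O(n^{4k^2+3})$ of Elmallah and Stewart. -/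

import Mathlib

/-- Orientation determinant of three points of the plane; positive iff `a`, `b`, `c` make a strict
left (counterclockwise) turn. -/
noncomputable def orient (a b c : ℝ × ℝ) : ℝ :=
  (b.1 - a.1) * (c.2 - a.2) - (b.2 - a.2) * (c.1 - a.1)

/-- An intersection model of `n` chords in a convex `k`-gon. The corners are listed in
counterclockwise order, side `i` joins corner `i` to the next one. Chord `v` has the two endpoints
`(v, 0)` and `(v, 1)`, lying in the relative interiors of two different sides; all `2 n` endpoints
are distinct. -/
structure PolygonModel (k n : ℕ) where
  corner : Fin k → ℝ × ℝ
  convex : ∀ i j l, i < j → j < l → 0 < orient (corner i) (corner j) (corner l)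
  side : Fin n → Fin 2 → Fin k
  param : Fin n → Fin 2 → ℝ
  param_mem : ∀ v b, param v b ∈ Set.Ioo (0 : ℝ) 1
  side_ne : ∀ v, side v 0 ≠ side v 1
  distinct : Function.Injective fun e : Fin n × Fin 2 => (side e.1 e.2, param e.1 e.2)

/-- `D` is a dominating set of `G`. -/
def IsDominatingSet {V : Type*} (G : SimpleGraph V) (D : Finset V) : Prop :=
  ∀ v, v ∉ D → ∃ u ∈ D, G.Adj v u

/-- `D` is a dominating set of `G` of minimum cardinality. -/
def IsMinDominatingSet {V : Type*} (G : SimpleGraph V) (D : Finset V) : Prop :=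
  IsDominatingSet G D ∧ ∀ E : Finset V, IsDominatingSet G E → D.card ≤ E.card

/-- One iteration of the main loop of the algorithm: the outer boundary `O` that is tried and the
sets `D'ᵢⱼ` (for `i < j`) that are determined for it. -/
structure Iteration (k n : ℕ) where
  boundary : Finset (Fin n)
  sub : Fin k → Fin k → Finset (Fin n)

namespace PolygonModel

variable {k n : ℕ} (J : PolygonModel k n)

/-- The endpoint `b` of chord `v`, as a point of the plane. -/
noncomputable def point (v : Fin n) (b : Fin 2) : ℝ × ℝ :=
  AffineMap.lineMap (J.corner (J.side v b)) (J.corner (finRotate k (J.side v b))) (J.param v b)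

/-- Chord `v`, as a straight line segment. -/
noncomputable def chord (v : Fin n) : Set (ℝ × ℝ) :=
  segment ℝ (J.point v 0) (J.point v 1)

/-- The chords `u` and `v` intersect. -/
def Intersects (u v : Fin n) : Prop := (J.chord u ∩ J.chord v).Nonempty

/-- `J` is an intersection model of `G`; the vertex `v` corresponds to the chord `v`. -/
def IsModelOf (G : SimpleGraph (Fin n)) : Prop :=
  ∀ u v, G.Adj u v ↔ u ≠ v ∧ J.Intersects u v

/-- Endpoint `e` comes before endpoint `f` in the counterclockwise walk along the polygon that
starts at the first corner of side `0`. -/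
def Before (e f : Fin n × Fin 2) : Prop :=
  J.side e.1 e.2 < J.side f.1 f.2 ∨
    (J.side e.1 e.2 = J.side f.1 f.2 ∧ J.param e.1 e.2 < J.param f.1 f.2)

open scoped Classical in
/-- The label in `{1, …, 2 n}` of endpoint `b` of chord `v`: endpoints are labelled in
counterclockwise order, and label `1` is the leftmost one on the first side that has endpoints. -/
noncomputable def label (v : Fin n) (b : Fin 2) : ℕ :=
  (Finset.univ.filter fun e : Fin n × Fin 2 => J.Before e (v, b)).card + 1

open scoped Classical in
/-- `J_ij`: the chords with an endpoint on side `i` and an endpoint on side `j`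
(used only for `i ≠ j`). -/
noncomputable def between (i j : Fin k) : Finset (Fin n) :=
  Finset.univ.filter fun v => (∃ b, J.side v b = i) ∧ ∃ b, J.side v b = j

open scoped Classical in
/-- `N_J[S]`: the chords that belong to `S` or intersect a chord of `S`. -/
noncomputable def closedNbhd (S : Finset (Fin n)) : Finset (Fin n) :=
  Finset.univ.filter fun v => ∃ c ∈ S, v = c ∨ J.Intersects v c

open scoped Classical in
/-- The chord of `D` with the leftmost endpoint on side `i` (as a set with one element, or no
element if no chord of `D` has an endpoint on side `i`). -/
noncomputable def leftmost (i : Fin k) (D : Finset (Fin n)) : Finset (Fin n) :=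
  D.filter fun v => ∃ b, J.side v b = i ∧
    ∀ u ∈ D, ∀ b', J.side u b' = i → J.label v b ≤ J.label u b'

open scoped Classical in
/-- The chord of `D` with the rightmost endpoint on side `i` (as a set with one element, or no
element if no chord of `D` has an endpoint on side `i`). -/
noncomputable def rightmost (i : Fin k) (D : Finset (Fin n)) : Finset (Fin n) :=
  D.filter fun v => ∃ b, J.side v b = i ∧
    ∀ u ∈ D, ∀ b', J.side u b' = i → J.label u b' ≤ J.label v b

/-- The part `O_ij` of the outer boundary of `D`. Two cases for consecutive sides because the pair
of sides is unordered; sides are counted cyclically. It is empty if `D_ij` is. -/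
noncomputable def outerPart (D : Finset (Fin n)) (i j : Fin k) : Finset (Fin n) :=
  if j = finRotate k i then
    J.leftmost i (D ∩ J.between i j) ∪ J.rightmost j (D ∩ J.between i j)
  else if i = finRotate k j then
    J.leftmost j (D ∩ J.between i j) ∪ J.rightmost i (D ∩ J.between i j)
  else
    J.leftmost i (D ∩ J.between i j) ∪ J.rightmost i (D ∩ J.between i j) ∪
      (J.leftmost j (D ∩ J.between i j) ∪ J.rightmost j (D ∩ J.between i j))

/-- The union of a family of chord sets over all (unordered) pairs of different sides. -/
def unionPairs {k n : ℕ} (F : Fin k → Fin k → Finset (Fin n)) : Finset (Fin n) :=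
  (Finset.univ.filter fun p : Fin k × Fin k => p.1 < p.2).biUnion fun p => F p.1 p.2

/-- The outer boundary `O` of the chord set `D`. -/
noncomputable def outerBoundary (D : Finset (Fin n)) : Finset (Fin n) :=
  unionPairs (J.outerPart D)

/-- `J'_ij`: the chords between sides `i` and `j` that `O` does not dominate. -/
noncomputable def undominated (O : Finset (Fin n)) (i j : Fin k) : Finset (Fin n) :=
  J.between i j \ J.closedNbhd O

/-- `X ⊆ J_ij` is a minimum set with `J'_ij ⊆ N_J[X]`. -/
def IsMinSub (O : Finset (Fin n)) (i j : Fin k) (X : Finset (Fin n)) : Prop :=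
  (X ⊆ J.between i j ∧ J.undominated O i j ⊆ J.closedNbhd X) ∧
    ∀ Y : Finset (Fin n), Y ⊆ J.between i j → J.undominated O i j ⊆ J.closedNbhd Y →
      X.card ≤ Y.card

/-- The set `D' ∪ O` of an iteration. -/
def _root_.Iteration.candidate {k n : ℕ} (a : Iteration k n) : Finset (Fin n) :=
  unionPairs a.sub ∪ a.boundary

/-- A complete run of the algorithm on the model `J`, with iterations `L` and returned set `D`:
* the main loop treats every possible outer boundary (the outer boundary of some chord set),
  each one once, in some order;
* in each iteration a minimum set `D'_ij` is determined for each pair of sides;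
* if `N_J[D' ∪ O] = J` then `D' ∪ O` is a candidate;
* a smallest candidate is returned. -/
structure IsRun (L : List (Iteration k n)) (D : Finset (Fin n)) : Prop where
  nodup : (L.map Iteration.boundary).Nodup
  boundaries : ∀ O : Finset (Fin n),
    O ∈ L.map Iteration.boundary ↔ ∃ E : Finset (Fin n), J.outerBoundary E = O
  sub : ∀ a ∈ L, ∀ i j, i < j → J.IsMinSub a.boundary i j (a.sub i j)
  returned : ∃ a ∈ L, J.closedNbhd a.candidate = Finset.univ ∧ D = a.candidate
  smallest : ∀ a ∈ L, J.closedNbhd a.candidate = Finset.univ → D.card ≤ a.candidate.card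

/-- The input of the algorithm, as a list of numbers: `k`, `n`, and for every chord the label and
the side of its first endpoint and the label and the side of its second endpoint. -/
noncomputable def input : List ℕ :=
  k :: n :: (List.finRange n).flatMap fun v =>
    [J.label v 0, (J.side v 0 : ℕ), J.label v 1, (J.side v 1 : ℕ)]

end PolygonModel

/-- A chord set as a 0-1 vector of length `n`. -/
def encodeSet {n : ℕ} (X : Finset (Fin n)) : List ℕ :=
  List.ofFn fun v : Fin n => if v ∈ X then 1 else 0

/-- The report of an iteration: `O`, followed by the sets `D'_ij` for `i < j`. -/
def Iteration.encode {k n : ℕ} (a : Iteration k n) : List ℕ :=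
  encodeSet a.boundary ++ (List.finRange k).flatMap fun i => (List.finRange k).flatMap fun j =>
    if i < j then encodeSet (a.sub i j) else []

/-! ### The word RAM

A random access machine with unit-cost operations on words. A word is a number below the modulus
`B`, and all arithmetic is reduced modulo `B`; for inputs of size `n` the modulus is a fixed power
of `n + 2`, so that words have `O(log n)` bits. Programs are structured (sequence, conditional,
while loop); every elementary instruction and every evaluation of a test takes one step. -/

namespace WordRAM

/-- Arithmetic operations; subtraction is truncated at `0`. -/
inductive Op where
  | add | sub | mul | div | mod

/-- Value of an operation on natural numbers (before reduction modulo `B`). -/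
def Op.eval : Op → ℕ → ℕ → ℕ
  | .add, x, y => x + y
  | .sub, x, y => x - y
  | .mul, x, y => x * y
  | .div, x, y => x / y
  | .mod, x, y => x % y

/-- Programs. Registers are named by numbers. -/
inductive Cmd where
  /-- do nothing -/
  | skip
  /-- `r := v` -/
  | const (r v : ℕ)
  /-- `r := a ∘ b` for registers `a`, `b` -/
  | arith (o : Op) (r a b : ℕ)
  /-- `r := mem[a]` -/
  | load (r a : ℕ)
  /-- `mem[a] := r` -/
  | store (a r : ℕ)
  /-- append the content of `r` to the output -/
  | emit (r : ℕ)
  /-- first `p`, then `q` -/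
  | seq (p q : Cmd)
  /-- if `a < b` then `p` else `q` -/
  | ite (a b : ℕ) (p q : Cmd)
  /-- while `a < b` do `p` -/
  | loop (a b : ℕ) (p : Cmd)

/-- Machine states: registers, random access memory, and the output written so far. -/
structure State where
  reg : ℕ → ℕ
  mem : ℕ → ℕ
  out : List ℕ

/-- Write `x` to register `r`. -/
def State.setReg (s : State) (r x : ℕ) : State := { s with reg := Function.update s.reg r x }

/-- `Exec B p s t s'`: started in state `s`, the program `p` halts in state `s'` after exactly
`t` steps, on the machine with word modulus `B`. -/
inductive Exec (B : ℕ) : Cmd → State → ℕ → State → Prop where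
  | skip (s : State) : Exec B .skip s 1 s
  | const (s : State) (r v : ℕ) : Exec B (.const r v) s 1 (s.setReg r (v % B))
  | arith (s : State) (o : Op) (r a b : ℕ) :
      Exec B (.arith o r a b) s 1 (s.setReg r (o.eval (s.reg a) (s.reg b) % B))
  | load (s : State) (r a : ℕ) : Exec B (.load r a) s 1 (s.setReg r (s.mem (s.reg a)))
  | store (s : State) (a r : ℕ) :
      Exec B (.store a r) s 1 { s with mem := Function.update s.mem (s.reg a) (s.reg r) }
  | emit (s : State) (r : ℕ) : Exec B (.emit r) s 1 { s with out := s.out ++ [s.reg r] }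
  | seq {p q : Cmd} {s s₁ s₂ : State} {t₁ t₂ : ℕ} :
      Exec B p s t₁ s₁ → Exec B q s₁ t₂ s₂ → Exec B (.seq p q) s (t₁ + t₂) s₂
  | iteTrue {a b : ℕ} {p q : Cmd} {s s₁ : State} {t : ℕ} :
      s.reg a < s.reg b → Exec B p s t s₁ → Exec B (.ite a b p q) s (t + 1) s₁
  | iteFalse {a b : ℕ} {p q : Cmd} {s s₁ : State} {t : ℕ} :
      ¬ s.reg a < s.reg b → Exec B q s t s₁ → Exec B (.ite a b p q) s (t + 1) s₁
  | loopTrue {a b : ℕ} {p : Cmd} {s s₁ s₂ : State} {t₁ t₂ : ℕ} :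
      s.reg a < s.reg b → Exec B p s t₁ s₁ → Exec B (.loop a b p) s₁ t₂ s₂ →
        Exec B (.loop a b p) s (t₁ + t₂ + 1) s₂
  | loopFalse {a b : ℕ} {p : Cmd} {s : State} :
      ¬ s.reg a < s.reg b → Exec B (.loop a b p) s 1 s

/-- The initial state: the input stands in the first memory cells, all else is `0` or empty. -/
def start (x : List ℕ) : State where
  reg := fun _ => 0
  mem := fun i => x.getD i 0
  out := []

/-- On input `x` and word modulus `B`, the program `p` halts after exactly `t` steps with
output `y`. -/
def Computes (B : ℕ) (p : Cmd) (x : List ℕ) (t : ℕ) (y : List ℕ) : Prop :=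
  ∃ s, Exec B p (start x) t s ∧ s.out = y

end WordRAM

/-! Correctness. Let `E` be any dominating set, `O` its outer boundary, and `v` a chord between
`S_i` and `S_j` that `O` does not dominate. Then every chord of `E` that dominates `v` lies in
`J_ij` itself. Indeed, whether a chord `c` outside `J_ij` meets `v` depends only on the sides
involved and, if the two chords share a side, on the order of their endpoints there. So if `c` meets
`v`, then so does the chord of `E` parallel to `c` that is extreme in the favourable direction, and
this chord belongs to `O` (`mem_closedNbhd_outerBoundary`). Hence `(E \ O) ∩ J_ij` is admissible in
the subproblem for `i` and `j`, so `D'_ij` is not larger, and summation over the pairs of sides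
gives `|D' ∪ O| ≤ |E|` (`isMinDominatingSet_of_isRun`). The geometry enters through one fact only:
two chords meet or coincide exactly if the number of inversions between their pairs of labels is odd
(`intersects_iff_linkNum`).

Running time. An outer boundary has at most `m = 2k(k-2) = 2k²-4k` chords (`card_outerBoundary_le`),
so it is coded by a number below `(n+1)^m`, and a time `O(n)` per code is allowed. Since `J_ij`
induces a permutation graph, a subproblem is solved by a dynamic program with a table of size
`O(n³)`, which is too slow for the main loop. But the part of `J_ij` that `O` dominates is already
dominated by at most `w` chords of `O`, where `w = 4` for `k = 3` and `w = 9` otherwise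
(`card_le_of_minimal`). So the at most `k²(n+1)^w` relevant subproblems are solved in advance, in
time `O(n^(w+3))`, and `w + 3 ≤ m + 1`. The main loop only has to find these few chords and to look
up the result.

Machine model. The algorithm is written in a small language with bounded loops; `Stmt.halts_comp`
proves its compiler to the word RAM correct. The exponent of the running time is read off the syntax
of the program (`Stmt.exists_cost_le`, `deg_mainProg_le`), and `wp_mainProg` verifies its output.
For fixed `k` the factor `(k²-k)^m` is a constant, so `n(n/(k²-k))^m` and `(n+1)^(m+1)` have the
same order. -/

theorem finRotate_val {k : ℕ} (i : Fin k) :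
    ((finRotate k i : Fin k) : ℕ) = if (i : ℕ) + 1 < k then (i : ℕ) + 1 else 0 := by
  obtain _ | m := k
  · exact i.elim0
  · rw [finRotate_apply, Fin.val_add_one]
    have := i.isLt
    split_ifs with h1 h2 h2
    · subst h1; simp at h2
    · rfl
    · rfl
    · exact absurd (Fin.ext (by simp; omega)) h1

/-! ### Orientation of points on the boundary of a convex polygon -/

theorem orient_rotate (a b c : ℝ × ℝ) : orient a b c = orient b c a := by
  unfold orient; ring

/-- Since `orient` is affine in each argument, statements about points on the sides reduce to
statements about corners. -/
theorem orient_lineMap_left (a b c d : ℝ × ℝ) (t : ℝ) :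
    orient (AffineMap.lineMap a b t) c d = (1 - t) * orient a c d + t * orient b c d := by
  simp [orient, AffineMap.lineMap_apply]; ring

theorem orient_lineMap_mid (a b c d : ℝ × ℝ) (t : ℝ) :
    orient c (AffineMap.lineMap a b t) d = (1 - t) * orient c a d + t * orient c b d := by
  simp [orient, AffineMap.lineMap_apply]; ring

theorem orient_lineMap_right (a b c d : ℝ × ℝ) (t : ℝ) :
    orient c d (AffineMap.lineMap a b t) = (1 - t) * orient c d a + t * orient c d b := by
  simp [orient, AffineMap.lineMap_apply]; ring

theorem orient_lineMap_lineMap (a b c : ℝ × ℝ) (s t : ℝ) :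
    orient (AffineMap.lineMap a b s) (AffineMap.lineMap a b t) c = (t - s) * orient a b c := by
  simp [orient, AffineMap.lineMap_apply]; ring

namespace PolygonModel

variable {k n : ℕ} (J : PolygonModel k n)

theorem orient_corner_nonneg {i j l : Fin k} (h1 : i ≤ j) (h2 : j ≤ l) :
    0 ≤ orient (J.corner i) (J.corner j) (J.corner l) := by
  rcases h1.eq_or_lt with rfl | h1
  · simp [orient]
  rcases h2.eq_or_lt with rfl | h2
  · simp [orient, mul_comm]
  exact (J.convex _ _ _ h1 h2).le

theorem orient_corner_nonneg_rotate {i j l : Fin k} (h1 : i ≤ j) (h2 : j ≤ l) :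
    0 ≤ orient (J.corner j) (J.corner l) (J.corner i) := by
  rw [← orient_rotate]; exact J.orient_corner_nonneg h1 h2

/-- Both corners of side `l` lie weakly to the left of side `i`, and one of them strictly: the first
one, unless it is the end of side `i`, and in that case the second one, which then differs from both
corners of side `i` because there are at least three sides. -/
theorem orient_corner_corner_pos (hk : 3 ≤ k) {i l : Fin k} (h : i < l) {r : ℝ}
    (hr : r ∈ Set.Ioo (0 : ℝ) 1) :
    0 < orient (J.corner i) (J.corner (finRotate k i))
      (AffineMap.lineMap (J.corner l) (J.corner (finRotate k l)) r) := by
  obtain ⟨hr0, hr1⟩ := hr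
  have hi := finRotate_val i
  have hl := finRotate_val l
  have hil : (i : ℕ) < l := h
  have hlk := l.isLt
  rw [if_pos (by omega)] at hi
  have hii : i < finRotate k i := by rw [Fin.lt_def]; omega
  have hil' : finRotate k i ≤ l := by rw [Fin.le_def]; omega
  rw [orient_lineMap_right]
  have key : 0 ≤ orient (J.corner i) (J.corner (finRotate k i)) (J.corner (finRotate k l)) := by
    -- If `l` is the last side, its second corner is corner `0`, and a cyclic rotation of the three
    -- corners restores the increasing order.
    split_ifs at hl with hl1
    · exact J.orient_corner_nonneg hii.le (hil'.trans (by rw [Fin.le_def]; omega))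
    · exact J.orient_corner_nonneg_rotate (by rw [Fin.le_def]; omega) hii.le
  rcases hil'.eq_or_lt with e | hlt
  · have : 0 < orient (J.corner i) (J.corner (finRotate k i)) (J.corner (finRotate k l)) := by
      rw [← e] at hl ⊢
      split_ifs at hl with hl1
      · exact J.convex _ _ _ hii (by rw [Fin.lt_def]; omega)
      · rw [← orient_rotate]
        exact J.convex _ _ _ (by rw [Fin.lt_def]; omega) hii
    have h0 := J.orient_corner_nonneg hii.le hil'
    nlinarith [mul_pos hr0 this, mul_nonneg (sub_nonneg.2 hr1.le) h0]
  · have h0 := J.convex _ _ _ hii hlt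
    nlinarith [mul_nonneg hr0.le key, mul_pos (sub_pos.2 hr1) h0]

theorem orient_point_corner_corner_pos (hk : 3 ≤ k) {i j : Fin k} (h : i < j) {r : ℝ}
    (hr : r ∈ Set.Ioo (0 : ℝ) 1) :
    0 < orient (AffineMap.lineMap (J.corner i) (J.corner (finRotate k i)) r)
      (J.corner j) (J.corner (finRotate k j)) := by
  obtain ⟨hr0, hr1⟩ := hr
  have hi := finRotate_val i
  have hj := finRotate_val j
  have hij : (i : ℕ) < j := h
  have hjk := j.isLt
  rw [if_pos (by omega)] at hi
  have hii : i < finRotate k i := by rw [Fin.lt_def]; omega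
  have hij' : finRotate k i ≤ j := by rw [Fin.le_def]; omega
  rw [orient_lineMap_left]
  split_ifs at hj with hj1
  · have hjj : j < finRotate k j := by rw [Fin.lt_def]; omega
    have h1 := J.convex _ _ _ h hjj
    have h2 := J.orient_corner_nonneg hij' hjj.le
    nlinarith [mul_nonneg hr0.le h2, mul_pos (sub_pos.2 hr1) h1]
  · have h0 : finRotate k j ≤ i := by rw [Fin.le_def]; omega
    have h1 := J.orient_corner_nonneg_rotate h0 h.le
    have h2 := J.orient_corner_nonneg_rotate (h0.trans hii.le) hij'
    rcases h0.eq_or_lt with e | hlt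
    · have : 0 < orient (J.corner (finRotate k i)) (J.corner j) (J.corner (finRotate k j)) := by
        rw [← orient_rotate]
        have hv := congrArg Fin.val e
        exact J.convex _ _ _ (by rw [Fin.lt_def]; omega) (by rw [Fin.lt_def]; omega)
      nlinarith [mul_pos hr0 this, mul_nonneg (sub_nonneg.2 hr1.le) h1]
    · have : 0 < orient (J.corner i) (J.corner j) (J.corner (finRotate k j)) := by
        rw [← orient_rotate]; exact J.convex _ _ _ hlt h
      nlinarith [mul_nonneg hr0.le h2, mul_pos (sub_pos.2 hr1) this]

/-- Expansion in all three arguments gives a convex combination of eight determinants of corners.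
None is negative, and the one of the corners `i`, `j`, `l` is positive and has a positive weight. -/
theorem orient_lineMap_corner_pos {i j l : Fin k} (h1 : i < j) (h2 : j < l) {r s t : ℝ}
    (hr : r ∈ Set.Ioo (0 : ℝ) 1) (hs : s ∈ Set.Ioo (0 : ℝ) 1) (ht : t ∈ Set.Ioo (0 : ℝ) 1) :
    0 < orient (AffineMap.lineMap (J.corner i) (J.corner (finRotate k i)) r)
      (AffineMap.lineMap (J.corner j) (J.corner (finRotate k j)) s)
      (AffineMap.lineMap (J.corner l) (J.corner (finRotate k l)) t) := by
  have hi := finRotate_val i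
  have hj := finRotate_val j
  have hl := finRotate_val l
  have h1' : (i : ℕ) < j := h1
  have h2' : (j : ℕ) < l := h2
  have hlk := l.isLt
  rw [if_pos (by omega)] at hi hj
  have hii : i ≤ finRotate k i := by rw [Fin.le_def]; omega
  have hij' : finRotate k i ≤ j := by rw [Fin.le_def]; omega
  have hjj : j ≤ finRotate k j := by rw [Fin.le_def]; omega
  have hjl' : finRotate k j ≤ l := by rw [Fin.le_def]; omega
  have hP : ∀ a b, a ≤ b → b ≤ l →
      0 ≤ orient (J.corner a) (J.corner b) (J.corner (finRotate k l)) := by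
    intro a b hab hbl
    split_ifs at hl with hl1
    · exact J.orient_corner_nonneg hab (hbl.trans (by rw [Fin.le_def]; omega))
    · exact J.orient_corner_nonneg_rotate (by rw [Fin.le_def]; omega) hab
  have hr0 := hr.1.le; have hr1 := sub_pos.2 hr.2
  have hs0 := hs.1.le; have hs1 := sub_pos.2 hs.2
  have ht0 := ht.1.le; have ht1 := sub_pos.2 ht.2
  have Q : ∀ a b, a ≤ b → b ≤ l → 0 ≤ (1 - t) * orient (J.corner a) (J.corner b) (J.corner l) +
      t * orient (J.corner a) (J.corner b) (J.corner (finRotate k l)) := fun a b hab hbl =>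
    add_nonneg (mul_nonneg ht1.le (J.orient_corner_nonneg hab hbl)) (mul_nonneg ht0 (hP a b hab hbl))
  have Q0 : 0 < (1 - t) * orient (J.corner i) (J.corner j) (J.corner l) +
      t * orient (J.corner i) (J.corner j) (J.corner (finRotate k l)) :=
    add_pos_of_pos_of_nonneg (mul_pos ht1 (J.convex _ _ _ h1 h2))
      (mul_nonneg ht0 (hP i j h1.le h2.le))
  rw [orient_lineMap_left, orient_lineMap_mid, orient_lineMap_mid]
  simp only [orient_lineMap_right]
  exact add_pos_of_pos_of_nonneg
    (mul_pos hr1 (add_pos_of_pos_of_nonneg (mul_pos hs1 Q0)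
      (mul_nonneg hs0 (Q _ _ (h1.le.trans hjj) hjl'))))
    (mul_nonneg hr0 (add_nonneg (mul_nonneg hs1.le (Q _ _ hij' h2.le))
      (mul_nonneg hs0 (Q _ _ (hij'.trans hjj) hjl'))))

/-- Three endpoints in counterclockwise order, not all on one side, make a strict left turn. -/
theorem orient_point_pos (hk : 3 ≤ k) {e f g : Fin n × Fin 2} (hef : J.Before e f)
    (hfg : J.Before f g) (hne : J.side e.1 e.2 ≠ J.side g.1 g.2) :
    0 < orient (J.point e.1 e.2) (J.point f.1 f.2) (J.point g.1 g.2) := by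
  have me := J.param_mem e.1 e.2
  have mf := J.param_mem f.1 f.2
  have mg := J.param_mem g.1 g.2
  unfold point
  rcases hef with h1 | ⟨h1, h1'⟩ <;> rcases hfg with h2 | ⟨h2, h2'⟩
  · exact J.orient_lineMap_corner_pos h1 h2 me mf mg
  · rw [orient_rotate, h2, orient_lineMap_lineMap, ← orient_rotate]
    exact mul_pos (sub_pos.2 h2') (J.orient_point_corner_corner_pos hk (h2 ▸ h1) me)
  · rw [h1, orient_lineMap_lineMap]
    exact mul_pos (sub_pos.2 h1') (J.orient_corner_corner_pos hk h2 mg)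
  · exact absurd (h1.trans h2) hne

end PolygonModel

/-! ### Intersection of segments -/

theorem mem_segment_orient_pos {a b p q x : ℝ × ℝ} (hp : 0 < orient a b p) (hq : 0 < orient a b q)
    (hx : x ∈ segment ℝ p q) : 0 < orient a b x := by
  rw [segment_eq_image_lineMap] at hx
  obtain ⟨t, ht, rfl⟩ := hx
  rw [orient_lineMap_right]
  rcases ht.1.eq_or_lt with h | h
  · rw [← h]; simpa using hp
  · exact add_pos_of_nonneg_of_pos (mul_nonneg (sub_nonneg.2 ht.2) hp.le) (mul_pos h hq)

theorem mem_segment_orient_eq_zero {a b x : ℝ × ℝ} (hx : x ∈ segment ℝ a b) :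
    orient a b x = 0 := by
  rw [segment_eq_image_lineMap] at hx
  obtain ⟨t, -, rfl⟩ := hx
  rw [orient_lineMap_right]; simp [orient]; ring_nf; simp

theorem segment_inter_eq_empty {a b p q : ℝ × ℝ} (hp : 0 < orient a b p) (hq : 0 < orient a b q) :
    ¬ (segment ℝ a b ∩ segment ℝ p q).Nonempty := by
  rintro ⟨x, hx, hx'⟩
  exact (mem_segment_orient_pos hp hq hx').ne' (mem_segment_orient_eq_zero hx)

/-- The diagonals of a convex quadrilateral divide each other in the ratio of triangle areas. By
`hs` the two triangulations have the same total area, so the same denominator serves for both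
parameters. -/
theorem segment_inter_nonempty {a b c d : ℝ × ℝ} (h1 : 0 < orient a b c) (h2 : 0 < orient a b d)
    (h3 : 0 < orient a c d) (h4 : 0 < orient b c d) :
    (segment ℝ a c ∩ segment ℝ b d).Nonempty := by
  have hs : orient a b d + orient b c d = orient a b c + orient a c d := by unfold orient; ring
  refine ⟨AffineMap.lineMap a c (orient a b d / (orient a b d + orient b c d)), ?_, ?_⟩
  · rw [segment_eq_image_lineMap]
    exact ⟨_, ⟨by positivity, (div_le_one (by positivity)).2 (by linarith)⟩, rfl⟩
  · rw [segment_eq_image_lineMap]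
    refine ⟨orient a b c / (orient a b d + orient b c d),
      ⟨by positivity, (div_le_one (by positivity)).2 (by linarith)⟩, ?_⟩
    have hne : orient a b d + orient b c d ≠ 0 := by positivity
    ext
    · simp only [AffineMap.lineMap_apply, vsub_eq_sub, vadd_eq_add, Prod.fst_add, Prod.smul_fst,
        Prod.fst_sub, smul_eq_mul]
      field_simp
      unfold orient; ring
    · simp only [AffineMap.lineMap_apply, vsub_eq_sub, vadd_eq_add, Prod.snd_add, Prod.smul_snd,
        Prod.snd_sub, smul_eq_mul]
      field_simp
      unfold orient; ring

/-- Parity of the number of inversions between `{a, b}` and `{c, d}`. -/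
def linkNum (a b c d : ℕ) : ℕ :=
  ((if a < c then 1 else 0) + (if a < d then 1 else 0) + (if b < c then 1 else 0) +
    (if b < d then 1 else 0)) % 2

theorem linkNum_swap_left (a b c d : ℕ) : linkNum b a c d = linkNum a b c d := by
  unfold linkNum; congr 1; ring

theorem linkNum_swap_right (a b c d : ℕ) : linkNum a b d c = linkNum a b c d := by
  unfold linkNum; congr 1; ring

/-- Makes every chord linked to itself, so that "lies in `S` or meets a chord of `S`" becomes a
single parity condition. -/
theorem linkNum_self {a b : ℕ} (h : a ≠ b) : linkNum a b a b = 1 := by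
  unfold linkNum; split_ifs <;> omega

theorem linkNum_comm {a b c d : ℕ} (h1 : a ≠ c) (h2 : a ≠ d) (h3 : b ≠ c) (h4 : b ≠ d) :
    linkNum c d a b = linkNum a b c d := by
  unfold linkNum; split_ifs <;> omega

/-! ### Labels, and intersection of chords as linking of labels -/

namespace PolygonModel

variable {k n : ℕ} (J : PolygonModel k n)

theorem before_trans {e f g : Fin n × Fin 2} (h : J.Before e f) (h' : J.Before f g) :
    J.Before e g := by
  unfold Before at *
  rcases h with h | ⟨h1, h2⟩ <;> rcases h' with h' | ⟨h1', h2'⟩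
  · exact Or.inl (h.trans h')
  · exact Or.inl (h1' ▸ h)
  · exact Or.inl (h1 ▸ h')
  · exact Or.inr ⟨h1.trans h1', h2.trans h2'⟩

theorem before_irrefl (e : Fin n × Fin 2) : ¬ J.Before e e := by simp [Before]

theorem before_or_before {e f : Fin n × Fin 2} (h : e ≠ f) : J.Before e f ∨ J.Before f e := by
  unfold Before
  rcases lt_trichotomy (J.side e.1 e.2) (J.side f.1 f.2) with h1 | h1 | h1
  · exact Or.inl (Or.inl h1)
  · rcases lt_trichotomy (J.param e.1 e.2) (J.param f.1 f.2) with h2 | h2 | h2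
    · exact Or.inl (Or.inr ⟨h1, h2⟩)
    · exact absurd (J.distinct (Prod.ext h1 h2)) h
    · exact Or.inr (Or.inr ⟨h1.symm, h2⟩)
  · exact Or.inr (Or.inl h1)

theorem label_lt_label_of_before {u v : Fin n} {b c : Fin 2} (h : J.Before (u, b) (v, c)) :
    J.label u b < J.label v c := by
  classical
  unfold label
  refine Nat.succ_lt_succ (Finset.card_lt_card ?_)
  rw [Finset.ssubset_iff_of_subset fun e => by
    simpa using fun he => J.before_trans he h]
  exact ⟨(u, b), by simpa using h, by simpa using J.before_irrefl _⟩

theorem label_lt_label_iff {u v : Fin n} {b c : Fin 2} :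
    J.label u b < J.label v c ↔ J.Before (u, b) (v, c) := by
  refine ⟨fun h => ?_, J.label_lt_label_of_before⟩
  by_cases he : (u, b) = (v, c)
  · obtain ⟨rfl, rfl⟩ := Prod.mk.inj he
    exact absurd h (lt_irrefl _)
  · refine (J.before_or_before he).resolve_right fun h' => ?_
    exact absurd (J.label_lt_label_of_before h') h.asymm

theorem label_inj {u v : Fin n} {b c : Fin 2} : J.label u b = J.label v c ↔ u = v ∧ b = c := by
  refine ⟨fun h => ?_, fun h => h.1 ▸ h.2 ▸ rfl⟩
  by_contra he
  rcases J.before_or_before (e := (u, b)) (f := (v, c)) (by simpa using he) with h' | h'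
  · exact absurd (J.label_lt_label_of_before h') (by omega)
  · exact absurd (J.label_lt_label_of_before h') (by omega)

theorem label_pos (v : Fin n) (b : Fin 2) : 0 < J.label v b := Nat.succ_pos _

theorem label_le (v : Fin n) (b : Fin 2) : J.label v b ≤ 2 * n := by
  classical
  have : (Finset.univ.filter fun e => J.Before e (v, b)).card <
      (Finset.univ : Finset (Fin n × Fin 2)).card :=
    Finset.card_lt_card ⟨Finset.filter_subset _ _, fun h => by
      simpa [J.before_irrefl] using h (Finset.mem_univ (v, b))⟩
  simp at this
  unfold label
  omega

theorem label_lt_of_side_lt {u v : Fin n} {b c : Fin 2} (h : J.side u b < J.side v c) :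
    J.label u b < J.label v c := J.label_lt_label_of_before (Or.inl h)

theorem side_le_of_label_lt {u v : Fin n} {b c : Fin 2} (h : J.label u b < J.label v c) :
    J.side u b ≤ J.side v c := by
  by_contra h'
  exact absurd (J.label_lt_of_side_lt (not_le.1 h')) h.asymm

theorem label_zero_ne_one (v : Fin n) : J.label v 0 ≠ J.label v 1 := by
  simp [J.label_inj]

theorem side_ne_of_ne (v : Fin n) {x y : Fin 2} (h : x ≠ y) : J.side v x ≠ J.side v y := by
  have := J.side_ne v
  fin_cases x <;> fin_cases y <;> simp_all [this.symm]

theorem chord_eq (v : Fin n) {x y : Fin 2} (h : x ≠ y) :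
    J.chord v = segment ℝ (J.point v x) (J.point v y) := by
  unfold chord
  fin_cases x <;> fin_cases y <;> simp_all
  exact segment_symm _ _ _

theorem linkNum_label_eq (u v : Fin n) {x x' y y' : Fin 2} (h : x ≠ x') (h' : y ≠ y') :
    linkNum (J.label u 0) (J.label u 1) (J.label v 0) (J.label v 1) =
      linkNum (J.label u x) (J.label u x') (J.label v y) (J.label v y') := by
  fin_cases x <;> fin_cases x' <;> fin_cases y <;> fin_cases y' <;>
    simp_all [linkNum_swap_left, linkNum_swap_right]

theorem exists_label_lt (v : Fin n) : ∃ x y : Fin 2, x ≠ y ∧ J.label v x < J.label v y := by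
  rcases Nat.lt_or_gt_of_ne (J.label_zero_ne_one v) with h | h
  · exact ⟨0, 1, by simp, h⟩
  · exact ⟨1, 0, by simp, h⟩

/-- When the first endpoint overall belongs to `u`, the other endpoint of `u` comes before, between
or after those of `v`. In the first and the last case both endpoints of `v` lie strictly on one side
of the line through `u`; in the middle case the four endpoints form a convex quadrilateral with
diagonals `u` and `v`. The strict turns are available because the endpoints of one chord lie on
different sides, so that no three consecutive points in question share a side. -/
theorem intersects_iff_of_first (hk : 3 ≤ k) {u v : Fin n} {x x' y y' : Fin 2}
    (hx : x ≠ x') (hy : y ≠ y') (h1 : J.label u x < J.label u x')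
    (h2 : J.label v y < J.label v y') (h3 : J.label u x < J.label v y) :
    J.Intersects u v ↔
      linkNum (J.label u x) (J.label u x') (J.label v y) (J.label v y') = 1 := by
  have huv : u ≠ v ∨ u = v := (em _).symm
  have O := fun {a b c : Fin n} {p q r : Fin 2} (h : J.label a p < J.label b q)
    (h' : J.label b q < J.label c r) (hs : J.side a p ≠ J.side c r) =>
    J.orient_point_pos hk (J.label_lt_label_iff.1 h) (J.label_lt_label_iff.1 h') hs
  have su := J.side_ne_of_ne u hx
  have sv := J.side_ne_of_ne v hy
  have le := fun {a b : Fin n} {p q : Fin 2} (h : J.label a p < J.label b q) =>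
    J.side_le_of_label_lt h
  rw [Intersects, J.chord_eq u hx, J.chord_eq v hy]
  rcases lt_trichotomy (J.label u x') (J.label v y) with h4 | h4 | h4
  · refine iff_of_false (segment_inter_eq_empty (O h1 h4 ?_) (O h1 (h4.trans h2) ?_)) ?_
    · intro e
      exact su (le_antisymm (le h1) (e ▸ le h4))
    · intro e
      exact su (le_antisymm (le h1) (e ▸ le (h4.trans h2)))
    · unfold linkNum; split_ifs <;> first | omega | simp
  -- Equal labels mean equal endpoints, so `u = v`, which contradicts the order of the endpoints.
  · obtain ⟨e1, e2⟩ := J.label_inj.1 h4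
    have e3 : y' = x := by omega
    subst e1 e2 e3
    omega
  rcases lt_trichotomy (J.label u x') (J.label v y') with h5 | h5 | h5
  · refine iff_of_true (segment_inter_nonempty (O h3 h4 su) (O h3 h2 ?_) (O h1 h5 ?_) (O h4 h5 sv)) ?_
    · intro e
      exact sv (le_antisymm (le h2) (e ▸ le h3))
    · intro e
      exact su (le_antisymm (le h1) (e ▸ le h5))
    · unfold linkNum; split_ifs <;> omega
  · obtain ⟨e1, e2⟩ := J.label_inj.1 h5
    have e3 : y = x := by omega
    subst e1 e2 e3
    omega
  · refine iff_of_false ?_ (by unfold linkNum; split_ifs <;> first | omega | simp)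
    rw [segment_symm ℝ (J.point u x)]
    refine segment_inter_eq_empty ?_ ?_
    · rw [orient_rotate]
      exact O h3 (h2.trans h5) su
    · rw [orient_rotate]
      exact O (h3.trans h2) h5 su

theorem intersects_comm {u v : Fin n} : J.Intersects u v ↔ J.Intersects v u := by
  unfold Intersects; rw [Set.inter_comm]

/-- Chords coincide or cross exactly if their labels have odd linking number. -/
theorem intersects_iff_linkNum (hk : 3 ≤ k) (u v : Fin n) : J.Intersects u v ↔
    linkNum (J.label u 0) (J.label u 1) (J.label v 0) (J.label v 1) = 1 := by
  by_cases huv : u = v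
  · subst huv
    exact iff_of_true ⟨_, left_mem_segment _ _ _, left_mem_segment _ _ _⟩
      (linkNum_self (J.label_zero_ne_one u))
  obtain ⟨x, x', hx, h1⟩ := J.exists_label_lt u
  obtain ⟨y, y', hy, h2⟩ := J.exists_label_lt v
  have ne : ∀ p q, J.label u p ≠ J.label v q := fun p q h => huv (J.label_inj.1 h).1
  rcases Nat.lt_or_gt_of_ne (ne x y) with h3 | h3
  · rw [J.linkNum_label_eq u v hx hy]
    exact J.intersects_iff_of_first hk hx hy h1 h2 h3
  · rw [intersects_comm, ← linkNum_comm (ne _ _) (ne _ _) (ne _ _) (ne _ _),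
      J.linkNum_label_eq v u hy hx]
    exact J.intersects_iff_of_first hk hy hx h2 h1 h3

theorem mem_closedNbhd (hk : 3 ≤ k) {S : Finset (Fin n)} {v : Fin n} :
    v ∈ J.closedNbhd S ↔ ∃ c ∈ S,
      linkNum (J.label c 0) (J.label c 1) (J.label v 0) (J.label v 1) = 1 := by
  classical
  simp only [closedNbhd, Finset.mem_filter, Finset.mem_univ, true_and]
  refine exists_congr fun c => and_congr_right fun _ => ?_
  rw [J.intersects_comm, J.intersects_iff_linkNum hk]
  refine or_iff_right_of_imp ?_
  rintro rfl
  exact linkNum_self (J.label_zero_ne_one _)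

end PolygonModel

/-! ### Outer boundaries and the correctness of the algorithm -/

namespace PolygonModel

variable {k n : ℕ} (J : PolygonModel k n)

theorem side_ne_side_sub (v : Fin n) (b : Fin 2) : J.side v b ≠ J.side v (1 - b) :=
  J.side_ne_of_ne v (by omega)

theorem mem_between {i j : Fin k} (h : i ≠ j) {v : Fin n} :
    v ∈ J.between i j ↔ ∃ b, J.side v b = i ∧ J.side v (1 - b) = j := by
  simp only [between, Finset.mem_filter, Finset.mem_univ, true_and]
  constructor
  · rintro ⟨⟨b, rfl⟩, c, rfl⟩
    have : c = 1 - b := by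
      by_contra hc
      exact h (by rw [show c = b by omega])
    exact ⟨b, rfl, by rw [this]⟩
  · rintro ⟨b, h1, h2⟩
    exact ⟨⟨b, h1⟩, _, h2⟩

theorem mem_between_side (v : Fin n) (b : Fin 2) :
    v ∈ J.between (J.side v b) (J.side v (1 - b)) :=
  (J.mem_between (J.side_ne_side_sub v b)).2 ⟨b, rfl, rfl⟩

theorem between_comm (i j : Fin k) : J.between i j = J.between j i := by
  unfold between
  exact Finset.filter_congr fun v _ => and_comm

theorem exists_mem_between (v : Fin n) : ∃ i j, i < j ∧ v ∈ J.between i j := by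
  rcases lt_or_gt_of_ne (J.side_ne_side_sub v 0) with h | h
  · exact ⟨_, _, h, J.mem_between_side v 0⟩
  · exact ⟨_, _, h, J.between_comm _ _ ▸ J.mem_between_side v 0⟩

theorem eq_of_mem_between {i j i' j' : Fin k} (h : i < j) (h' : i' < j') {v : Fin n}
    (hv : v ∈ J.between i j) (hv' : v ∈ J.between i' j') : i = i' ∧ j = j' := by
  obtain ⟨b, rfl, rfl⟩ := (J.mem_between h.ne).1 hv
  obtain ⟨c, rfl, rfl⟩ := (J.mem_between h'.ne).1 hv'
  have : b = c := by
    by_contra hc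
    have : c = 1 - b := by omega
    subst this
    rw [show (1 : Fin 2) - (1 - b) = b by omega] at h'
    exact h.asymm h'
  subst this
  exact ⟨rfl, rfl⟩

theorem mem_unionPairs {F : Fin k → Fin k → Finset (Fin n)} {v : Fin n} :
    v ∈ unionPairs F ↔ ∃ i j, i < j ∧ v ∈ F i j := by
  simp [unionPairs]

/-- Endpoint `b` of `v` is the first one, on its side, of the chords in `X` parallel to `v`. -/
def IsLeft (X : Finset (Fin n)) (v : Fin n) (b : Fin 2) : Prop :=
  ∀ u ∈ X, ∀ c, J.side u c = J.side v b → J.side u (1 - c) = J.side v (1 - b) →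
    J.label v b ≤ J.label u c

/-- Endpoint `b` of `v` is the last one, on its side, of the chords in `X` parallel to `v`. -/
def IsRight (X : Finset (Fin n)) (v : Fin n) (b : Fin 2) : Prop :=
  ∀ u ∈ X, ∀ c, J.side u c = J.side v b → J.side u (1 - c) = J.side v (1 - b) →
    J.label u c ≤ J.label v b

/-- The condition on a chord of `X` to belong to the outer boundary of `X`. -/
def IsExtreme (X : Finset (Fin n)) (v : Fin n) : Prop :=
  ∃ b, (J.side v b ≠ finRotate k (J.side v (1 - b)) ∧ J.IsLeft X v b) ∨
    (J.side v (1 - b) ≠ finRotate k (J.side v b) ∧ J.IsRight X v b)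

/-- Names the endpoint `b` that lies on `i`. The two ends of a chord can then be treated
symmetrically, by the exchange of `b` and `1 - b`. -/
theorem mem_leftmost {D : Finset (Fin n)} {i j : Fin k} (h : i ≠ j) {v : Fin n} :
    v ∈ J.leftmost i (D ∩ J.between i j) ↔
      v ∈ D ∧ ∃ b, J.side v b = i ∧ J.side v (1 - b) = j ∧ J.IsLeft D v b := by
  simp only [leftmost, Finset.mem_filter, Finset.mem_inter, J.mem_between h, IsLeft]
  constructor
  · rintro ⟨⟨hD, c, h1, h2⟩, b, h3, h4⟩
    have : b = c := by
      by_contra hc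
      rw [show b = 1 - c by omega, h2] at h3
      exact h h3.symm
    subst this
    exact ⟨hD, b, h1, h2, fun u hu d hd hd' =>
      h4 u ⟨hu, d, hd.trans h1, hd'.trans h2⟩ d (hd.trans h1)⟩
  · rintro ⟨hD, b, h1, h2, h3⟩
    refine ⟨⟨hD, b, h1, h2⟩, b, h1, ?_⟩
    rintro u ⟨hu, c, h4, h5⟩ d hd
    have : d = c := by
      by_contra hc
      rw [show d = 1 - c by omega, h5] at hd
      exact h hd.symm
    subst this
    exact h3 u hu d (hd.trans h1.symm) (h5.trans h2.symm)

theorem mem_rightmost {D : Finset (Fin n)} {i j : Fin k} (h : i ≠ j) {v : Fin n} :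
    v ∈ J.rightmost i (D ∩ J.between i j) ↔
      v ∈ D ∧ ∃ b, J.side v b = i ∧ J.side v (1 - b) = j ∧ J.IsRight D v b := by
  simp only [rightmost, Finset.mem_filter, Finset.mem_inter, J.mem_between h, IsRight]
  constructor
  · rintro ⟨⟨hD, c, h1, h2⟩, b, h3, h4⟩
    have : b = c := by
      by_contra hc
      rw [show b = 1 - c by omega, h2] at h3
      exact h h3.symm
    subst this
    exact ⟨hD, b, h1, h2, fun u hu d hd hd' =>
      h4 u ⟨hu, d, hd.trans h1, hd'.trans h2⟩ d (hd.trans h1)⟩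
  · rintro ⟨hD, b, h1, h2, h3⟩
    refine ⟨⟨hD, b, h1, h2⟩, b, h1, ?_⟩
    rintro u ⟨hu, c, h4, h5⟩ d hd
    have : d = c := by
      by_contra hc
      rw [show d = 1 - c by omega, h5] at hd
      exact h hd.symm
    subst this
    exact h3 u hu d (hd.trans h1.symm) (h5.trans h2.symm)

theorem ne_finRotate_finRotate (hk : 3 ≤ k) (i : Fin k) : i ≠ finRotate k (finRotate k i) := by
  intro h
  have h1 := congrArg Fin.val h
  have h2 := finRotate_val i
  rw [finRotate_val, h2] at h1
  split_ifs at h1 <;> omega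

/-- Replaces the three cases of the definition by one rule for ordered pairs of sides, applied to
`(i, j)` and to `(j, i)`. With at least three sides the two exceptions cannot occur together, since
no side is the successor of its successor. -/
theorem mem_outerPart (hk : 3 ≤ k) {D : Finset (Fin n)} {i j : Fin k} {v : Fin n} :
    v ∈ J.outerPart D i j ↔
      (i ≠ finRotate k j ∧ (v ∈ J.leftmost i (D ∩ J.between i j) ∨
        v ∈ J.rightmost j (D ∩ J.between i j))) ∨
      (j ≠ finRotate k i ∧ (v ∈ J.leftmost j (D ∩ J.between i j) ∨
        v ∈ J.rightmost i (D ∩ J.between i j))) := by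
  unfold outerPart
  split_ifs with h1 h2
  · subst h1
    simp only [ne_eq, ne_finRotate_finRotate hk i, not_false_eq_true, not_true_eq_false,
      true_and, false_and, or_false, Finset.mem_union]
  · subst h2
    simp only [ne_eq, ne_finRotate_finRotate hk j, not_false_eq_true, not_true_eq_false,
      true_and, false_and, false_or, Finset.mem_union]
  · simp only [ne_eq, h1, h2, not_false_eq_true, true_and, Finset.mem_union]; tauto

theorem mem_outerBoundary (hk : 3 ≤ k) {D : Finset (Fin n)} {v : Fin n} :
    v ∈ J.outerBoundary D ↔ v ∈ D ∧ J.IsExtreme D v := by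
  simp only [outerBoundary, mem_unionPairs, J.mem_outerPart hk]
  constructor
  · rintro ⟨i, j, hij, ⟨h0, h | h⟩ | ⟨h0, h | h⟩⟩
    · obtain ⟨hD, b, rfl, rfl, hb⟩ := (J.mem_leftmost hij.ne).1 h
      exact ⟨hD, b, Or.inl ⟨h0, hb⟩⟩
    · rw [J.between_comm] at h
      obtain ⟨hD, b, rfl, rfl, hb⟩ := (J.mem_rightmost hij.ne').1 h
      exact ⟨hD, b, Or.inr ⟨h0, hb⟩⟩
    · rw [J.between_comm] at h
      obtain ⟨hD, b, rfl, rfl, hb⟩ := (J.mem_leftmost hij.ne').1 h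
      exact ⟨hD, b, Or.inl ⟨h0, hb⟩⟩
    · obtain ⟨hD, b, rfl, rfl, hb⟩ := (J.mem_rightmost hij.ne).1 h
      exact ⟨hD, b, Or.inr ⟨h0, hb⟩⟩
  · rintro ⟨hD, b, h⟩
    rcases lt_or_gt_of_ne (J.side_ne_side_sub v b) with hs | hs
    · refine ⟨_, _, hs, h.imp (fun h => ⟨h.1, Or.inl ?_⟩) fun h => ⟨h.1, Or.inr ?_⟩⟩
      · exact (J.mem_leftmost hs.ne).2 ⟨hD, b, rfl, rfl, h.2⟩
      · exact (J.mem_rightmost hs.ne).2 ⟨hD, b, rfl, rfl, h.2⟩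
    · refine ⟨_, _, hs, h.symm.imp (fun h => ⟨h.1, Or.inr ?_⟩) fun h => ⟨h.1, Or.inl ?_⟩⟩
      · rw [J.between_comm]
        exact (J.mem_rightmost hs.ne').2 ⟨hD, b, rfl, rfl, h.2⟩
      · rw [J.between_comm]
        exact (J.mem_leftmost hs.ne').2 ⟨hD, b, rfl, rfl, h.2⟩

theorem outerBoundary_subset (hk : 3 ≤ k) (D : Finset (Fin n)) : J.outerBoundary D ⊆ D :=
  fun _ h => ((J.mem_outerBoundary hk).1 h).1

/-- A set is an outer boundary iff all its chords are extreme. -/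
theorem exists_outerBoundary_eq_iff (hk : 3 ≤ k) {X : Finset (Fin n)} :
    (∃ E, J.outerBoundary E = X) ↔ ∀ v ∈ X, J.IsExtreme X v := by
  constructor
  · rintro ⟨E, rfl⟩ v hv
    obtain ⟨-, b, h⟩ := (J.mem_outerBoundary hk).1 hv
    exact ⟨b, h.imp
      (fun h => ⟨h.1, fun u hu => h.2 u (J.outerBoundary_subset hk E hu)⟩)
      fun h => ⟨h.1, fun u hu => h.2 u (J.outerBoundary_subset hk E hu)⟩⟩
  · intro h
    -- A set all of whose chords are extreme is its own outer boundary.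
    refine ⟨X, Finset.Subset.antisymm (J.outerBoundary_subset hk X) fun v hv => ?_⟩
    exact (J.mem_outerBoundary hk).2 ⟨hv, h v hv⟩

/-- Supplies the extreme chord that takes the place of `c`: it joins the same two sides, and its
endpoint is not further to the right. -/
theorem exists_isLeft {X : Finset (Fin n)} {c : Fin n} (hc : c ∈ X) (b : Fin 2) :
    ∃ u ∈ X, ∃ d, J.side u d = J.side c b ∧ J.side u (1 - d) = J.side c (1 - b) ∧
      J.IsLeft X u d ∧ J.label u d ≤ J.label c b := by
  obtain ⟨⟨u, d⟩, hu, hmin⟩ := Finset.exists_min_image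
    ((X ×ˢ Finset.univ).filter fun e : Fin n × Fin 2 =>
      J.side e.1 e.2 = J.side c b ∧ J.side e.1 (1 - e.2) = J.side c (1 - b))
    (fun e => J.label e.1 e.2) ⟨(c, b), by simpa using hc⟩
  simp only [Finset.mem_filter, Finset.mem_product, Finset.mem_univ, and_true, Prod.forall,
    and_imp] at hu hmin
  exact ⟨u, hu.1, d, hu.2.1, hu.2.2, fun w hw e h1 h2 =>
    hmin w e hw (h1.trans hu.2.1) (h2.trans hu.2.2), hmin c b hc rfl rfl⟩

theorem exists_isRight {X : Finset (Fin n)} {c : Fin n} (hc : c ∈ X) (b : Fin 2) :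
    ∃ u ∈ X, ∃ d, J.side u d = J.side c b ∧ J.side u (1 - d) = J.side c (1 - b) ∧
      J.IsRight X u d ∧ J.label c b ≤ J.label u d := by
  obtain ⟨⟨u, d⟩, hu, hmax⟩ := Finset.exists_max_image
    ((X ×ˢ Finset.univ).filter fun e : Fin n × Fin 2 =>
      J.side e.1 e.2 = J.side c b ∧ J.side e.1 (1 - e.2) = J.side c (1 - b))
    (fun e => J.label e.1 e.2) ⟨(c, b), by simpa using hc⟩
  simp only [Finset.mem_filter, Finset.mem_product, Finset.mem_univ, and_true, Prod.forall,
    and_imp] at hu hmax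
  exact ⟨u, hu.1, d, hu.2.1, hu.2.2, fun w hw e h1 h2 =>
    hmax w e hw (h1.trans hu.2.1) (h2.trans hu.2.2), hmax c b hc rfl rfl⟩

theorem label_lt_label_iff_side_lt {u v : Fin n} {b c : Fin 2} (h : J.side u b ≠ J.side v c) :
    J.label u b < J.label v c ↔ J.side u b < J.side v c := by
  refine ⟨fun h' => lt_of_le_of_ne (J.side_le_of_label_lt h') h, J.label_lt_of_side_lt⟩

/-- Linking number of two chords without a common side. -/
theorem linkNum_of_sides_ne {c v : Fin n} {b p : Fin 2}
    (h1 : J.side c b ≠ J.side v p) (h2 : J.side c b ≠ J.side v (1 - p))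
    (h3 : J.side c (1 - b) ≠ J.side v p) (h4 : J.side c (1 - b) ≠ J.side v (1 - p)) :
    linkNum (J.label c 0) (J.label c 1) (J.label v 0) (J.label v 1) =
      linkNum (J.side c b) (J.side c (1 - b)) (J.side v p) (J.side v (1 - p)) := by
  rw [J.linkNum_label_eq c v (x := b) (x' := 1 - b) (y := p) (y' := 1 - p) (by omega) (by omega)]
  simp [linkNum, J.label_lt_label_iff_side_lt, *]

/-- Linking number of two chords with one common side. -/
theorem linkNum_of_side_eq {c v : Fin n} {b p : Fin 2}
    (h1 : J.side c b = J.side v p)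
    (h3 : J.side c (1 - b) ≠ J.side v p) (h4 : J.side c (1 - b) ≠ J.side v (1 - p)) :
    linkNum (J.label c 0) (J.label c 1) (J.label v 0) (J.label v 1) =
      ((if J.label c b < J.label v p then 1 else 0) +
        (if (J.side v p : ℕ) < J.side v (1 - p) then 1 else 0) +
        (if (J.side c (1 - b) : ℕ) < J.side v p then 1 else 0) +
        (if (J.side c (1 - b) : ℕ) < J.side v (1 - p) then 1 else 0)) % 2 := by
  rw [J.linkNum_label_eq c v (x := b) (x' := 1 - b) (y := p) (y' := 1 - p) (by omega) (by omega)]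
  have h2 : J.side c b ≠ J.side v (1 - p) := h1 ▸ J.side_ne_side_sub v p
  have e2 := J.label_lt_label_iff_side_lt h2
  have e3 := J.label_lt_label_iff_side_lt h3
  have e4 := J.label_lt_label_iff_side_lt h4
  rw [h1] at e2
  simp only [linkNum, e2, e3, e4, Fin.lt_def]

/-- What is dominated by a chord between other sides, is dominated by the outer boundary. -/
theorem mem_closedNbhd_outerBoundary (hk : 3 ≤ k) {E : Finset (Fin n)} {i j : Fin k} (hij : i ≠ j)
    {v c : Fin n} (hv : v ∈ J.between i j) (hc : c ∈ E) (hc' : c ∉ J.between i j)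
    (hl : linkNum (J.label c 0) (J.label c 1) (J.label v 0) (J.label v 1) = 1) :
    v ∈ J.closedNbhd (J.outerBoundary E) := by
  rw [J.mem_closedNbhd hk]
  -- A chord outside `J_ij` shares at most one side with `v`. If it shares one, the link is decided
  -- by the order of the two endpoints there; otherwise by the sides alone.
  by_cases hshare : ∃ b p, J.side c b = J.side v p
  · obtain ⟨b, p, hbp⟩ := hshare
    have hv' : v ∈ J.between (J.side v p) (J.side v (1 - p)) := J.mem_between_side v p
    have hc'' : c ∉ J.between (J.side v p) (J.side v (1 - p)) := by
      obtain ⟨q, rfl, rfl⟩ := (J.mem_between hij).1 hv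
      by_cases hq : q = p
      · exact hq ▸ hc'
      · rw [J.between_comm, show (1 : Fin 2) - p = q by omega, show p = 1 - q by omega]
        exact hc'
    have h3 : J.side c (1 - b) ≠ J.side v p := hbp ▸ (J.side_ne_side_sub c b).symm
    have h4 : J.side c (1 - b) ≠ J.side v (1 - p) := fun h =>
      hc'' ((J.mem_between (J.side_ne_side_sub v p)).2 ⟨b, hbp, h⟩)
    have hlk := J.linkNum_of_side_eq hbp h3 h4
    rw [hl] at hlk
    have h5 := J.side_ne_side_sub v p
    have h3' := Fin.val_ne_of_ne h3
    have h4' := Fin.val_ne_of_ne h4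
    have h5' := Fin.val_ne_of_ne h5
    have r1 := finRotate_val (J.side c (1 - b))
    have r2 := finRotate_val (J.side c b)
    have b1 := (J.side c (1 - b)).isLt
    have b2 := (J.side v p).isLt
    have b3 := (J.side v (1 - p)).isLt
    -- If `c` precedes `v` on the common side, then so does the leftmost chord parallel to `c`, so
    -- it has the same linking number with `v`. If `c` follows `v`, the rightmost one is used.
    by_cases hlt : J.label c b < J.label v p
    · obtain ⟨u, hu, d, hd1, hd2, hL, hle⟩ := J.exists_isLeft hc b
      have hu' : u ∈ J.outerBoundary E := by
        refine (J.mem_outerBoundary hk).2 ⟨hu, d, Or.inl ⟨?_, hL⟩⟩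
        rw [hd1, hd2]
        -- The leftmost chord is missing from the outer boundary only if the common side follows the
        -- other side of `c`. Then `c` cuts off the corner between them, and `v` starts beyond it
        -- and does not return to the other side of `c`; so the two chords would not be linked.
        intro e
        rw [← e, hbp] at r1
        rw [if_pos hlt] at hlk
        split_ifs at r1 hlk <;> omega
      refine ⟨u, hu', ?_⟩
      rw [J.linkNum_of_side_eq (hd1.trans hbp) (hd2 ▸ h3) (hd2 ▸ h4), hd2,
        if_pos (by omega : J.label u d < J.label v p)]
      rw [if_pos hlt] at hlk
      exact hlk.symm
    · obtain ⟨u, hu, d, hd1, hd2, hR, hle⟩ := J.exists_isRight hc b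
      have hu' : u ∈ J.outerBoundary E := by
        refine (J.mem_outerBoundary hk).2 ⟨hu, d, Or.inr ⟨?_, hR⟩⟩
        rw [hd1, hd2]
        intro e
        -- The mirror image: `c` cuts off the corner at the end of the common side, and `v` starts
        -- before it.
        rw [← e, hbp] at r2
        rw [if_neg hlt] at hlk
        split_ifs at r2 hlk <;> omega
      refine ⟨u, hu', ?_⟩
      rw [J.linkNum_of_side_eq (hd1.trans hbp) (hd2 ▸ h3) (hd2 ▸ h4), hd2,
        if_neg (by omega : ¬ J.label u d < J.label v p)]
      rw [if_neg hlt] at hlk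
      exact hlk.symm
  -- Without a common side all chords parallel to `c` have the same linking number with `v`, so any
  -- one of them in the outer boundary will do. One exists, because at least one of the two orders
  -- of the sides of `c` is not exceptional.
  · push Not at hshare
    obtain ⟨b, hb⟩ : ∃ b, J.side c b ≠ finRotate k (J.side c (1 - b)) := by
      by_cases h : J.side c 0 = finRotate k (J.side c 1)
      · refine ⟨1, ?_⟩
        rw [show (1 : Fin 2) - 1 = 0 from rfl, h]
        exact ne_finRotate_finRotate hk _
      · exact ⟨0, h⟩
    obtain ⟨u, hu, d, hd1, hd2, hL, -⟩ := J.exists_isLeft hc b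
    refine ⟨u, (J.mem_outerBoundary hk).2 ⟨hu, d, Or.inl ⟨hd1 ▸ hd2 ▸ hb, hL⟩⟩, ?_⟩
    rw [J.linkNum_of_sides_ne (hshare b 0) (hshare b _) (hshare _ 0) (hshare _ _)] at hl
    rw [J.linkNum_of_sides_ne (b := d) (p := 0), hd1, hd2, hl] <;> simp only [hd1, hd2]
    exacts [hshare b 0, hshare b _, hshare _ 0, hshare _ _]

theorem isDominatingSet_iff {G : SimpleGraph (Fin n)} (hG : J.IsModelOf G) {D : Finset (Fin n)} :
    IsDominatingSet G D ↔ J.closedNbhd D = Finset.univ := by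
  simp only [IsDominatingSet, closedNbhd, Finset.filter_eq_self, Finset.mem_univ, true_imp_iff]
  refine forall_congr' fun v => ⟨fun h => ?_, ?_⟩
  · by_cases hv : v ∈ D
    · exact ⟨v, hv, Or.inl rfl⟩
    · obtain ⟨u, hu, h⟩ := h hv
      exact ⟨u, hu, Or.inr ((hG v u).1 h).2⟩
  · rintro ⟨c, hc, h⟩ hv
    have hne : v ≠ c := fun e => hv (e ▸ hc)
    exact ⟨c, hc, (hG v c).2 ⟨hne, h.resolve_left hne⟩⟩

theorem closedNbhd_mono {X Y : Finset (Fin n)} (h : X ⊆ Y) : J.closedNbhd X ⊆ J.closedNbhd Y := by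
  intro v
  simp only [closedNbhd, Finset.mem_filter, Finset.mem_univ, true_and]
  rintro ⟨c, hc, h'⟩
  exact ⟨c, h hc, h'⟩

/-- Every iteration of the algorithm yields a candidate. -/
theorem closedNbhd_candidate {a : Iteration k n}
    (h : ∀ i j, i < j → J.IsMinSub a.boundary i j (a.sub i j)) :
    J.closedNbhd a.candidate = Finset.univ := by
  refine Finset.eq_univ_of_forall fun v => ?_
  obtain ⟨i, j, hij, hv⟩ := J.exists_mem_between v
  by_cases hO : v ∈ J.closedNbhd a.boundary
  · exact J.closedNbhd_mono Finset.subset_union_right hO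
  · refine J.closedNbhd_mono ?_ ((h i j hij).1.2 (Finset.mem_sdiff.2 ⟨hv, hO⟩))
    exact fun u hu => Finset.mem_union_left _ (mem_unionPairs.2 ⟨i, j, hij, hu⟩)

/-- The returned set is compared with an arbitrary dominating set `E` by means of the iteration `e`
that treats the outer boundary of `E`. That iteration yields a candidate, so it competes for the
minimum. -/
theorem isMinDominatingSet_of_isRun (hk : 3 ≤ k) {G : SimpleGraph (Fin n)} (hG : J.IsModelOf G)
    {L : List (Iteration k n)} {D : Finset (Fin n)} (h : J.IsRun L D) :
    IsMinDominatingSet G D := by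
  obtain ⟨a, ha, ha', rfl⟩ := h.returned
  refine ⟨(J.isDominatingSet_iff hG).2 ha', fun E hE => ?_⟩
  rw [J.isDominatingSet_iff hG] at hE
  obtain ⟨e, he, hO⟩ := List.mem_map.1 ((h.boundaries (J.outerBoundary E)).2 ⟨E, rfl⟩)
  refine (h.smallest e he (J.closedNbhd_candidate (h.sub e he))).trans ?_
  -- The chords of `E` between the two sides and off the outer boundary are admissible in the
  -- subproblem: a chord that the boundary leaves undominated can be dominated neither by a boundary
  -- chord nor by a chord of `E` between other sides.
  have hsub : ∀ p ∈ Finset.univ.filter (fun p : Fin k × Fin k => p.1 < p.2),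
      (e.sub p.1 p.2).card ≤ ((E \ J.outerBoundary E) ∩ J.between p.1 p.2).card := by
    intro p hp
    have hp : p.1 < p.2 := by simpa using hp
    refine (h.sub e he p.1 p.2 hp).2 _ Finset.inter_subset_right fun v hv => ?_
    obtain ⟨hv1, hv2⟩ := Finset.mem_sdiff.1 hv
    rw [hO] at hv2
    have hvE : v ∈ J.closedNbhd E := hE ▸ Finset.mem_univ v
    rw [J.mem_closedNbhd hk] at hvE ⊢
    obtain ⟨c, hc, hl⟩ := hvE
    refine ⟨c, Finset.mem_inter.2 ⟨Finset.mem_sdiff.2 ⟨hc, fun hcO => hv2 ?_⟩, ?_⟩, hl⟩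
    · exact (J.mem_closedNbhd hk).2 ⟨c, hcO, hl⟩
    · by_contra hc'
      exact hv2 (J.mem_closedNbhd_outerBoundary hk hp.ne hv1 hc hc' hl)
  calc e.candidate.card ≤ (unionPairs e.sub).card + e.boundary.card := Finset.card_union_le _ _
    _ ≤ (E \ J.outerBoundary E).card + (J.outerBoundary E).card := by
        rw [hO]
        refine Nat.add_le_add_right (Finset.card_biUnion_le.trans ?_) _
        refine (Finset.sum_le_sum hsub).trans ?_
        rw [← Finset.card_biUnion]
        · exact Finset.card_le_card (Finset.biUnion_subset.2 fun _ _ => Finset.inter_subset_left)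
        · intro p hp q hq hpq
          replace hp : p.1 < p.2 := by simpa using hp
          replace hq : q.1 < q.2 := by simpa using hq
          rw [Function.onFun, Finset.disjoint_left]
          intro v hv hv'
          exact hpq (Prod.ext_iff.2 (J.eq_of_mem_between hp hq (Finset.mem_inter.1 hv).2
            (Finset.mem_inter.1 hv').2))
    _ = E.card := Finset.card_sdiff_add_card_eq_card (J.outerBoundary_subset hk E)

end PolygonModel

/-! ### Size of an outer boundary, and of what matters of it between two sides -/

namespace PolygonModel

variable {k n : ℕ} (J : PolygonModel k n)

/-- The linking number of two chords. -/
noncomputable def link (c v : Fin n) : ℕ :=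
  linkNum (J.label c 0) (J.label c 1) (J.label v 0) (J.label v 1)

/-- The chords that an ordered pair of sides contributes to the outer boundary of `D`. -/
noncomputable def extremePair (D : Finset (Fin n)) (i j : Fin k) : Finset (Fin n) :=
  if i ≠ finRotate k j then
    J.leftmost i (D ∩ J.between i j) ∪ J.rightmost j (D ∩ J.between i j) else ∅

theorem card_extremePair_le {i j : Fin k} (h : i ≠ j) (D : Finset (Fin n)) :
    (J.extremePair D i j).card ≤ if i ≠ finRotate k j then 2 else 0 := by
  unfold extremePair
  split_ifs with h0
  · have h1 : (J.leftmost i (D ∩ J.between i j)).card ≤ 1 := by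
      refine Finset.card_le_one.2 fun u hu v hv => ?_
      obtain ⟨hu, b, hb1, hb2, hb⟩ := (J.mem_leftmost h).1 hu
      obtain ⟨hv, c, hc1, hc2, hc⟩ := (J.mem_leftmost h).1 hv
      exact (J.label_inj.1 (le_antisymm (hb v hv c (hc1.trans hb1.symm) (hc2.trans hb2.symm))
        (hc u hu b (hb1.trans hc1.symm) (hb2.trans hc2.symm)))).1
    have h2 : (J.rightmost j (D ∩ J.between i j)).card ≤ 1 := by
      rw [J.between_comm]
      refine Finset.card_le_one.2 fun u hu v hv => ?_
      obtain ⟨hu, b, hb1, hb2, hb⟩ := (J.mem_rightmost h.symm).1 hu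
      obtain ⟨hv, c, hc1, hc2, hc⟩ := (J.mem_rightmost h.symm).1 hv
      exact (J.label_inj.1 (le_antisymm (hc u hu b (hb1.trans hc1.symm) (hb2.trans hc2.symm))
        (hb v hv c (hc1.trans hb1.symm) (hc2.trans hb2.symm)))).1
    exact (Finset.card_union_le _ _).trans (by omega)
  · simp

theorem exists_mem_extremePair (hk : 3 ≤ k) {D : Finset (Fin n)} {v : Fin n}
    (hv : v ∈ J.outerBoundary D) :
    ∃ b, v ∈ J.extremePair D (J.side v b) (J.side v (1 - b)) ∧
      J.side v b ≠ finRotate k (J.side v (1 - b)) := by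
  obtain ⟨hD, b, ⟨h0, h⟩ | ⟨h0, h⟩⟩ := (J.mem_outerBoundary hk).1 hv
  · refine ⟨b, ?_, h0⟩
    rw [extremePair, if_pos h0]
    exact Finset.mem_union_left _
      ((J.mem_leftmost (J.side_ne_side_sub v b)).2 ⟨hD, b, rfl, rfl, h⟩)
  · have e : (1 : Fin 2) - (1 - b) = b := by omega
    refine ⟨1 - b, ?_, by rwa [e]⟩
    rw [e, extremePair, if_pos h0, J.between_comm]
    exact Finset.mem_union_right _
      ((J.mem_rightmost (J.side_ne_side_sub v b)).2 ⟨hD, b, rfl, rfl, h⟩)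

theorem finRotate_ne_self {k : ℕ} (hk : 3 ≤ k) (i : Fin k) : finRotate k i ≠ i := by
  intro h
  have h1 := congrArg Fin.val h
  rw [finRotate_val] at h1
  split_ifs at h1 <;> omega

/-- An ordered pair `(i, j)` contributes only if `i` is neither `j` nor the side after `j`. There
are `k(k-2)` such pairs, and each contributes a leftmost and a rightmost chord. -/
theorem card_outerBoundary_le (hk : 3 ≤ k) (D : Finset (Fin n)) :
    (J.outerBoundary D).card ≤ 2 * (k * (k - 2)) := by
  classical
  let S := (Finset.univ : Finset (Fin k)).sigma fun j => ({j, finRotate k j} : Finset (Fin k))ᶜ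
  have hS : S.card = k * (k - 2) := by
    rw [Finset.card_sigma, Finset.sum_const_nat (m := k - 2)]
    · simp
    · intro j _
      rw [Finset.card_compl, Finset.card_pair (finRotate_ne_self hk j).symm, Fintype.card_fin]
  have hsub : J.outerBoundary D ⊆ S.biUnion fun p => J.extremePair D p.2 p.1 := by
    intro v hv
    obtain ⟨b, hb, h0⟩ := J.exists_mem_extremePair hk hv
    refine Finset.mem_biUnion.2 ⟨⟨J.side v (1 - b), J.side v b⟩, ?_, hb⟩
    simp only [S, Finset.mem_sigma, Finset.mem_univ, true_and, Finset.mem_compl,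
      Finset.mem_insert, Finset.mem_singleton, not_or]
    exact ⟨J.side_ne_side_sub v b, h0⟩
  refine (Finset.card_le_card hsub).trans ((Finset.card_biUnion_le_card_mul _ _ 2 ?_).trans ?_)
  · rintro ⟨j, i⟩ hp
    simp only [S, Finset.mem_sigma, Finset.mem_univ, true_and, Finset.mem_compl,
      Finset.mem_insert, Finset.mem_singleton, not_or] at hp
    exact (J.card_extremePair_le hp.1 D).trans (by split_ifs <;> simp)
  · rw [hS, mul_comm]

/-- Two chords for each order of the two sides. In a triangle any two sides are consecutive, so one
of the orders contributes nothing. -/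
theorem card_outerBoundary_inter_between_le (hk : 3 ≤ k) (D : Finset (Fin n)) {i j : Fin k}
    (hij : i ≠ j) :
    (J.outerBoundary D ∩ J.between i j).card ≤ if k < 4 then 2 else 4 := by
  have hsub : J.outerBoundary D ∩ J.between i j ⊆ J.extremePair D i j ∪ J.extremePair D j i := by
    intro v hv
    obtain ⟨hvO, hv'⟩ := Finset.mem_inter.1 hv
    obtain ⟨c, rfl, rfl⟩ := (J.mem_between hij).1 hv'
    obtain ⟨b, hb, -⟩ := J.exists_mem_extremePair hk hvO
    by_cases hbc : b = c
    · exact Finset.mem_union_left _ (hbc ▸ hb)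
    · obtain rfl : b = 1 - c := by omega
      rw [show (1 : Fin 2) - (1 - c) = c by omega] at hb
      exact Finset.mem_union_right _ hb
  refine (Finset.card_le_card hsub).trans ((Finset.card_union_le _ _).trans ?_)
  have h1 := J.card_extremePair_le hij D
  have h2 := J.card_extremePair_le hij.symm D
  split_ifs with h4
  · have : i = finRotate k j ∨ j = finRotate k i := by
      have h5 := finRotate_val i
      have h6 := finRotate_val j
      have h7 := Fin.val_ne_of_ne hij
      have := i.isLt
      have := j.isLt
      simp only [Fin.ext_iff]
      split_ifs at h5 h6 <;> omega
    rcases this with h | h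
    · rw [if_neg (by simpa using h)] at h1
      split_ifs at h2 <;> omega
    · rw [if_neg (by simpa using h)] at h2
      split_ifs at h1 <;> omega
  · split_ifs at h1 h2 <;> omega

/-- Of chords with one endpoint on a common side, whose other endpoints lie in the same way with
respect to two sides, one dominates everything between the two sides that another one does. -/
theorem link_nested {c c' v v' : Fin n} {b b' p p' : Fin 2}
    (h1 : J.side c b = J.side v p) (h1' : J.side c' b' = J.side v p)
    (h3 : J.side c (1 - b) ≠ J.side v p) (h4 : J.side c (1 - b) ≠ J.side v (1 - p))
    (h3' : J.side c' (1 - b') ≠ J.side v p) (h4' : J.side c' (1 - b') ≠ J.side v (1 - p))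
    (hv : J.side v' p' = J.side v p) (hv' : J.side v' (1 - p') = J.side v (1 - p))
    (hkey : ((if (J.side c (1 - b) : ℕ) < J.side v p then 1 else 0) +
        (if (J.side c (1 - b) : ℕ) < J.side v (1 - p) then 1 else 0)) % 2 =
      ((if (J.side c' (1 - b') : ℕ) < J.side v p then 1 else 0) +
        (if (J.side c' (1 - b') : ℕ) < J.side v (1 - p) then 1 else 0)) % 2)
    (l1 : J.link c v = 1) (l2 : J.link c' v ≠ 1) (l3 : J.link c' v' = 1) : J.link c v' = 1 := by
  -- Each linking number is the parity of one comparison on the common side plus a constant that is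
  -- the same for `c` and `c'` by `hkey`. Thus the sets of chords that `c` and `c'` dominate are
  -- both initial or both final pieces of the same order, and `v` shows which is the larger one.
  unfold link at *
  rw [J.linkNum_of_side_eq h1 h3 h4] at l1
  rw [J.linkNum_of_side_eq h1' h3' h4'] at l2
  rw [J.linkNum_of_side_eq (h1'.trans hv.symm) (hv ▸ h3') (hv' ▸ h4')] at l3
  rw [J.linkNum_of_side_eq (h1.trans hv.symm) (hv ▸ h3) (hv' ▸ h4)]
  rw [hv, hv'] at *
  generalize (if (J.side c (1 - b) : ℕ) < J.side v p then 1 else 0) = x1 at *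
  generalize (if (J.side c (1 - b) : ℕ) < J.side v (1 - p) then 1 else 0) = x2 at *
  generalize (if (J.side c' (1 - b') : ℕ) < J.side v p then 1 else 0) = x3 at *
  generalize (if (J.side c' (1 - b') : ℕ) < J.side v (1 - p) then 1 else 0) = x4 at *
  generalize (if (J.side v p : ℕ) < J.side v (1 - p) then 1 else 0) = x5 at *
  split_ifs at * <;> omega

/-- The parity of the number of the sides `i`, `j` that come after side `l`. -/
def sideParity (i j l : Fin k) : ℕ :=
  ((if (l : ℕ) < i then 1 else 0) + (if (l : ℕ) < j then 1 else 0)) % 2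

open scoped Classical in
/-- How a chord, not between the sides `i` and `j`, lies with respect to them. -/
noncomputable def position (i j : Fin k) (c : Fin n) : ℕ × ℕ :=
  if h : ∃ b, J.side c b = i then (1, sideParity i j (J.side c (1 - h.choose)))
  else if h : ∃ b, J.side c b = j then (2, sideParity i j (J.side c (1 - h.choose)))
  else (0, 0)

theorem position_mem {i j : Fin k} (c : Fin n) : J.position i j c ∈
    ({(0, 0), (1, 0), (1, 1), (2, 0), (2, 1)} : Finset (ℕ × ℕ)) := by
  unfold position
  have h2 : ∀ l, sideParity i j l = 0 ∨ sideParity i j l = 1 := fun x => Nat.mod_two_eq_zero_or_one _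
  split_ifs with h h'
  · rcases h2 (J.side c (1 - h.choose)) with h | h <;> rw [h] <;> simp
  · rcases h2 (J.side c (1 - h'.choose)) with h | h <;> rw [h] <;> simp
  · simp

/-- A set of chords, each of which dominates something between `i` and `j` that the others do not
dominate, lies in different positions with respect to `i` and `j`. -/
theorem position_injOn {i j : Fin k} (hij : i ≠ j) {X : Finset (Fin n)}
    (hX : ∀ c ∈ X, c ∉ J.between i j)
    (hmin : ∀ c ∈ X, ∃ v ∈ J.between i j, J.link c v = 1 ∧ ∀ c' ∈ X, c' ≠ c → J.link c' v ≠ 1) :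
    Set.InjOn (J.position i j) X := by
  intro c hc c' hc' heq
  by_contra hne
  obtain ⟨v, hv, l1, l2⟩ := hmin c hc
  obtain ⟨v', hv', l3, l4⟩ := hmin c' hc'
  replace l2 := l2 c' hc' (Ne.symm hne)
  replace l4 := l4 c hc hne
  obtain ⟨p, hp1, hp2⟩ := (J.mem_between hij).1 hv
  obtain ⟨p', hp1', hp2'⟩ := (J.mem_between hij).1 hv'
  have nb : ∀ d ∈ X, ∀ b, J.side d b = i → J.side d (1 - b) ≠ i ∧ J.side d (1 - b) ≠ j := by
    rintro d hd b rfl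
    exact ⟨(J.side_ne_side_sub d b).symm, fun h =>
      hX d hd ((J.mem_between hij).2 ⟨b, rfl, h⟩)⟩
  have nb' : ∀ d ∈ X, ∀ b, J.side d b = j → J.side d (1 - b) ≠ j ∧ J.side d (1 - b) ≠ i := by
    rintro d hd b rfl
    exact ⟨(J.side_ne_side_sub d b).symm, fun h =>
      hX d hd (J.between_comm _ _ ▸ (J.mem_between hij.symm).2 ⟨b, rfl, h⟩)⟩
  have e : ∀ q : Fin 2, (1 : Fin 2) - (1 - q) = q := fun q => by omega
  have hi := fun d (h : ∃ b, J.side d b = i) => h.choose_spec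
  have hj := fun d (h : ∃ b, J.side d b = j) => h.choose_spec
  -- Only the three combinations with equal first components survive: both chords meet side `i`,
  -- both meet side `j` but not `i`, or both meet neither.
  unfold position at heq
  split_ifs at heq <;>
    simp only [Prod.mk.injEq, false_and, OfNat.ofNat_ne_zero, OfNat.zero_ne_ofNat,
      one_ne_zero, zero_ne_one, OfNat.ofNat_ne_one, OfNat.one_ne_ofNat, true_and] at heq
  · rename_i h1 h2
    refine l4 (J.link_nested (b := h1.choose) (b' := h2.choose) (p := p) (p' := p')
      ?_ ?_ ?_ ?_ ?_ ?_ ?_ ?_ ?_ l1 l2 l3) <;> simp only [hp1, hp2, hp1', hp2']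
    · exact hi _ h1
    · exact hi _ h2
    · exact (nb c hc _ (hi _ h1)).1
    · exact (nb c hc _ (hi _ h1)).2
    · exact (nb c' hc' _ (hi _ h2)).1
    · exact (nb c' hc' _ (hi _ h2)).2
    · exact heq
  -- Now the common side is `j`, so the two ends of `v` and of `v'` change roles.
  · rename_i h1 h4 h3 h6
    refine l4 (J.link_nested (b := h4.choose) (b' := h6.choose) (p := 1 - p) (p' := 1 - p')
      ?_ ?_ ?_ ?_ ?_ ?_ ?_ ?_ ?_ l1 l2 l3) <;> simp only [e, hp1, hp2, hp1', hp2']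
    · exact hj _ h4
    · exact hj _ h6
    · exact (nb' c hc _ (hj _ h4)).1
    · exact (nb' c hc _ (hj _ h4)).2
    · exact (nb' c' hc' _ (hj _ h6)).1
    · exact (nb' c' hc' _ (hj _ h6)).2
    · simpa only [sideParity, add_comm] using heq
  -- A chord that meets neither side is linked to all chords between them or to none.
  · rename_i h1 h4 h3 h6
    push Not at h1 h4
    refine l4 ?_
    rw [link, J.linkNum_of_sides_ne (b := 0) (p := p) (hp1 ▸ h1 _) (hp2 ▸ h4 _) (hp1 ▸ h1 _)
      (hp2 ▸ h4 _), hp1, hp2] at l1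
    rw [link, J.linkNum_of_sides_ne (b := 0) (p := p') (hp1' ▸ h1 _) (hp2' ▸ h4 _) (hp1' ▸ h1 _)
      (hp2' ▸ h4 _), hp1', hp2', l1]

/-- In a triangle a chord outside `J_ij` joins one of the two sides to the third side `l`. Its
position is then determined by which of the two it meets, which leaves two values instead of five.
-/
theorem position_eq_of_three {i j l : Fin k} (hk : k < 4) (hij : i < j) (hl : l ≠ i) (hl' : l ≠ j)
    {c : Fin n} (hc : c ∉ J.between i j) :
    J.position i j c ∈ ({(1, sideParity i j l), (2, sideParity i j l)} : Finset (ℕ × ℕ)) := by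
  have third : ∀ d : Fin k, d ≠ i → d ≠ j → d = l := by
    intro d h1 h2
    have := Fin.val_ne_of_ne h1
    have := Fin.val_ne_of_ne h2
    have := Fin.val_ne_of_ne hl
    have := Fin.val_ne_of_ne hl'
    have := Fin.val_ne_of_ne hij.ne
    ext; omega
  unfold position
  split_ifs with h1 h2
  · rw [third (J.side c (1 - h1.choose))]
    · simp
    · conv_rhs => rw [← h1.choose_spec]
      exact (J.side_ne_side_sub c _).symm
    · exact fun h => hc ((J.mem_between hij.ne).2 ⟨_, h1.choose_spec, h⟩)
  · rw [third (J.side c (1 - h2.choose))]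
    · simp
    · exact fun h => h1 ⟨_, h⟩
    · conv_rhs => rw [← h2.choose_spec]
      exact (J.side_ne_side_sub c _).symm
  · push Not at h1 h2
    exact absurd ((third _ (h1 0) (h2 0)).trans (third _ (h1 1) (h2 1)).symm) (J.side_ne c)

/-- Few chords of an outer boundary suffice to dominate what it dominates between two sides. -/
theorem card_le_of_minimal (hk : 3 ≤ k) {E X : Finset (Fin n)} {i j : Fin k} (hij : i < j)
    (hX : X ⊆ J.outerBoundary E)
    (hmin : ∀ c ∈ X, ∃ v ∈ J.between i j, J.link c v = 1 ∧ ∀ c' ∈ X, c' ≠ c → J.link c' v ≠ 1) :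
    X.card ≤ if k < 4 then 4 else 9 := by
  -- The bound is a sum, `2 + 2` or `4 + 5`: boundary chords between the two sides, and positions
  -- available to the other chords.
  have h1 : (X ∩ J.between i j).card ≤ if k < 4 then 2 else 4 :=
    (Finset.card_le_card (Finset.inter_subset_inter_right hX)).trans
      (J.card_outerBoundary_inter_between_le hk E hij.ne)
  have h2 : (X \ J.between i j).card ≤ if k < 4 then 2 else 5 := by
    have inj : Set.InjOn (J.position i j) (X \ J.between i j : Finset (Fin n)) := by
      refine J.position_injOn hij.ne (fun c hc => (Finset.mem_sdiff.1 hc).2) fun c hc => ?_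
      obtain ⟨v, hv, l1, l2⟩ := hmin c (Finset.mem_sdiff.1 hc).1
      exact ⟨v, hv, l1, fun c' hc' => l2 c' (Finset.mem_sdiff.1 hc').1⟩
    split_ifs with h4
    · obtain ⟨l, hl, hl'⟩ : ∃ l : Fin k, l ≠ i ∧ l ≠ j := by
        obtain ⟨l, hl⟩ := Finset.exists_mem_notMem_of_card_lt_card (s := {i, j})
          (t := (Finset.univ : Finset (Fin k)))
          ((Finset.card_le_two).trans_lt (by simp; omega))
        exact ⟨l, by simpa using hl⟩
      exact (Finset.card_le_card_of_injOn _ (fun c hc => J.position_eq_of_three h4 hij hl hl'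
        (Finset.mem_sdiff.1 hc).2) inj).trans Finset.card_le_two
    · exact (Finset.card_le_card_of_injOn _ (fun c _ => J.position_mem c) inj).trans (by simp)
  rw [← Finset.card_inter_add_card_sdiff X (J.between i j)]
  split_ifs at * <;> omega

end PolygonModel

/-! ### Dynamic programming for domination by chords between two sides

Positions `1, …, N` are scanned; some of them carry a number `b ℓ`. Two positions `ℓ' < ℓ` with
numbers are adjacent if `b ℓ' < b ℓ`. The state `(q, r)` consists of the least number `q` taken so
far, and the largest number `r` of a position that still has to be dominated (`0` if there is
none). -/

section DynamicProgram

variable (N : ℕ) (has und : ℕ → Prop) [DecidablePred has] [DecidablePred und] (b : ℕ → ℕ)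

/-- The second component of the state after taking a position with number `x`. -/
def takeRest (x r : ℕ) : ℕ := if r < x then 0 else r

/-- The second component of the state after not taking a position with number `x`; `u` tells
whether the position has to be dominated. -/
def skipRest (u : Prop) [Decidable u] (x q r : ℕ) : ℕ := if u ∧ ¬ q < x then max r x else r

/-- The least number of positions still to be taken, in state `(q, r)` with `z` positions left;
plus `N + 1` if something stays undominated. -/
def costToGo : ℕ → ℕ → ℕ → ℕ
  | 0, _, r => if r = 0 then 0 else N + 1
  | z + 1, q, r =>
    if has (N - z) then
      min (1 + costToGo z (min q (b (N - z))) (takeRest (b (N - z)) r))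
        (costToGo z q (skipRest (und (N - z)) (b (N - z)) q r))
    else costToGo z q r

/-- The state after the next position. -/
def scanStep (d : Prop) [Decidable d] (l : ℕ) (s : ℕ × ℕ) : ℕ × ℕ :=
  if has l then
    if d then (min s.1 (b l), takeRest (b l) s.2) else (s.1, skipRest (und l) (b l) s.1 s.2)
  else s

/-- Whether the optimal solution takes the position after `z`, in state `s`. -/
def Takes (z : ℕ) (s : ℕ × ℕ) : Prop :=
  has (z + 1) ∧ 1 + costToGo N has und b (N - (z + 1)) (min s.1 (b (z + 1)))
      (takeRest (b (z + 1)) s.2) <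
    costToGo N has und b (N - (z + 1)) s.1 (skipRest (und (z + 1)) (b (z + 1)) s.1 s.2)

instance (z : ℕ) (s : ℕ × ℕ) : Decidable (Takes N has und b z s) := by
  unfold Takes; infer_instance

/-- The states of the optimal solution. -/
def optState : ℕ → ℕ × ℕ
  | 0 => (N + 1, 0)
  | z + 1 => scanStep has und b (Takes N has und b z (optState z)) (z + 1) (optState z)

/-- The positions that the optimal solution takes. -/
def OptTakes (l : ℕ) : Prop := Takes N has und b (l - 1) (optState N has und b (l - 1))

instance : DecidablePred (OptTakes N has und b) := fun l => by unfold OptTakes; infer_instance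

/-- The states if the positions in `d` are taken. -/
def scan (d : ℕ → Prop) [DecidablePred d] : ℕ → ℕ × ℕ
  | 0 => (N + 1, 0)
  | z + 1 => scanStep has und b (d (z + 1)) (z + 1) (scan d z)

variable {N has und b}

theorem scan_optTakes (z : ℕ) :
    scan N has und b (OptTakes N has und b) z = optState N has und b z := by
  induction z with
  | zero => rfl
  | succ z ih =>
    rw [scan, optState, ih]
    rfl

theorem costToGo_le (z q r : ℕ) : costToGo N has und b z q r ≤ N + 1 + z := by
  induction z generalizing q r with
  | zero => unfold costToGo; split_ifs <;> omega
  | succ z ih =>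
    unfold costToGo
    split_ifs
    · exact (min_le_right _ _).trans ((ih _ _).trans (by omega))
    · exact (ih _ _).trans (by omega)

theorem scan_fst_le (d : ℕ → Prop) [DecidablePred d] (z : ℕ) :
    (scan N has und b d z).1 ≤ N + 1 := by
  induction z with
  | zero => exact le_rfl
  | succ z ih =>
    rw [scan, scanStep]
    split_ifs
    · exact (min_le_left _ _).trans ih
    · exact ih
    · exact ih

theorem scan_snd_le (hb : ∀ l, has l → b l ≤ N) (d : ℕ → Prop) [DecidablePred d] (z : ℕ) :
    (scan N has und b d z).2 ≤ N := by
  induction z with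
  | zero => exact Nat.zero_le _
  | succ z ih =>
    rw [scan, scanStep]
    split_ifs with h1 h2
    · unfold takeRest; dsimp only; split_ifs <;> omega
    · have := hb _ h1
      unfold skipRest; dsimp only; split_ifs <;> omega
    · exact ih

/-- The number of positions after `z` that are taken. -/
def takenAfter (N : ℕ) (has : ℕ → Prop) [DecidablePred has] (d : ℕ → Prop) [DecidablePred d]
    (z : ℕ) : ℕ :=
  ((Finset.Ioc z N).filter fun l => has l ∧ d l).card

theorem takenAfter_step {d : ℕ → Prop} [DecidablePred d] {z : ℕ} (hz : z < N) :
    takenAfter N has d z =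
      (if has (z + 1) ∧ d (z + 1) then 1 else 0) + takenAfter N has d (z + 1) := by
  have : Finset.Ioc z N = insert (z + 1) (Finset.Ioc (z + 1) N) := by
    ext x; simp only [Finset.mem_Ioc, Finset.mem_insert]; omega
  unfold takenAfter
  rw [this, Finset.filter_insert]
  split_ifs
  · rw [Finset.card_insert_of_notMem (by simp), add_comm]
  · simp

/-- The easy half of the dynamic programming principle: each decision of `d` is one of the two
alternatives whose minimum is taken. -/
theorem costToGo_scan_le (d : ℕ → Prop) [DecidablePred d] {y z : ℕ} (hz : z + y = N) :
    costToGo N has und b y (scan N has und b d z).1 (scan N has und b d z).2 ≤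
      takenAfter N has d z + if (scan N has und b d N).2 = 0 then 0 else N + 1 := by
  induction y generalizing z with
  | zero =>
    obtain rfl : z = N := by omega
    rw [costToGo]; omega
  | succ y ih =>
    specialize ih (z := z + 1) (by omega)
    rw [takenAfter_step (by omega)]
    rw [costToGo, show N - y = z + 1 by omega]
    rw [scan, scanStep] at ih
    split_ifs at * <;> first | omega | simp_all <;> omega

/-- The other half: `Takes` picks an alternative that attains the minimum, so equality holds along
the states of the optimal solution. -/
theorem costToGo_scan_optTakes {y z : ℕ} (hz : z + y = N) :
    costToGo N has und b y (optState N has und b z).1 (optState N has und b z).2 =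
      takenAfter N has (OptTakes N has und b) z +
        if (optState N has und b N).2 = 0 then 0 else N + 1 := by
  induction y generalizing z with
  | zero =>
    obtain rfl : z = N := by omega
    rw [costToGo]; simp [takenAfter]
  | succ y ih =>
    specialize ih (z := z + 1) (by omega)
    rw [takenAfter_step (by omega), add_assoc, ← ih]
    rw [costToGo, show N - y = z + 1 by omega, optState, scanStep]
    have e : OptTakes N has und b (z + 1) ↔ Takes N has und b z (optState N has und b z) := Iff.rfl
    simp only [e]
    have ht := Takes.eq_def N has und b z (optState N has und b z)
    rw [show N - (z + 1) = y by omega] at ht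
    by_cases h1 : has (z + 1)
    · simp only [h1, true_and, if_true]
      split_ifs with h2
      · rw [ht] at h2
        have := h2.2
        dsimp only
        omega
      · rw [ht, not_and] at h2
        have := h2 h1
        dsimp only
        omega
    · simp [h1]

/-- Positions `l'` and `l` in different order, with numbers in the same order. -/
def PosAdj (b : ℕ → ℕ) (l' l : ℕ) : Prop := (l' < l ∧ b l' < b l) ∨ (l < l' ∧ b l < b l')

/-- A position that still has to be dominated after position `z`. -/
def Pending (has und : ℕ → Prop) (b : ℕ → ℕ) (d : ℕ → Prop) (z l : ℕ) : Prop :=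
  (1 ≤ l ∧ l ≤ z) ∧ has l ∧ und l ∧ ¬ d l ∧
    ∀ l', 1 ≤ l' → l' ≤ z → has l' → d l' → ¬ PosAdj b l' l

/-- The least number taken tells whether a new position is adjacent to one already taken. The
initial value `N + 1` plays the part of infinity, hence the restriction to `x ≤ N`. -/
theorem scan_fst_spec (d : ℕ → Prop) [DecidablePred d] (z x : ℕ)
    (hx : x ≤ N) :
    (scan N has und b d z).1 < x ↔ ∃ l, (1 ≤ l ∧ l ≤ z) ∧ has l ∧ d l ∧ b l < x := by
  induction z with
  | zero =>
    simp only [scan]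
    exact iff_of_false (by omega) (by rintro ⟨l, h, -⟩; omega)
  | succ z ih =>
    have key : (∃ l, (1 ≤ l ∧ l ≤ z + 1) ∧ has l ∧ d l ∧ b l < x) ↔
        (∃ l, (1 ≤ l ∧ l ≤ z) ∧ has l ∧ d l ∧ b l < x) ∨
          (has (z + 1) ∧ d (z + 1) ∧ b (z + 1) < x) := by
      constructor
      · rintro ⟨l, hl, h⟩
        by_cases e : l = z + 1
        · exact Or.inr (e ▸ h)
        · exact Or.inl ⟨l, by omega, h⟩
      · rintro (⟨l, hl, h⟩ | h)
        · exact ⟨l, by omega, h⟩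
        · exact ⟨z + 1, by omega, h⟩
    rw [key, ← ih, scan, scanStep]
    split_ifs with h1 h2 <;> simp_all

/-- Remembering only the largest pending number suffices: a position taken later dominates exactly
the pending ones with a smaller number. It therefore settles all of them, or else the largest one
stays pending, and smaller ones settled on the way do not matter. Positivity of the numbers lets `0`
stand for "none". -/
theorem scan_snd_spec (hb : ∀ l, has l → 0 < b l ∧ b l ≤ N) (d : ℕ → Prop) [DecidablePred d]
    (z : ℕ) :
    (∀ l, Pending has und b d z l → b l ≤ (scan N has und b d z).2) ∧
      ((scan N has und b d z).2 = 0 ∨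
        ∃ l, Pending has und b d z l ∧ (scan N has und b d z).2 = b l) := by
  induction z with
  | zero => exact ⟨fun l h => absurd h.1 (by omega), Or.inl rfl⟩
  | succ z ih =>
    obtain ⟨ih1, ih2⟩ := ih
    have mono : ∀ l, l ≤ z → Pending has und b d (z + 1) l → Pending has und b d z l :=
      fun l hl h => ⟨⟨h.1.1, hl⟩, h.2.1, h.2.2.1, h.2.2.2.1, fun l' h1 h2 =>
        h.2.2.2.2 l' h1 (by omega)⟩
    have ext : ∀ l, Pending has und b d z l →
        (has (z + 1) → d (z + 1) → ¬ PosAdj b (z + 1) l) → Pending has und b d (z + 1) l := by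
      intro l h h'
      refine ⟨⟨h.1.1, h.1.2.trans (Nat.le_succ z)⟩, h.2.1, h.2.2.1, h.2.2.2.1,
        fun l' h1 h2 h3 h4 => ?_⟩
      by_cases e : l' = z + 1
      · subst e; exact h' h3 h4
      · exact h.2.2.2.2 l' h1 (by omega) h3 h4
    rw [scan, scanStep]
    split_ifs with h1 h2
    · have hold : ∀ l, Pending has und b d (z + 1) l → l ≤ z := by
        intro l h
        have : l ≠ z + 1 := by rintro rfl; exact h.2.2.2.1 h2
        have := h.1; omega
      unfold takeRest
      dsimp only
      split_ifs with h3
      · refine ⟨fun l h => ?_, Or.inl rfl⟩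
        have hl := hold l h
        have := ih1 l (mono l hl h)
        exact absurd (Or.inr ⟨by omega, by omega⟩)
          (h.2.2.2.2 (z + 1) (by omega) le_rfl h1 h2)
      · refine ⟨fun l h => ih1 l (mono l (hold l h) h), ih2.imp_right ?_⟩
        rintro ⟨l, h, e⟩
        refine ⟨l, ext l h fun _ _ h' => ?_, e⟩
        have := h.1
        rcases h' with h' | h' <;> omega
    -- A position that is not taken becomes pending unless it is dominated from the left, which the
    -- first component of the state decides.
    · have hnew : Pending has und b d (z + 1) (z + 1) ↔
          und (z + 1) ∧ ¬ (scan N has und b d z).1 < b (z + 1) := by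
        rw [scan_fst_spec d z _ (hb _ h1).2]
        constructor
        · intro h
          refine ⟨h.2.2.1, ?_⟩
          rintro ⟨l, hl, h3, h4, h5⟩
          exact h.2.2.2.2 l hl.1 (by omega) h3 h4 (Or.inl ⟨by omega, h5⟩)
        · rintro ⟨h3, h4⟩
          refine ⟨by omega, h1, h3, h2, fun l' h5 h6 h7 h8 h9 => ?_⟩
          have : l' ≠ z + 1 := by rintro rfl; exact h2 h8
          rcases h9 with h9 | h9
          · exact h4 ⟨l', by omega, h7, h8, h9.2⟩
          · omega
      unfold skipRest
      dsimp only
      split_ifs with h3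
      · have hp := hnew.2 h3
        constructor
        · intro l h
          by_cases e : l = z + 1
          · subst e; exact le_max_right _ _
          · have := h.1
            exact (ih1 l (mono l (by omega) h)).trans (le_max_left _ _)
        · right
          rcases max_choice (scan N has und b d z).2 (b (z + 1)) with e | e
          · rcases ih2 with h0 | ⟨l, h, e'⟩
            · rw [h0] at e ⊢
              refine ⟨z + 1, hp, by simp⟩
            · exact ⟨l, ext l h fun _ h => absurd h h2, e.trans e'⟩
          · exact ⟨z + 1, hp, e⟩
      · refine ⟨fun l h => ?_, ih2.imp_right fun ⟨l, h, e⟩ =>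
          ⟨l, ext l h fun _ h => absurd h h2, e⟩⟩
        have hl : l ≠ z + 1 := by rintro rfl; exact h3 (hnew.1 h)
        have := h.1
        exact ih1 l (mono l (by omega) h)
    · refine ⟨fun l h => ?_, ih2.imp_right fun ⟨l, h, e⟩ =>
        ⟨l, ext l h fun h => absurd h h1, e⟩⟩
      have hl : l ≠ z + 1 := by rintro rfl; exact h1 h.2.1
      have := h.1
      exact ih1 l (mono l (by omega) h)

/-- Everything is dominated iff the final state says so. -/
theorem scan_snd_eq_zero_iff (hb : ∀ l, has l → 0 < b l ∧ b l ≤ N) (d : ℕ → Prop)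
    [DecidablePred d] :
    (scan N has und b d N).2 = 0 ↔ ∀ l, ¬ Pending has und b d N l := by
  obtain ⟨h1, h2⟩ := scan_snd_spec (und := und) hb d N
  constructor
  · intro h l hl
    have := h1 l hl
    have := hb l hl.2.1
    omega
  · intro h
    exact h2.resolve_right fun ⟨l, hl, _⟩ => h l hl

theorem takenAfter_le (d : ℕ → Prop) [DecidablePred d] : takenAfter N has d 0 ≤ N :=
  (Finset.card_filter_le _ _).trans (by simp)

/-- The optimal solution dominates everything, and it is a smallest one, if there is a solution. -/
theorem optTakes_spec (hb : ∀ l, has l → 0 < b l ∧ b l ≤ N) (d : ℕ → Prop) [DecidablePred d]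
    (hd : ∀ l, ¬ Pending has und b d N l) :
    (∀ l, ¬ Pending has und b (OptTakes N has und b) N l) ∧
      takenAfter N has (OptTakes N has und b) 0 ≤ takenAfter N has d 0 := by
  have h1 := costToGo_scan_le (N := N) (has := has) (und := und) (b := b) d (y := N) (z := 0) (by omega)
  have h2 := costToGo_scan_optTakes (N := N) (has := has) (und := und) (b := b) (y := N) (z := 0) (by omega)
  rw [if_pos ((scan_snd_eq_zero_iff hb d).2 hd), show (scan N has und b d 0) = (N + 1, 0) from rfl]
    at h1
  rw [show (optState N has und b 0) = (N + 1, 0) from rfl] at h2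
  have h3 := takenAfter_le (N := N) (has := has) d
  rw [← scan_snd_eq_zero_iff hb, scan_optTakes]
  -- If the optimal solution left something undominated, its cost would be at least `N + 1`, whereas
  -- `d` costs at most `N`.
  split_ifs at h2 with h4
  · exact ⟨h4, by omega⟩
  · omega

end DynamicProgram

/-! ### The dynamic program on the chords between two sides -/

namespace PolygonModel

variable {k n : ℕ} (J : PolygonModel k n)

/-- By counting: the labels of the `2 n` endpoints are distinct numbers in an interval of that size.
-/
theorem exists_label_eq {l : ℕ} (h1 : 1 ≤ l) (h2 : l ≤ 2 * n) : ∃ v b, J.label v b = l := by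
  have hsub : Finset.univ.image (fun e : Fin n × Fin 2 => J.label e.1 e.2) ⊆
      Finset.Icc 1 (2 * n) := by
    intro x hx
    obtain ⟨e, -, rfl⟩ := Finset.mem_image.1 hx
    exact Finset.mem_Icc.2 ⟨J.label_pos _ _, J.label_le _ _⟩
  have hcard : (Finset.univ.image fun e : Fin n × Fin 2 => J.label e.1 e.2).card = 2 * n := by
    rw [Finset.card_image_of_injective _ fun e f h => Prod.ext_iff.2 (J.label_inj.1 h)]
    simp [mul_comm]
  have := Finset.eq_of_subset_of_card_le hsub (by simp [hcard])
  obtain ⟨e, -, rfl⟩ := Finset.mem_image.1 (this ▸ Finset.mem_Icc.2 ⟨h1, h2⟩)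
  exact ⟨e.1, e.2, rfl⟩

/-- The endpoint labelled `l` lies on side `i` and belongs to a chord between `i` and `j`. -/
def HasAt (i j : Fin k) (l : ℕ) : Prop :=
  ∃ v b, J.label v b = l ∧ J.side v b = i ∧ J.side v (1 - b) = j

open scoped Classical in
/-- The label of the other endpoint of the chord with an endpoint labelled `l`. -/
noncomputable def otherAt (l : ℕ) : ℕ :=
  if h : ∃ e : Fin n × Fin 2, J.label e.1 e.2 = l then J.label h.choose.1 (1 - h.choose.2) else 0

/-- The endpoint labelled `l` belongs to a chord of `T`. -/
def ChordAt (T : Finset (Fin n)) (l : ℕ) : Prop := ∃ v ∈ T, ∃ b, J.label v b = l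

theorem otherAt_label (v : Fin n) (b : Fin 2) : J.otherAt (J.label v b) = J.label v (1 - b) := by
  have h : ∃ e : Fin n × Fin 2, J.label e.1 e.2 = J.label v b := ⟨(v, b), rfl⟩
  obtain ⟨h1, h2⟩ := J.label_inj.1 h.choose_spec
  rw [otherAt, dif_pos h, h1, h2]

theorem hasAt_label {i j : Fin k} {v : Fin n} {b : Fin 2} :
    J.HasAt i j (J.label v b) ↔ J.side v b = i ∧ J.side v (1 - b) = j := by
  constructor
  · rintro ⟨u, c, h, h'⟩
    obtain ⟨rfl, rfl⟩ := J.label_inj.1 h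
    exact h'
  · exact fun h => ⟨v, b, rfl, h⟩

theorem chordAt_label {T : Finset (Fin n)} {v : Fin n} {b : Fin 2} :
    J.ChordAt T (J.label v b) ↔ v ∈ T := by
  constructor
  · rintro ⟨u, hu, c, h⟩
    obtain ⟨rfl, rfl⟩ := J.label_inj.1 h
    exact hu
  · exact fun h => ⟨v, h, b, rfl⟩

theorem otherAt_spec {i j : Fin k} (l : ℕ) (h : J.HasAt i j l) :
    0 < J.otherAt l ∧ J.otherAt l ≤ 2 * n := by
  obtain ⟨v, b, rfl, -⟩ := h
  rw [otherAt_label]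
  exact ⟨J.label_pos _ _, J.label_le _ _⟩

open scoped Classical in
/-- The chords between `i` and `j` whose endpoints on `i` are at the positions in `d`. -/
noncomputable def chordsOf (i j : Fin k) (d : ℕ → Prop) : Finset (Fin n) :=
  Finset.univ.filter fun v => ∃ b, J.side v b = i ∧ J.side v (1 - b) = j ∧ d (J.label v b)

theorem mem_chordsOf {i j : Fin k} {d : ℕ → Prop} {v : Fin n} :
    v ∈ J.chordsOf i j d ↔ ∃ b, J.side v b = i ∧ J.side v (1 - b) = j ∧ d (J.label v b) := by
  simp [chordsOf]

theorem mem_chordsOf_of_side {i j : Fin k} (hij : i ≠ j) {d : ℕ → Prop} {v : Fin n} {b : Fin 2}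
    (h1 : J.side v b = i) (h2 : J.side v (1 - b) = j) :
    v ∈ J.chordsOf i j d ↔ d (J.label v b) := by
  rw [mem_chordsOf]
  refine ⟨?_, fun h => ⟨b, h1, h2, h⟩⟩
  rintro ⟨c, h3, h4, h5⟩
  have : c = b := by
    by_contra h
    rw [show c = 1 - b by omega, h2] at h3
    exact hij h3.symm
  exact this ▸ h5

/-- All labels on `i` precede all labels on `j`. So two chords between these sides cross exactly if
their endpoints come in the same order on both sides. This is the permutation graph structure that
the dynamic program exploits. -/
theorem link_eq_one_iff_of_between {i j : Fin k} (hij : i < j) {c v : Fin n} {a b : Fin 2}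
    (h1 : J.side c a = i) (h2 : J.side c (1 - a) = j) (h3 : J.side v b = i)
    (h4 : J.side v (1 - b) = j) :
    J.link c v = 1 ↔ c = v ∨ PosAdj J.otherAt (J.label c a) (J.label v b) := by
  by_cases hcv : c = v
  · subst hcv
    exact iff_of_true (linkNum_self (J.label_zero_ne_one _)) (Or.inl rfl)
  rw [link, J.linkNum_label_eq c v (x := a) (x' := 1 - a) (y := b) (y' := 1 - b) (by omega)
    (by omega)]
  simp only [hcv, false_or, PosAdj, otherAt_label]
  have e1 : J.label c a < J.label v (1 - b) := J.label_lt_of_side_lt (h1 ▸ h4 ▸ hij)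
  have e2 : J.label v b < J.label c (1 - a) := J.label_lt_of_side_lt (h3 ▸ h2 ▸ hij)
  have e3 : J.label c a ≠ J.label v b := fun h => hcv (J.label_inj.1 h).1
  have e4 : J.label c (1 - a) ≠ J.label v (1 - b) := fun h => hcv (J.label_inj.1 h).1
  unfold linkNum
  rw [if_pos e1, if_neg e2.asymm]
  split_ifs <;> simp <;> omega

theorem forall_not_pending_iff (hk : 3 ≤ k) {i j : Fin k} (hij : i < j) {O : Finset (Fin n)}
    {d : ℕ → Prop} :
    (∀ l, ¬ Pending (J.HasAt i j) (J.ChordAt (J.closedNbhd O)ᶜ) J.otherAt d (2 * n) l) ↔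
      J.undominated O i j ⊆ J.closedNbhd (J.chordsOf i j d) := by
  constructor
  · intro h v hv
    rw [J.mem_closedNbhd hk]
    obtain ⟨b, h1, h2⟩ := (J.mem_between hij.ne).1 (Finset.mem_sdiff.1 hv).1
    by_contra hno
    push Not at hno
    refine h (J.label v b) ⟨⟨J.label_pos _ _, J.label_le _ _⟩, J.hasAt_label.2 ⟨h1, h2⟩,
      J.chordAt_label.2 (Finset.mem_compl.2 (Finset.mem_sdiff.1 hv).2), fun hd => ?_, fun l hl hl' h3 h4 h5 => ?_⟩
    · exact hno v ((J.mem_chordsOf_of_side hij.ne h1 h2).2 hd)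
        (linkNum_self (J.label_zero_ne_one _))
    · obtain ⟨c, a, rfl, h6, h7⟩ := h3
      exact hno c ((J.mem_chordsOf_of_side hij.ne h6 h7).2 h4)
        ((J.link_eq_one_iff_of_between hij h6 h7 h1 h2).2 (Or.inr h5))
  · rintro h l ⟨-, ⟨v, b, rfl, h1, h2⟩, h3, h4, h5⟩
    obtain ⟨c, hc, hl⟩ := (J.mem_closedNbhd hk).1 (h (Finset.mem_sdiff.2
      ⟨(J.mem_between hij.ne).2 ⟨b, h1, h2⟩, Finset.mem_compl.1 (J.chordAt_label.1 h3)⟩))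
    obtain ⟨a, h6, h7, h8⟩ := J.mem_chordsOf.1 hc
    rcases (J.link_eq_one_iff_of_between hij h6 h7 h1 h2).1 hl with rfl | hl
    · exact h4 ((J.mem_chordsOf_of_side hij.ne h1 h2).1 hc)
    · exact h5 _ (J.label_pos _ _) (J.label_le _ _) (J.hasAt_label.2 ⟨h6, h7⟩) h8 hl

/-- Each chord between the sides has exactly one endpoint on `i`, so counting positions is counting
chords. -/
theorem takenAfter_eq_card {i j : Fin k} (hij : i ≠ j) [DecidablePred (J.HasAt i j)] {d : ℕ → Prop}
    [DecidablePred d] :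
    takenAfter (2 * n) (J.HasAt i j) d 0 = (J.chordsOf i j d).card := by
  classical
  let pos : Fin n → ℕ := fun v => if J.side v 0 = i then J.label v 0 else J.label v 1
  have hpos : ∀ v b, J.side v b = i → J.side v (1 - b) = j → pos v = J.label v b := by
    intro v b h1 h2
    have h3 : b = 0 ∨ b = 1 := by omega
    rcases h3 with rfl | rfl
    · simp [pos, h1]
    · have : J.side v 0 ≠ i := by rw [show (0 : Fin 2) = 1 - 1 from rfl, h2]; exact hij.symm
      simp [pos, this]
  have : (Finset.Ioc 0 (2 * n)).filter (fun l => J.HasAt i j l ∧ d l) =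
      (J.chordsOf i j d).image pos := by
    ext l
    simp only [Finset.mem_filter, Finset.mem_Ioc, Finset.mem_image, mem_chordsOf]
    constructor
    · rintro ⟨-, ⟨v, b, rfl, h1, h2⟩, h3⟩
      exact ⟨v, ⟨b, h1, h2, h3⟩, hpos v b h1 h2⟩
    · rintro ⟨v, ⟨b, h1, h2, h3⟩, rfl⟩
      rw [hpos v b h1 h2]
      exact ⟨⟨J.label_pos _ _, J.label_le _ _⟩, J.hasAt_label.2 ⟨h1, h2⟩, h3⟩
  rw [takenAfter, this, Finset.card_image_of_injOn]
  intro u hu v hv h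
  obtain ⟨b, h1, h2, -⟩ := J.mem_chordsOf.1 hu
  obtain ⟨c, h3, h4, -⟩ := J.mem_chordsOf.1 hv
  rw [hpos u b h1 h2, hpos v c h3 h4] at h
  exact (J.label_inj.1 h).1

theorem chordsOf_chordAt {i j : Fin k} (hij : i ≠ j) {Y : Finset (Fin n)}
    (hY : Y ⊆ J.between i j) : J.chordsOf i j (J.ChordAt Y) = Y := by
  ext v
  simp only [mem_chordsOf, chordAt_label]
  constructor
  · rintro ⟨b, -, -, h⟩; exact h
  · intro h
    obtain ⟨b, h1, h2⟩ := (J.mem_between hij).1 (hY h)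
    exact ⟨b, h1, h2, h⟩

open scoped Classical in
/-- The minimum set computed by the dynamic program. -/
noncomputable def optSub (O : Finset (Fin n)) (i j : Fin k) : Finset (Fin n) :=
  J.chordsOf i j (OptTakes (2 * n) (J.HasAt i j) (J.ChordAt (J.closedNbhd O)ᶜ) J.otherAt)

theorem isMinSub_optSub (hk : 3 ≤ k) (O : Finset (Fin n)) {i j : Fin k} (hij : i < j) :
    J.IsMinSub O i j (J.optSub O i j) := by
  classical
  have key : ∀ Y : Finset (Fin n), Y ⊆ J.between i j → J.undominated O i j ⊆ J.closedNbhd Y →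
      J.undominated O i j ⊆ J.closedNbhd (J.optSub O i j) ∧ (J.optSub O i j).card ≤ Y.card := by
    intro Y hY hO
    have hd := J.chordsOf_chordAt hij.ne hY
    rw [← hd, ← J.forall_not_pending_iff hk hij] at hO
    obtain ⟨h1, h2⟩ := optTakes_spec (J.otherAt_spec (i := i) (j := j)) _ hO
    rw [J.takenAfter_eq_card hij.ne, J.takenAfter_eq_card hij.ne, hd] at h2
    exact ⟨(J.forall_not_pending_iff hk hij).1 h1, h2⟩
  have hsub : J.optSub O i j ⊆ J.between i j := by
    intro v hv
    obtain ⟨b, h1, h2, -⟩ := J.mem_chordsOf.1 hv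
    exact (J.mem_between hij.ne).2 ⟨b, h1, h2⟩
  -- The set of all chords between the two sides is admissible, so a solution exists and the optimal
  -- one is admissible, too.
  refine ⟨⟨hsub, (key (J.between i j) (Finset.Subset.refl _) fun v hv => ?_).1⟩,
    fun Y hY hO => (key Y hY hO).2⟩
  exact (J.mem_closedNbhd hk).2
    ⟨v, (Finset.mem_sdiff.1 hv).1, linkNum_self (J.label_zero_ne_one _)⟩

end PolygonModel

/-! ### A language with expressions, arrays and bounded loops, compiled to the word RAM -/

namespace ArrayLang

/-- Expressions: variables, constants, operations, array cells, conditional expressions, sums. -/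
inductive Expr where
  | var (x : ℕ)
  | lit (c : ℕ)
  | op (o : WordRAM.Op) (a b : Expr)
  /-- cell `i` of array `α` -/
  | rd (α : Fin 16) (i : Expr)
  /-- if `a < b` then `p` else `q` -/
  | sel (a b p q : Expr)
  /-- the sum of `e` over all values `< N` of the variable `x` -/
  | sum (x : ℕ) (N e : Expr)

/-- Values of the variables and arrays, and the output written so far. -/
structure Env where
  var : ℕ → ℕ
  arr : Fin 16 → ℕ → ℕ
  out : List ℕ

namespace Env

/-- Assign a value to a variable. -/
def setVar (s : Env) (x v : ℕ) : Env := { s with var := Function.update s.var x v }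

/-- Assign a value to an array cell. -/
def setArr (s : Env) (α : Fin 16) (i v : ℕ) : Env :=
  { s with arr := Function.update s.arr α (Function.update (s.arr α) i v) }

/-- Append a value to the output. -/
def emit (s : Env) (v : ℕ) : Env := { s with out := s.out ++ [v] }

/-- All values are at most `M`. -/
def Le (M : ℕ) (s : Env) : Prop := (∀ x, s.var x ≤ M) ∧ ∀ α i, s.arr α i ≤ M

@[simp] theorem setVar_var (s : Env) (x v y : ℕ) :
    (s.setVar x v).var y = if y = x then v else s.var y := Function.update_apply ..

@[simp] theorem setVar_arr (s : Env) (x v : ℕ) : (s.setVar x v).arr = s.arr := rfl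

@[simp] theorem setVar_out (s : Env) (x v : ℕ) : (s.setVar x v).out = s.out := rfl

@[simp] theorem setArr_var (s : Env) (α : Fin 16) (i v : ℕ) : (s.setArr α i v).var = s.var := rfl

@[simp] theorem setArr_out (s : Env) (α : Fin 16) (i v : ℕ) : (s.setArr α i v).out = s.out := rfl

@[simp] theorem setArr_arr (s : Env) (α : Fin 16) (i v : ℕ) (β : Fin 16) (j : ℕ) :
    (s.setArr α i v).arr β j = if β = α ∧ j = i then v else s.arr β j := by
  unfold setArr
  by_cases h : β = α
  · subst h; simp [Function.update_apply]
  · simp [h]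

@[simp] theorem emit_var (s : Env) (v : ℕ) : (s.emit v).var = s.var := rfl

@[simp] theorem emit_arr (s : Env) (v : ℕ) : (s.emit v).arr = s.arr := rfl

@[simp] theorem emit_out (s : Env) (v : ℕ) : (s.emit v).out = s.out ++ [v] := rfl

theorem Le.setVar {M : ℕ} {s : Env} (h : s.Le M) {x v : ℕ} (hv : v ≤ M) : (s.setVar x v).Le M := by
  refine ⟨fun y => ?_, h.2⟩
  rw [setVar_var]; split_ifs; exacts [hv, h.1 y]

theorem Le.setArr {M : ℕ} {s : Env} (h : s.Le M) {α : Fin 16} {i v : ℕ} (hv : v ≤ M) :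
    (s.setArr α i v).Le M := by
  refine ⟨h.1, fun β j => ?_⟩
  rw [setArr_arr]; split_ifs; exacts [hv, h.2 β j]

theorem Le.mono {M M' : ℕ} {s : Env} (h : s.Le M) (hM : M ≤ M') : s.Le M' :=
  ⟨fun x => (h.1 x).trans hM, fun α i => (h.2 α i).trans hM⟩

end Env

namespace Expr

/-- The value of an expression. -/
def eval : Expr → Env → ℕ
  | var x, s => s.var x
  | lit c, _ => c
  | op o a b, s => o.eval (a.eval s) (b.eval s)
  | rd α i, s => s.arr α (i.eval s)
  | sel a b p q, s => if a.eval s < b.eval s then p.eval s else q.eval s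
  | sum x N e, s => ∑ i ∈ Finset.range (N.eval s), e.eval (s.setVar x i)

/-- A bound for the running time of the evaluation. -/
def cost : Expr → Env → ℕ
  | var _, _ => 1
  | lit _, _ => 1
  | op _ a b, s => a.cost s + b.cost s + 1
  | rd _ i, s => i.cost s + 5
  | sel a b p q, s => a.cost s + b.cost s + p.cost s + q.cost s + 1
  | sum x N e, s => N.cost s + ∑ i ∈ Finset.range (N.eval s), (e.cost (s.setVar x i) + 4) + 6

/-- A bound for all numbers that occur in the evaluation, if all variables and array cells are at
most `M` and the arrays start at address `base ≤ M`. -/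
def bnd : Expr → ℕ → ℕ
  | var _, M => M
  | lit c, _ => c
  | op _ a b, M => (a.bnd M + 1) * (b.bnd M + 1)
  | rd _ i, M => 2 * M + 16 * i.bnd M + 16
  | sel a b p q, M => a.bnd M + b.bnd M + p.bnd M + q.bnd M
  | sum _ N e, M => (N.bnd M + 1) * (e.bnd (M + N.bnd M) + 1) + N.bnd M + M + 1

/-- Code that evaluates the expression into the register for the temporary number `d`. -/
def comp : Expr → ℕ → WordRAM.Cmd
  -- Register `2 x` holds variable `x`, and temporary `d` is register `2 d + 1`. Registers `1`, `3`,
  -- `5`, `7` hold the base address of the arrays and the constants `0`, `1`, `16`; so the addition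
  -- of register `3` is a copy. Cell `i` of array `α` has the address `base + 16 i + α`.
  | var x, d => .arith .add (2 * d + 1) (2 * x) 3
  | lit c, d => .const (2 * d + 1) c
  | op o a b, d =>
    .seq (a.comp d) (.seq (b.comp (d + 1)) (.arith o (2 * d + 1) (2 * d + 1) (2 * d + 3)))
  | rd α i, d =>
    .seq (i.comp d) (.seq (.arith .mul (2 * d + 1) (2 * d + 1) 7)
      (.seq (.arith .add (2 * d + 1) 1 (2 * d + 1)) (.seq (.const (2 * d + 3) α)
        (.seq (.arith .add (2 * d + 1) (2 * d + 1) (2 * d + 3)) (.load (2 * d + 1) (2 * d + 1))))))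
  | sel a b p q, d =>
    .seq (a.comp d) (.seq (b.comp (d + 1))
      (.ite (2 * d + 1) (2 * d + 3) (p.comp d) (q.comp d)))
  | sum x N e, d =>
    -- Four temporaries are in use: the number of terms, the partial sum, the counter, and the old
    -- value of `x`, which is restored at the end because evaluation must not change variables. The
    -- summand works from temporary `d + 4` on.
    .seq (N.comp d) (.seq (.const (2 * d + 3) 0) (.seq (.const (2 * d + 5) 0)
      (.seq (.arith .add (2 * d + 7) (2 * x) 3)
        (.seq (.loop (2 * d + 5) (2 * d + 1)
          (.seq (.arith .add (2 * x) (2 * d + 5) 3) (.seq (e.comp (d + 4))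
            (.seq (.arith .add (2 * d + 3) (2 * d + 3) (2 * d + 9))
              (.arith .add (2 * d + 5) (2 * d + 5) 5)))))
          (.seq (.arith .add (2 * x) (2 * d + 7) 3)
            (.arith .add (2 * d + 1) (2 * d + 3) 3))))))

theorem op_eval_le (o : WordRAM.Op) (x y : ℕ) : o.eval x y ≤ x * y + x + y := by
  cases o <;> simp only [WordRAM.Op.eval]
  · nlinarith
  · omega
  · omega
  · exact (Nat.div_le_self x y).trans (by nlinarith)
  · exact (Nat.mod_le x y).trans (by nlinarith)

theorem op_eval_lt {o : WordRAM.Op} {x y X Y : ℕ} (hx : x ≤ X) (hy : y ≤ Y) :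
    o.eval x y < (X + 1) * (Y + 1) := by
  have := op_eval_le o x y
  nlinarith [Nat.mul_le_mul hx hy]

theorem eval_le_bnd (e : Expr) {M : ℕ} {s : Env} (h : s.Le M) : e.eval s ≤ e.bnd M := by
  induction e generalizing s M with
  | var x => exact h.1 x
  | lit c => exact le_rfl
  | op o a b iha ihb => exact (op_eval_lt (iha h) (ihb h)).le
  | rd α i ih => exact (h.2 α _).trans (by simp only [bnd]; omega)
  | sel a b p q iha ihb ihp ihq =>
    have := ihp h
    have := ihq h
    simp only [eval, bnd]
    split_ifs <;> omega
  | sum x N e ihN ihe =>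
    have hN := ihN h
    have : ∀ i ∈ Finset.range (N.eval s), e.eval (s.setVar x i) ≤ e.bnd (M + N.bnd M) := by
      intro i hi
      rw [Finset.mem_range] at hi
      exact ihe ((h.mono (by omega)).setVar (by omega))
    have h2 := Finset.sum_le_card_nsmul _ _ _ this
    rw [Finset.card_range, smul_eq_mul] at h2
    simp only [eval, bnd]
    nlinarith [Nat.mul_le_mul_right (e.bnd (M + N.bnd M)) hN]

end Expr

/-! ### Rules for the word RAM, and correctness of compiled expressions -/

open WordRAM

/-- `p`, started in `s`, halts after at most `T` steps in a state with property `Q`. -/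
def Halts (B : ℕ) (p : Cmd) (s : State) (T : ℕ) (Q : State → Prop) : Prop :=
  ∃ t s', Exec B p s t s' ∧ t ≤ T ∧ Q s'

namespace Halts

variable {B : ℕ} {p q : Cmd} {s : State} {T T₁ T₂ : ℕ} {Q R : State → Prop}

theorem mono (h : Halts B p s T₁ R) (hT : T₁ ≤ T) (hQ : ∀ s', R s' → Q s') : Halts B p s T Q := by
  obtain ⟨t, s', h1, h2, h3⟩ := h
  exact ⟨t, s', h1, h2.trans hT, hQ _ h3⟩

theorem seq (h : Halts B p s T₁ R) (h' : ∀ s', R s' → Halts B q s' T₂ Q) :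
    Halts B (.seq p q) s (T₁ + T₂) Q := by
  obtain ⟨t, s', h1, h2, h3⟩ := h
  obtain ⟨t', s'', h1', h2', h3'⟩ := h' s' h3
  exact ⟨_, _, .seq h1 h1', by omega, h3'⟩

theorem const {r v : ℕ} (hv : v < B) (h : Q (s.setReg r v)) : Halts B (.const r v) s 1 Q :=
  ⟨1, _, .const s r v, le_rfl, by rwa [Nat.mod_eq_of_lt hv]⟩

theorem arith {o : Op} {r a b : ℕ} (hv : o.eval (s.reg a) (s.reg b) < B)
    (h : Q (s.setReg r (o.eval (s.reg a) (s.reg b)))) : Halts B (.arith o r a b) s 1 Q :=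
  ⟨1, _, .arith s o r a b, le_rfl, by rwa [Nat.mod_eq_of_lt hv]⟩

theorem load {r a : ℕ} (h : Q (s.setReg r (s.mem (s.reg a)))) : Halts B (.load r a) s 1 Q :=
  ⟨1, _, .load s r a, le_rfl, h⟩

theorem store {r a : ℕ}
    (h : Q { s with mem := Function.update s.mem (s.reg a) (s.reg r) }) :
    Halts B (.store a r) s 1 Q :=
  ⟨1, _, .store s a r, le_rfl, h⟩

theorem emit {r : ℕ} (h : Q { s with out := s.out ++ [s.reg r] }) : Halts B (.emit r) s 1 Q :=
  ⟨1, _, .emit s r, le_rfl, h⟩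

theorem ite {a b : ℕ} (h : s.reg a < s.reg b → Halts B p s T Q)
    (h' : ¬ s.reg a < s.reg b → Halts B q s T Q) : Halts B (.ite a b p q) s (T + 1) Q := by
  by_cases hc : s.reg a < s.reg b
  · obtain ⟨t, s', h1, h2, h3⟩ := h hc
    exact ⟨_, _, .iteTrue hc h1, by omega, h3⟩
  · obtain ⟨t, s', h1, h2, h3⟩ := h' hc
    exact ⟨_, _, .iteFalse hc h1, by omega, h3⟩

/-- Induction on the number of remaining rounds. Each round costs its body and one test; the last
`1` is the test that fails. -/
theorem loop {a b : ℕ} (I : ℕ → State → Prop) {N : ℕ} (f : ℕ → ℕ)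
    (hI : ∀ i s, i ≤ N → I i s → s.reg a = i ∧ s.reg b = N)
    (hp : ∀ i s, i < N → I i s → Halts B p s (f i) (I (i + 1))) (h0 : I 0 s) :
    Halts B (.loop a b p) s (∑ i ∈ Finset.range N, (f i + 1) + 1) (I N) := by
  suffices H : ∀ y i s, i + y = N → I i s →
      Halts B (.loop a b p) s (∑ j ∈ Finset.Ico i N, (f j + 1) + 1) (I N) by
    simpa using H N 0 s (by omega) h0
  intro y
  induction y with
  | zero =>
    intro i s hi h
    obtain rfl : i = N := by omega
    obtain ⟨h1, h2⟩ := hI i s le_rfl h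
    exact ⟨1, s, .loopFalse (by omega), by simp, h⟩
  | succ y ih =>
    intro i s hi h
    obtain ⟨h1, h2⟩ := hI i s (by omega) h
    obtain ⟨t, s', h3, h4, h5⟩ := hp i s (by omega) h
    obtain ⟨t', s'', h3', h4', h5'⟩ := ih (i + 1) s' (by omega) h5
    refine ⟨_, _, .loopTrue (by omega) h3 h3', ?_, h5'⟩
    rw [Finset.sum_eq_sum_Ico_succ_bot (by omega)]
    omega

end Halts

/-- The RAM state represents the environment, with the arrays interleaved from address `base`. -/
structure Rel (base : ℕ) (s : Env) (σ : State) : Prop where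
  var_eq : ∀ x, σ.reg (2 * x) = s.var x
  base_eq : σ.reg 1 = base
  zero : σ.reg 3 = 0
  one : σ.reg 5 = 1
  sixteen : σ.reg 7 = 16
  arr_eq : ∀ (α : Fin 16) i, σ.mem (base + 16 * i + (α : ℕ)) = s.arr α i
  out_eq : σ.out = s.out

/-- Nothing has changed but temporaries from number `d` on. -/
structure Keeps (d : ℕ) (σ σ' : State) : Prop where
  reg : ∀ r, r % 2 = 0 ∨ r < 2 * d + 1 → σ'.reg r = σ.reg r
  mem : σ'.mem = σ.mem
  out : σ'.out = σ.out

theorem setReg_reg (s : State) (r v q : ℕ) :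
    (s.setReg r v).reg q = if q = r then v else s.reg q := Function.update_apply ..

@[simp] theorem setReg_same (s : State) (r v : ℕ) : (s.setReg r v).reg r = v := by
  simp [setReg_reg]

theorem setReg_ne {s : State} {r v q : ℕ} (h : q ≠ r) : (s.setReg r v).reg q = s.reg q := by
  simp [setReg_reg, h]

@[simp] theorem setReg_mem (s : State) (r v : ℕ) : (s.setReg r v).mem = s.mem := rfl

@[simp] theorem setReg_out (s : State) (r v : ℕ) : (s.setReg r v).out = s.out := rfl

namespace Keeps

variable {d : ℕ} {σ σ' σ'' : State}

theorem refl (d : ℕ) (σ : State) : Keeps d σ σ := ⟨fun _ _ => rfl, rfl, rfl⟩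

theorem trans (h : Keeps d σ σ') (h' : Keeps d σ' σ'') : Keeps d σ σ'' :=
  ⟨fun r hr => (h'.reg r hr).trans (h.reg r hr), h'.mem.trans h.mem, h'.out.trans h.out⟩

theorem mono {d' : ℕ} (h : Keeps d' σ σ') (hd : d ≤ d') : Keeps d σ σ' :=
  ⟨fun r hr => h.reg r (by omega), h.mem, h.out⟩

theorem setReg (h : Keeps d σ σ') {r v : ℕ} (hr : r % 2 = 1) (hr' : 2 * d + 1 ≤ r) :
    Keeps d σ (σ'.setReg r v) :=
  ⟨fun q hq => (setReg_ne (by omega)).trans (h.reg q hq), h.mem, h.out⟩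

/-- While a sum is evaluated, the register `q` of the summation variable is modified. So
preservation is asserted for the state with `q` reset, and this lemma carries the assertion across
one evaluation of the summand. -/
theorem patch {d' q v w : ℕ} (h : Keeps d σ (σ'.setReg q v)) (h' : Keeps d' (σ'.setReg q w) σ'')
    (hd : d ≤ d') : Keeps d σ (σ''.setReg q v) := by
  refine ⟨fun r hr => ?_, h'.mem.trans h.mem, h'.out.trans h.out⟩
  rw [← h.reg r hr, setReg_reg, setReg_reg]
  split_ifs with hq
  · rfl
  · rw [h'.reg r (by omega), setReg_ne hq]

theorem setReg_patch {q v r w : ℕ} (h : Keeps d σ (σ'.setReg q v)) (hr : r % 2 = 1)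
    (hr' : 2 * d + 1 ≤ r) : Keeps d σ ((σ'.setReg r w).setReg q v) := by
  refine ⟨fun p hp => ?_, h.mem, h.out⟩
  rw [← h.reg p hp]
  by_cases hq : p = q
  · rw [hq, setReg_same, setReg_same]
  · rw [setReg_ne hq, setReg_ne hq, setReg_ne (by omega)]

end Keeps

namespace Rel

variable {base d : ℕ} {s : Env} {σ σ' : State}

theorem of_keeps (h : Rel base s σ) (hk : Keeps d σ σ') (hd : 4 ≤ d) : Rel base s σ' where
  var_eq x := (hk.reg _ (by omega)).trans (h.var_eq x)
  base_eq := (hk.reg _ (by omega)).trans h.base_eq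
  zero := (hk.reg _ (by omega)).trans h.zero
  one := (hk.reg _ (by omega)).trans h.one
  sixteen := (hk.reg _ (by omega)).trans h.sixteen
  arr_eq α i := by rw [hk.mem, h.arr_eq]
  out_eq := hk.out.trans h.out_eq

theorem setVar (h : Rel base s σ) (x v : ℕ) : Rel base (s.setVar x v) (σ.setReg (2 * x) v) where
  var_eq y := by
    rw [setReg_reg, Env.setVar_var, h.var_eq]
    exact if_congr (by omega) rfl rfl
  base_eq := (setReg_ne (by omega)).trans h.base_eq
  zero := (setReg_ne (by omega)).trans h.zero
  one := (setReg_ne (by omega)).trans h.one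
  sixteen := (setReg_ne (by omega)).trans h.sixteen
  arr_eq α i := h.arr_eq α i
  out_eq := h.out_eq

theorem setReg (h : Rel base s σ) {r v : ℕ} (hr : r % 2 = 1) (hr' : 9 ≤ r) :
    Rel base s (σ.setReg r v) :=
  h.of_keeps (d := 4) ((Keeps.refl 4 σ).setReg hr (by omega)) le_rfl

end Rel

namespace Expr

/-- Since `e.bnd M` bounds all intermediate values and addresses, no reduction modulo `B` takes
effect and machine arithmetic is exact. Temporaries start at `4`, which protects the four reserved
registers. -/
theorem halts_comp {B base : ℕ} (hB : 17 ≤ B) (e : Expr) {M d : ℕ} (hd : 4 ≤ d) {s : Env}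
    {σ : State} (hr : Rel base s σ) (hs : s.Le M) (hbase : base ≤ M) (hb : e.bnd M < B) :
    Halts B (e.comp d) σ (e.cost s) fun σ' => σ'.reg (2 * d + 1) = e.eval s ∧ Keeps d σ σ' := by
  induction e generalizing s σ M d with
  | var x =>
    have hv : Op.add.eval (σ.reg (2 * x)) (σ.reg 3) = s.var x := by
      simp [Op.eval, hr.var_eq, hr.zero]
    refine Halts.arith ?_ ?_
    · rw [hv]; exact (hs.1 x).trans_lt hb
    · exact ⟨by simp [hv, eval], (Keeps.refl d σ).setReg (by omega) le_rfl⟩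
  | lit c =>
    exact Halts.const hb ⟨by simp [eval], (Keeps.refl d σ).setReg (by omega) le_rfl⟩
  | op o a b iha ihb =>
    have ea := eval_le_bnd a hs
    have eb := eval_le_bnd b hs
    simp only [bnd] at hb
    have h1 : a.bnd M < B := by nlinarith
    have h2 : b.bnd M < B := by nlinarith
    refine Halts.mono (Halts.seq (iha hd hr hs hbase h1) fun σ1 ⟨v1, k1⟩ => Halts.seq
      (ihb (d := d + 1) (by omega) (hr.of_keeps k1 hd) hs hbase h2) fun σ2 ⟨v2, k2⟩ =>
      Halts.arith (Q := fun σ' => σ'.reg (2 * d + 1) = (op o a b).eval s ∧ Keeps d σ σ') ?_ ?_)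
      le_rfl fun _ h => h
    all_goals
      rw [show 2 * d + 3 = 2 * (d + 1) + 1 by ring, v2, k2.reg (2 * d + 1) (by omega), v1]
    · exact (op_eval_lt ea eb).trans hb
    · exact ⟨by simp [eval], (k1.trans (k2.mono (by omega))).setReg (by omega) le_rfl⟩
  | rd α i ih =>
    have ei := eval_le_bnd i hs
    simp only [bnd] at hb
    refine Halts.mono (Halts.seq (ih hd hr hs hbase (by omega)) fun σ1 ⟨v1, k1⟩ =>
      Halts.seq (Halts.arith (Q := fun σ2 => σ2.reg (2 * d + 1) = 16 * i.eval s ∧ Keeps d σ σ2)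
        ?_ ?_) fun σ2 ⟨v2, k2⟩ =>
      Halts.seq (Halts.arith (Q := fun σ3 => σ3.reg (2 * d + 1) = base + 16 * i.eval s ∧
        Keeps d σ σ3) ?_ ?_) fun σ3 ⟨v3, k3⟩ =>
      Halts.seq (Halts.const (Q := fun σ4 => σ4.reg (2 * d + 1) = base + 16 * i.eval s ∧
        σ4.reg (2 * d + 3) = α ∧ Keeps d σ σ4) ?_ ?_) fun σ4 ⟨v4, v4', k4⟩ =>
      Halts.seq (Halts.arith (Q := fun σ5 => σ5.reg (2 * d + 1) = base + 16 * i.eval s + α ∧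
        Keeps d σ σ5) ?_ ?_) fun σ5 ⟨v5, k5⟩ =>
      Halts.load (Q := fun σ' => σ'.reg (2 * d + 1) = (rd α i).eval s ∧ Keeps d σ σ') ?_)
      le_rfl fun _ h => h
    · rw [k1.reg 7 (by omega), hr.sixteen, v1]; simp only [Op.eval]; omega
    · rw [k1.reg 7 (by omega), hr.sixteen, v1]
      exact ⟨by simp [Op.eval, mul_comm], k1.setReg (by omega) le_rfl⟩
    · rw [k2.reg 1 (by omega), hr.base_eq, v2]; simp only [Op.eval]; omega
    · rw [k2.reg 1 (by omega), hr.base_eq, v2]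
      exact ⟨by simp [Op.eval], k2.setReg (by omega) le_rfl⟩
    · have := α.isLt; omega
    · exact ⟨(setReg_ne (by omega)).trans v3, by simp, k3.setReg (by omega) (by omega)⟩
    · rw [v4, v4']; have := α.isLt; simp only [Op.eval]; omega
    · rw [v4, v4']
      exact ⟨by simp [Op.eval], k4.setReg (by omega) le_rfl⟩
    · rw [v5, k5.mem, hr.arr_eq]
      exact ⟨by simp [eval], k5.setReg (by omega) le_rfl⟩
  | sel a b p q iha ihb ihp ihq =>
    simp only [bnd] at hb
    refine Halts.mono (Halts.seq (iha hd hr hs hbase (by omega)) fun σ1 ⟨v1, k1⟩ => Halts.seq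
      (ihb (d := d + 1) (by omega) (hr.of_keeps k1 hd) hs hbase (by omega)) fun σ2 ⟨v2, k2⟩ =>
      Halts.ite (T := p.cost s + q.cost s)
        (Q := fun σ' => σ'.reg (2 * d + 1) = (sel a b p q).eval s ∧ Keeps d σ σ') ?_ ?_)
      (by simp only [cost]; omega) fun _ h => h
    all_goals
      rw [show 2 * d + 3 = 2 * (d + 1) + 1 by ring, v2, k2.reg (2 * d + 1) (by omega), v1]
      have k3 := k1.trans (k2.mono (by omega))
      intro hc
    · refine Halts.mono (ihp hd (hr.of_keeps k3 hd) hs hbase (by omega)) (by omega) ?_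
      exact fun σ3 h => ⟨by simp [eval, hc, h.1], k3.trans h.2⟩
    · refine Halts.mono (ihq hd (hr.of_keeps k3 hd) hs hbase (by omega)) (by omega) ?_
      exact fun σ3 h => ⟨by simp [eval, hc, h.1], k3.trans h.2⟩
  | sum x N e ihN ihe =>
    have eN := eval_le_bnd N hs
    have esum := eval_le_bnd (sum x N e) hs
    simp only [bnd] at hb esum
    have hbe : e.bnd (M + N.bnd M) < B := by nlinarith
    have hbN : N.bnd M + 1 < B := by nlinarith
    have hM : ∀ i, i < N.eval s → (s.setVar x i).Le (M + N.bnd M) := fun i hi =>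
      (hs.mono (by omega)).setVar (by omega)
    have hx : s.var x < B := (hs.1 x).trans_lt (by nlinarith)
    -- Partial sums are at most the full sum, as all terms are natural numbers, so the accumulator
    -- does not overflow.
    have hpart : ∀ i, i ≤ N.eval s → ∑ j ∈ Finset.range i, e.eval (s.setVar x j) < B := by
      intro i hi
      refine (Finset.sum_le_sum_of_subset (Finset.range_mono hi)).trans_lt ?_
      exact esum.trans_lt hb
    let I : ℕ → State → Prop := fun i σ' => (σ'.reg (2 * d + 1) = N.eval s ∧
      σ'.reg (2 * d + 3) = ∑ j ∈ Finset.range i, e.eval (s.setVar x j)) ∧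
      (σ'.reg (2 * d + 5) = i ∧ σ'.reg (2 * d + 7) = s.var x) ∧
      Keeps d σ (σ'.setReg (2 * x) (s.var x))
    refine Halts.mono (Halts.seq (ihN hd hr hs hbase (by omega)) fun σ1 ⟨v1, k1⟩ =>
      Halts.seq (Halts.const (Q := fun σ2 => σ2.reg (2 * d + 1) = N.eval s ∧
        σ2.reg (2 * d + 3) = 0 ∧ Keeps d σ σ2) (by omega) ?_) fun σ2 ⟨v2, w2, k2⟩ =>
      Halts.seq (Halts.const (Q := fun σ3 => σ3.reg (2 * d + 1) = N.eval s ∧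
        σ3.reg (2 * d + 3) = 0 ∧ σ3.reg (2 * d + 5) = 0 ∧ Keeps d σ σ3) (by omega) ?_)
        fun σ3 ⟨v3, w3, u3, k3⟩ =>
      Halts.seq (Halts.arith (Q := I 0) ?_ ?_) fun σ4 h4 =>
      Halts.seq (Halts.loop I (fun i => 1 + (e.cost (s.setVar x i) + (1 + 1)))
        (fun i σ' _ h => ⟨h.2.1.1, h.1.1⟩) ?_ h4) fun σ5 h5 =>
      Halts.seq (Halts.arith (Q := fun σ6 => σ6.reg (2 * d + 3) =
        ∑ j ∈ Finset.range (N.eval s), e.eval (s.setVar x j) ∧ Keeps d σ σ6) ?_ ?_)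
        fun σ6 ⟨v6, k6⟩ =>
      Halts.arith (Q := fun σ' => σ'.reg (2 * d + 1) = (sum x N e).eval s ∧ Keeps d σ σ') ?_ ?_)
      ?_ fun _ h => h
    · exact ⟨(setReg_ne (by omega)).trans v1, by simp, k1.setReg (by omega) (by omega)⟩
    · exact ⟨(setReg_ne (by omega)).trans v2, (setReg_ne (by omega)).trans w2, by simp,
        k2.setReg (by omega) (by omega)⟩
    · rw [k3.reg (2 * x) (by omega), k3.reg 3 (by omega), hr.var_eq, hr.zero]
      simpa [Op.eval] using hx
    · rw [k3.reg (2 * x) (by omega), k3.reg 3 (by omega), hr.var_eq, hr.zero]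
      refine ⟨⟨(setReg_ne (by omega)).trans v3, (setReg_ne (by omega)).trans w3⟩,
        ⟨(setReg_ne (by omega)).trans u3, by simp [Op.eval]⟩, ?_⟩
      have k4 := k3.setReg (r := 2 * d + 7) (v := Op.add.eval (s.var x) 0) (by omega) (by omega)
      refine ⟨fun r hr' => ?_, k4.mem, k4.out⟩
      rw [setReg_reg]
      split_ifs with h
      · rw [h, hr.var_eq]
      · exact k4.reg r hr'
    · rintro i σ4 hi ⟨⟨v4, a4⟩, ⟨c4, x4⟩, k4⟩
      have z4 : σ4.reg 3 = 0 := by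
        rw [← setReg_ne (show 3 ≠ 2 * x by omega), k4.reg 3 (by omega), hr.zero]
      have o4 : σ4.reg 5 = 1 := by
        rw [← setReg_ne (show 5 ≠ 2 * x by omega), k4.reg 5 (by omega), hr.one]
      -- The state with `x` reset represents `s`; overwriting `x` in it is the same as overwriting
      -- `x` in the actual state.
      have r5 : Rel base (s.setVar x i) (σ4.setReg (2 * x) i) := by
        have := (hr.of_keeps k4 hd).setVar x i
        rwa [show (σ4.setReg (2 * x) (s.var x)).setReg (2 * x) i = σ4.setReg (2 * x) i by
          simp [State.setReg]] at this
      refine Halts.seq (Halts.arith (Q := fun σ5 => σ5 = σ4.setReg (2 * x) i) ?_ ?_) ?_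
      · rw [c4, z4]; simp only [Op.eval]; omega
      · rw [c4, z4]; rfl
      rintro _ rfl
      refine Halts.seq (ihe (d := d + 4) (by omega) r5 (hM i hi) (by omega) hbe) ?_
      rintro σ6 ⟨v6, k6⟩
      have k6' : Keeps d σ (σ6.setReg (2 * x) (s.var x)) := k4.patch k6 (by omega)
      have q6 : ∀ r, r % 2 = 1 → r < 2 * d + 9 → σ6.reg r = σ4.reg r := fun r h h' => by
        rw [k6.reg r (by omega), setReg_ne (by omega)]
      refine Halts.seq (Halts.arith (Q := fun σ7 => (σ7.reg (2 * d + 1) = N.eval s ∧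
        σ7.reg (2 * d + 3) = ∑ j ∈ Finset.range (i + 1), e.eval (s.setVar x j)) ∧
        (σ7.reg (2 * d + 5) = i ∧ σ7.reg (2 * d + 7) = s.var x) ∧ σ7.reg 5 = 1 ∧
        Keeps d σ (σ7.setReg (2 * x) (s.var x))) ?_ ?_) ?_
      · rw [q6 _ (by omega) (by omega), a4, show 2 * d + 9 = 2 * (d + 4) + 1 by ring, v6]
        have := hpart (i + 1) hi
        rwa [Finset.sum_range_succ] at this
      · rw [q6 _ (by omega) (by omega), a4, show 2 * d + 9 = 2 * (d + 4) + 1 by ring, v6]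
        refine ⟨⟨?_, ?_⟩, ⟨?_, ?_⟩, ?_, ?_⟩
        · rw [setReg_ne (by omega), q6 _ (by omega) (by omega), v4]
        · rw [setReg_same, Finset.sum_range_succ]; rfl
        · rw [setReg_ne (by omega), q6 _ (by omega) (by omega), c4]
        · rw [setReg_ne (by omega), q6 _ (by omega) (by omega), x4]
        · rw [setReg_ne (by omega), q6 _ (by omega) (by omega), o4]
        · exact k6'.setReg_patch (by omega) (by omega)
      · rintro σ7 ⟨⟨v7, a7⟩, ⟨c7, x7⟩, o7, k7⟩
        refine Halts.arith ?_ ?_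
        · rw [c7, o7]; simp only [Op.eval]; omega
        · rw [c7, o7]
          exact ⟨⟨(setReg_ne (by omega)).trans v7, (setReg_ne (by omega)).trans a7⟩,
            ⟨by simp [Op.eval], (setReg_ne (by omega)).trans x7⟩,
            k7.setReg_patch (by omega) (by omega)⟩
    · have z5 : σ5.reg 3 = 0 := by
        rw [← setReg_ne (show 3 ≠ 2 * x by omega), h5.2.2.reg 3 (by omega), hr.zero]
      rw [h5.2.1.2, z5]
      simpa [Op.eval] using hx
    · have z5 : σ5.reg 3 = 0 := by
        rw [← setReg_ne (show 3 ≠ 2 * x by omega), h5.2.2.reg 3 (by omega), hr.zero]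
      rw [h5.2.1.2, z5]
      exact ⟨(setReg_ne (by omega)).trans h5.1.2, h5.2.2⟩
    · rw [v6, k6.reg 3 (by omega), hr.zero]
      simpa [Op.eval] using hpart _ le_rfl
    · rw [v6, k6.reg 3 (by omega), hr.zero]
      exact ⟨by simp [eval, Op.eval], k6.setReg (by omega) le_rfl⟩
    · simp only [cost]
      have : ∀ i, 1 + (e.cost (s.setVar x i) + (1 + 1)) + 1 = e.cost (s.setVar x i) + 4 := by
        intro i; omega
      simp only [this]
      omega

end Expr

end ArrayLang

/-! ### Statements and their compilation -/

namespace ArrayLang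

open WordRAM

/-- Statements. -/
inductive Stmt where
  | assign (x : ℕ) (e : Expr)
  /-- cell `i` of array `α` becomes `e` -/
  | write (α : Fin 16) (i e : Expr)
  | emit (e : Expr)
  | seq (p q : Stmt)
  /-- if `a < b` then `p` -/
  | when (a b : Expr) (p : Stmt)
  /-- `p` for all values `< N` of the variable `x` -/
  | loop (x : ℕ) (N : Expr) (p : Stmt)

/-- Apply `f 0`, …, `f (n - 1)`. -/
def iter (f : ℕ → Env → Env) : ℕ → Env → Env
  | 0, s => s
  | n + 1, s => f n (iter f n s)

namespace Stmt

/-- The effect of a statement. -/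
def run : Stmt → Env → Env
  | assign x e, s => s.setVar x (e.eval s)
  | write α i e, s => s.setArr α (i.eval s) (e.eval s)
  | emit e, s => s.emit (e.eval s)
  | seq p q, s => q.run (p.run s)
  | when a b p, s => if a.eval s < b.eval s then p.run s else s
  | loop x N p, s => iter (fun i s => p.run (s.setVar x i)) (N.eval s) s

/-- A bound for the running time. -/
def cost : Stmt → Env → ℕ
  | assign _ e, s => e.cost s + 1
  | write _ i e, s => i.cost s + e.cost s + 5
  | emit e, s => e.cost s + 1
  | seq p q, s => p.cost s + q.cost (p.run s)
  | when a b p, s => a.cost s + b.cost s + p.cost s + 2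
  | loop x N p, s => N.cost s + ∑ i ∈ Finset.range (N.eval s),
      (p.cost ((iter (fun i s => p.run (s.setVar x i)) i s).setVar x i) + 3) + 2

/-- All assigned values are at most `M`. -/
def Ok (M : ℕ) : Stmt → Env → Prop
  | assign _ e, s => e.eval s ≤ M
  | write _ _ e, s => e.eval s ≤ M
  | emit _, _ => True
  | seq p q, s => p.Ok M s ∧ q.Ok M (p.run s)
  | when a b p, s => a.eval s < b.eval s → p.Ok M s
  | loop x N p, s => N.eval s ≤ M ∧ ∀ i < N.eval s,
      p.Ok M ((iter (fun i s => p.run (s.setVar x i)) i s).setVar x i)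

/-- A bound for all numbers that occur, if variables and array cells are at most `M`. -/
def bnd : Stmt → ℕ → ℕ
  | assign _ e, M => e.bnd M
  | write _ i e, M => 2 * M + 16 * i.bnd M + 16 + e.bnd M
  | emit e, M => e.bnd M
  | seq p q, M => p.bnd M + q.bnd M
  | when a b p, M => a.bnd M + b.bnd M + p.bnd M
  | loop _ N p, M => N.bnd M + p.bnd M + 1

/-- Code for the statement, that does not touch the first `d` temporaries. -/
def comp : Stmt → ℕ → Cmd
  | assign x e, d => .seq (e.comp d) (.arith .add (2 * x) (2 * d + 1) 3)
  | write α i e, d =>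
    .seq (i.comp d) (.seq (.arith .mul (2 * d + 1) (2 * d + 1) 7)
      (.seq (.arith .add (2 * d + 1) 1 (2 * d + 1)) (.seq (.const (2 * d + 3) α)
        (.seq (.arith .add (2 * d + 1) (2 * d + 1) (2 * d + 3))
          (.seq (e.comp (d + 1)) (.store (2 * d + 1) (2 * d + 3)))))))
  | emit e, d => .seq (e.comp d) (.emit (2 * d + 1))
  | seq p q, d => .seq (p.comp d) (q.comp d)
  | when a b p, d =>
    .seq (a.comp d) (.seq (b.comp (d + 1)) (.ite (2 * d + 1) (2 * d + 3) (p.comp d) .skip))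
  | loop x N p, d =>
    .seq (N.comp d) (.seq (.const (2 * d + 3) 0)
      (.loop (2 * d + 3) (2 * d + 1) (.seq (.arith .add (2 * x) (2 * d + 3) 3)
        (.seq (p.comp (d + 2)) (.arith .add (2 * d + 3) (2 * d + 3) 5)))))

theorem cost_pos (p : Stmt) (s : Env) : 0 < p.cost s := by
  induction p generalizing s <;> simp [cost, *]

theorem run_le (p : Stmt) {M : ℕ} {s : Env} (hs : s.Le M) (h : p.Ok M s) : (p.run s).Le M := by
  induction p generalizing s with
  | assign x e => exact hs.setVar h
  | write α i e => exact hs.setArr h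
  | emit e => exact hs
  | seq p q ihp ihq => exact ihq (ihp hs h.1) h.2
  | when a b p ih =>
    simp only [run]
    split_ifs with hc
    · exact ih hs (h hc)
    · exact hs
  | loop x N p ih =>
    have : ∀ i ≤ N.eval s, (iter (fun i s => p.run (s.setVar x i)) i s).Le M := by
      intro i
      induction i with
      | zero => exact fun _ => hs
      | succ i ihi =>
        intro hi
        exact ih ((ihi (by omega)).setVar (by have := h.1; omega)) (h.2 i hi)
    exact this _ le_rfl

theorem iter_le {p : Stmt} {M x : ℕ} {N : Expr} {s : Env} (hs : s.Le M)
    (h : (loop x N p).Ok M s) {i : ℕ} (hi : i ≤ N.eval s) :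
    (iter (fun i s => p.run (s.setVar x i)) i s).Le M := by
  induction i with
  | zero => exact hs
  | succ i ih =>
    exact run_le p ((ih (by omega)).setVar (by have := h.1; omega)) (h.2 i hi)

/-- `Ok` keeps all stored values below `M` throughout the run, so the static bound `p.bnd M`
excludes overflow in every iteration of every loop. The clause on odd registers protects the
counters of the enclosing loops. -/
theorem halts_comp {B base : ℕ} (hB : 17 ≤ B) (p : Stmt) {M d : ℕ} (hd : 4 ≤ d) {s : Env}
    {σ : State} (hr : Rel base s σ) (hs : s.Le M) (hbase : base ≤ M) (hok : p.Ok M s)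
    (hb : p.bnd M < B) :
    Halts B (p.comp d) σ (p.cost s) fun σ' => Rel base (p.run s) σ' ∧
      ∀ r, r % 2 = 1 → r < 2 * d + 1 → σ'.reg r = σ.reg r := by
  induction p generalizing s σ d with
  | assign x e =>
    have ee := e.eval_le_bnd hs
    simp only [bnd] at hb
    refine Halts.mono (Halts.seq (e.halts_comp hB hd hr hs hbase hb) fun σ1 ⟨v1, k1⟩ =>
      Halts.arith (Q := fun σ' => Rel base ((assign x e).run s) σ' ∧
        ∀ r, r % 2 = 1 → r < 2 * d + 1 → σ'.reg r = σ.reg r) ?_ ?_) le_rfl fun _ h => h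
    all_goals rw [v1, k1.reg 3 (by omega), hr.zero]
    · simp only [Op.eval]; omega
    · exact ⟨(hr.of_keeps k1 hd).setVar x _, fun r hr hr' => by
        rw [setReg_ne (by omega), k1.reg r (by omega)]⟩
  | write α i e =>
    have ei := i.eval_le_bnd hs
    simp only [bnd] at hb
    have hα := α.isLt
    refine Halts.mono (Halts.seq (i.halts_comp hB hd hr hs hbase (by omega)) fun σ1 ⟨v1, k1⟩ =>
      Halts.seq (Halts.arith (Q := fun σ2 => σ2.reg (2 * d + 1) = 16 * i.eval s ∧ Keeps d σ σ2)
        ?_ ?_) fun σ2 ⟨v2, k2⟩ =>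
      Halts.seq (Halts.arith (Q := fun σ3 => σ3.reg (2 * d + 1) = base + 16 * i.eval s ∧
        Keeps d σ σ3) ?_ ?_) fun σ3 ⟨v3, k3⟩ =>
      Halts.seq (Halts.const (Q := fun σ4 => σ4.reg (2 * d + 1) = base + 16 * i.eval s ∧
        σ4.reg (2 * d + 3) = α ∧ Keeps d σ σ4) ?_ ?_) fun σ4 ⟨v4, v4', k4⟩ =>
      Halts.seq (Halts.arith (Q := fun σ5 => σ5.reg (2 * d + 1) = base + 16 * i.eval s + α ∧
        Keeps d σ σ5) ?_ ?_) fun σ5 ⟨v5, k5⟩ =>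
      Halts.seq (e.halts_comp hB (d := d + 1) (by omega) (hr.of_keeps k5 hd) hs hbase (by omega))
        fun σ6 ⟨v6, k6⟩ => Halts.store (Q := fun σ' => Rel base ((write α i e).run s) σ' ∧
          ∀ r, r % 2 = 1 → r < 2 * d + 1 → σ'.reg r = σ.reg r) ?_)
      (by simp only [cost]; omega) fun _ h => h
    · rw [k1.reg 7 (by omega), hr.sixteen, v1]; simp only [Op.eval]; omega
    · rw [k1.reg 7 (by omega), hr.sixteen, v1]
      exact ⟨by simp [Op.eval, mul_comm], k1.setReg (by omega) le_rfl⟩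
    · rw [k2.reg 1 (by omega), hr.base_eq, v2]; simp only [Op.eval]; omega
    · rw [k2.reg 1 (by omega), hr.base_eq, v2]
      exact ⟨by simp [Op.eval], k2.setReg (by omega) le_rfl⟩
    · omega
    · exact ⟨(setReg_ne (by omega)).trans v3, by simp, k3.setReg (by omega) (by omega)⟩
    · rw [v4, v4']; simp only [Op.eval]; omega
    · rw [v4, v4']
      exact ⟨by simp [Op.eval], k4.setReg (by omega) le_rfl⟩
    · rw [k6.reg (2 * d + 1) (by omega), v5, show 2 * d + 3 = 2 * (d + 1) + 1 by ring, v6]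
      have r6 := (hr.of_keeps k5 hd).of_keeps k6 (by omega)
      refine ⟨⟨r6.var_eq, r6.base_eq, r6.zero, r6.one, r6.sixteen, fun β j => ?_, r6.out_eq⟩,
        fun r h h' => by rw [k6.reg r (by omega), k5.reg r (by omega)]⟩
      have hβ := β.isLt
      simp only [run, Env.setArr_arr, Function.update_apply]
      rw [r6.arr_eq]
      refine if_congr ?_ rfl rfl
      rw [Fin.ext_iff]
      omega
  | emit e =>
    have ee := e.eval_le_bnd hs
    simp only [bnd] at hb
    refine Halts.mono (Halts.seq (e.halts_comp hB hd hr hs hbase hb) fun σ1 ⟨v1, k1⟩ =>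
      Halts.emit (Q := fun σ' => Rel base ((emit e).run s) σ' ∧
        ∀ r, r % 2 = 1 → r < 2 * d + 1 → σ'.reg r = σ.reg r) ?_) le_rfl fun _ h => h
    have r1 := hr.of_keeps k1 hd
    refine ⟨⟨r1.var_eq, r1.base_eq, r1.zero, r1.one, r1.sixteen, r1.arr_eq, ?_⟩,
      fun r _ h => k1.reg r (by omega)⟩
    simp only [run, Env.emit_out, v1, r1.out_eq]
  | seq p q ihp ihq =>
    simp only [bnd] at hb
    exact Halts.seq (ihp hd hr hs hok.1 (by omega)) fun σ1 ⟨r1, k1⟩ =>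
      (ihq hd r1 (p.run_le hs hok.1) hok.2 (by omega)).mono le_rfl fun σ2 ⟨r2, k2⟩ =>
        ⟨r2, fun r h h' => (k2 r h h').trans (k1 r h h')⟩
  | when a b p ih =>
    simp only [bnd] at hb
    refine Halts.mono (Halts.seq (a.halts_comp hB hd hr hs hbase (by omega)) fun σ1 ⟨v1, k1⟩ =>
      Halts.seq (b.halts_comp hB (d := d + 1) (by omega) (hr.of_keeps k1 hd) hs hbase (by omega))
      fun σ2 ⟨v2, k2⟩ => Halts.ite (T := p.cost s) (Q := fun σ' => Rel base ((when a b p).run s) σ' ∧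
        ∀ r, r % 2 = 1 → r < 2 * d + 1 → σ'.reg r = σ.reg r) ?_ ?_)
      (by simp only [cost]; omega) fun _ h => h
    all_goals
      rw [show 2 * d + 3 = 2 * (d + 1) + 1 by ring, v2, k2.reg (2 * d + 1) (by omega), v1]
      have k3 := k1.trans (k2.mono (by omega))
      intro hc
    · refine (ih hd (hr.of_keeps k3 hd) hs (hok hc) (by omega)).mono le_rfl ?_
      exact fun σ3 h => ⟨by simpa [run, hc] using h.1, fun r h1 h2 =>
        (h.2 r h1 h2).trans (k3.reg r (by omega))⟩
    · exact ⟨1, σ2, .skip σ2, p.cost_pos s, by simpa [run, hc] using hr.of_keeps k3 hd,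
        fun r h1 h2 => k3.reg r (by omega)⟩
  | loop x N p ih =>
    have eN := N.eval_le_bnd hs
    simp only [bnd] at hb
    let st : ℕ → Env := fun i => iter (fun i s => p.run (s.setVar x i)) i s
    let I : ℕ → State → Prop := fun i σ' => (σ'.reg (2 * d + 1) = N.eval s ∧
      σ'.reg (2 * d + 3) = i) ∧ Rel base (st i) σ' ∧
      ∀ r, r % 2 = 1 → r < 2 * d + 1 → σ'.reg r = σ.reg r
    refine Halts.mono (Halts.seq (N.halts_comp hB hd hr hs hbase (by omega)) fun σ1 ⟨v1, k1⟩ =>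
      Halts.seq (Halts.const (Q := I 0) (by omega) ?_) fun σ2 h2 =>
      Halts.loop I (fun i => 1 + (p.cost ((st i).setVar x i) + 1))
        (fun i σ' _ h => ⟨h.1.2, h.1.1⟩) ?_ h2)
      ?_ fun σ' h => ⟨h.2.1, h.2.2⟩
    · refine ⟨⟨(setReg_ne (by omega)).trans v1, by simp⟩,
        (hr.of_keeps k1 hd).setReg (by omega) (by omega), fun r h h' => ?_⟩
      rw [setReg_ne (by omega), k1.reg r (by omega)]
    · rintro i σ3 hi ⟨⟨v3, c3⟩, r3, k3⟩
      refine Halts.seq (Halts.arith (Q := fun σ4 => σ4 = σ3.setReg (2 * x) i) ?_ ?_) ?_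
      · rw [c3, r3.zero]; simp only [Op.eval]; omega
      · rw [c3, r3.zero]; rfl
      rintro _ rfl
      refine Halts.seq (ih (d := d + 2) (by omega) (r3.setVar x i)
        ((iter_le hs hok hi.le).setVar (by have := hok.1; omega)) (hok.2 i hi) (by omega)) ?_
      rintro σ5 ⟨r5, k5⟩
      have q5 : ∀ r, r % 2 = 1 → r < 2 * d + 5 → σ5.reg r = σ3.reg r := fun r h h' => by
        rw [k5 r h (by omega), setReg_ne (by omega)]
      refine Halts.arith ?_ ?_
      · rw [q5 _ (by omega) (by omega), c3, r5.one]; simp only [Op.eval]; omega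
      · rw [q5 _ (by omega) (by omega), c3, r5.one]
        refine ⟨⟨?_, by simp [Op.eval]⟩, r5.setReg (by omega) (by omega), fun r h h' => ?_⟩
        · rw [setReg_ne (by omega), q5 _ (by omega) (by omega), v3]
        · rw [setReg_ne (by omega), q5 _ h (by omega), k3 r h h']
    · simp only [cost]
      have : ∀ i, 1 + (p.cost ((st i).setVar x i) + 1) + 1 = p.cost ((st i).setVar x i) + 3 := by
        intro i; omega
      simp only [this]
      show _ ≤ _ + ∑ i ∈ Finset.range (N.eval s), (p.cost ((st i).setVar x i) + 3) + 2
      omega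

end Stmt

/-- Copies the input into array `0`, with the arrays starting right after the input. -/
def prelude : Cmd :=
  .seq (.const 5 1) (.seq (.load 9 5) (.seq (.const 11 4) (.seq (.arith .mul 9 9 11)
    (.seq (.const 11 2) (.seq (.arith .add 1 9 11) (.seq (.const 7 16) (.seq (.const 9 0)
      (.loop 9 1 (.seq (.load 11 9) (.seq (.arith .mul 13 9 7) (.seq (.arith .add 13 13 1)
        (.seq (.store 13 11) (.arith .add 9 9 5)))))))))))))

/-- The initial values: the input stands in array `0`. -/
def initEnv (x : List ℕ) : Env where
  var := fun _ => 0
  arr := fun α i => if α = 0 then x.getD i 0 else 0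
  out := []

/-- The arrays begin at address `4 n + 2`, just behind the input, so copying never overwrites an
input cell. The highest address written is below `17 (4 n + 2)`, whence the condition on `B`. -/
theorem halts_prelude {B n : ℕ} {x : List ℕ} (hx : x.length = 4 * n + 2) (hn : x.getD 1 0 = n)
    (hB : 17 * (4 * n + 2) + 17 < B) :
    Halts B prelude (start x) (6 * (4 * n + 2) + 9) fun σ => Rel (4 * n + 2) (initEnv x) σ := by
  set N := 4 * n + 2 with hN
  let I : ℕ → State → Prop := fun i σ => (σ.reg 9 = i ∧ σ.reg 1 = N) ∧
    (∀ r, r % 2 = 0 → σ.reg r = 0) ∧ (σ.reg 3 = 0 ∧ σ.reg 5 = 1 ∧ σ.reg 7 = 16) ∧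
    σ.out = [] ∧ (∀ a, a < N → σ.mem a = x.getD a 0) ∧
    ∀ j, ∀ α < 16, σ.mem (N + 16 * j + α) = if α = 0 ∧ j < i then x.getD j 0 else 0
  refine Halts.mono (Halts.seq (Halts.const (Q := fun σ => σ = (start x).setReg 5 1) (by omega) rfl)
    fun _ e => Halts.seq (Halts.load (Q := fun σ => σ = ((start x).setReg 5 1).setReg 9 n) ?_)
    fun _ e => Halts.seq (Halts.const
      (Q := fun σ => σ = (((start x).setReg 5 1).setReg 9 n).setReg 11 4) (by omega) ?_)
    fun _ e => Halts.seq (Halts.arith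
      (Q := fun σ => σ = ((((start x).setReg 5 1).setReg 9 n).setReg 11 4).setReg 9 (4 * n)) ?_ ?_)
    fun _ e => Halts.seq (Halts.const
      (Q := fun σ => σ = (((((start x).setReg 5 1).setReg 9 n).setReg 11 4).setReg 9
        (4 * n)).setReg 11 2) (by omega) ?_)
    fun _ e => Halts.seq (Halts.arith
      (Q := fun σ => σ = ((((((start x).setReg 5 1).setReg 9 n).setReg 11 4).setReg 9
        (4 * n)).setReg 11 2).setReg 1 N) ?_ ?_)
    fun _ e => Halts.seq (Halts.const
      (Q := fun σ => σ = (((((((start x).setReg 5 1).setReg 9 n).setReg 11 4).setReg 9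
        (4 * n)).setReg 11 2).setReg 1 N).setReg 7 16) (by omega) ?_)
    fun _ e => Halts.seq (Halts.const (Q := I 0) (by omega) ?_)
    fun σ h0 => Halts.loop I (fun _ => 1 + (1 + (1 + (1 + 1))))
        (fun i σ' _ h => h.1) ?_ h0) ?_ ?_
  · have hn' : x[1]?.getD 0 = n := by simpa using hn
    subst e; simp [start, hn']
  · rw [e]
  · subst e; simp [setReg_reg, Op.eval]; omega
  · subst e; simp [setReg_reg, Op.eval, mul_comm]
  · rw [e]
  · subst e; simp [setReg_reg, Op.eval]; omega
  · subst e; simp [setReg_reg, Op.eval, hN]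
  · rw [e]
  · subst e
    refine ⟨by simp [setReg_reg], fun r hr => ?_, by simp [setReg_reg, start], rfl, fun a _ => rfl,
      fun j α hα => ?_⟩
    · rw [setReg_ne (by omega), setReg_ne (by omega), setReg_ne (by omega), setReg_ne (by omega),
        setReg_ne (by omega), setReg_ne (by omega), setReg_ne (by omega), setReg_ne (by omega)]
      rfl
    -- Nothing has been copied yet, and the memory behind the input is still zero.
    · simp only [not_lt_zero, and_false, if_false]
      exact List.getD_eq_default _ _ (by omega)
  · rintro i σ hi ⟨⟨h9, h1⟩, h2, ⟨h3, h5, h7⟩, ho, hm, hm'⟩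
    refine Halts.seq (Halts.load (Q := fun σ1 => σ1 = σ.setReg 11 (x.getD i 0)) ?_) ?_
    · rw [h9, hm i hi]
    rintro _ rfl
    refine Halts.seq (Halts.arith
      (Q := fun σ2 => σ2 = (σ.setReg 11 (x.getD i 0)).setReg 13 (i * 16)) ?_ ?_) ?_
    · simp only [setReg_reg, h9, h7, Op.eval]; norm_num; omega
    · simp [setReg_reg, h9, h7, Op.eval]
    rintro _ rfl
    refine Halts.seq (Halts.arith (Q := fun σ2 => σ2 = ((σ.setReg 11 (x.getD i 0)).setReg 13
      (i * 16)).setReg 13 (i * 16 + N)) ?_ ?_) ?_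
    · simp only [setReg_reg, h1, Op.eval]; norm_num; omega
    · simp [setReg_reg, h1, Op.eval]
    rintro _ rfl
    refine Halts.seq (Halts.store (Q := fun σ3 => (σ3.reg 9 = i ∧ σ3.reg 1 = N) ∧
      (∀ r, r % 2 = 0 → σ3.reg r = 0) ∧ (σ3.reg 3 = 0 ∧ σ3.reg 5 = 1 ∧ σ3.reg 7 = 16) ∧
      σ3.out = [] ∧ (∀ a, a < N → σ3.mem a = x.getD a 0) ∧
      ∀ j, ∀ α < 16, σ3.mem (N + 16 * j + α) = if α = 0 ∧ j < i + 1 then x.getD j 0 else 0) ?_) ?_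
    · refine ⟨by simp [setReg_reg, h9, h1], fun r hr => ?_, by simp [setReg_reg, h3, h5, h7], ho,
        fun a ha => ?_, fun j α hα => ?_⟩
      · dsimp only
        rw [setReg_ne (by omega), setReg_ne (by omega), setReg_ne (by omega), h2 r hr]
      · simp only [setReg_same, setReg_mem]
        rw [Function.update_of_ne (by omega), hm a ha]
      · simp only [setReg_same, setReg_mem, Function.update_apply]
        rw [setReg_ne (by omega), setReg_ne (by omega), setReg_same, hm' j α hα]
        split_ifs <;> first | rfl | omega | (congr 1; omega)
    · rintro σ3 ⟨⟨g9, g1⟩, g2, ⟨g3, g5, g7⟩, go, gm, gm'⟩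
      refine Halts.arith ?_ ?_
      · rw [g9, g5]; simp only [Op.eval]; omega
      · rw [g9, g5]
        refine ⟨by simp [setReg_reg, Op.eval, g1], fun r hr => ?_, by simp [setReg_reg, g3, g5, g7],
          go, gm, gm'⟩
        rw [setReg_ne (by omega), g2 r hr]
  · simp only [Finset.sum_const, Finset.card_range, smul_eq_mul]; omega
  · rintro σ ⟨⟨h9, h1⟩, h2, ⟨h3, h5, h7⟩, ho, hm, hm'⟩
    refine ⟨fun y => h2 _ (by omega), h1, h3, h5, h7, fun α i => ?_, ho⟩
    rw [hm' i α α.isLt]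
    simp only [initEnv, Fin.ext_iff, Fin.val_zero]
    by_cases hα : (α : ℕ) = 0
    · simp only [hα, true_and, if_true]
      split_ifs with h
      · rfl
      · exact (List.getD_eq_default _ _ (by omega)).symm
    · simp [hα]

/-- A statement can be carried out on the word RAM, starting with the input in array `0`. -/
theorem Stmt.exists_computes (p : Stmt) {B M n : ℕ} {x : List ℕ} (hx : x.length = 4 * n + 2)
    (hn : x.getD 1 0 = n) (hM : 4 * n + 2 ≤ M) (hxM : ∀ a ∈ x, a ≤ M) (hB : 17 * M + 17 < B)
    (hok : p.Ok M (initEnv x)) (hb : p.bnd M < B) :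
    ∃ t ≤ 6 * (4 * n + 2) + 9 + p.cost (initEnv x),
      Computes B (.seq prelude (p.comp 4)) x t (p.run (initEnv x)).out := by
  have hle : (initEnv x).Le M := by
    refine ⟨fun _ => Nat.zero_le _, fun α i => ?_⟩
    simp only [initEnv]
    split_ifs
    · by_cases hi : i < x.length
      · rw [List.getD_eq_getElem _ _ hi]; exact hxM _ (List.getElem_mem hi)
      · rw [List.getD_eq_default _ _ (by omega)]; exact Nat.zero_le _
    · exact Nat.zero_le _
  have hp : Halts B (.seq prelude (p.comp 4)) (start x) _ _ :=
    Halts.seq (halts_prelude hx hn (by omega)) fun σ hσ =>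
      (p.halts_comp (by omega) le_rfl hσ hle hM hok hb).mono le_rfl fun _ h => h.1.out_eq
  obtain ⟨t, σ, h1, h2, h3⟩ := hp
  exact ⟨t, h2, σ, h1, h3⟩

end ArrayLang

namespace ArrayLang

open WordRAM

/-! ### Truth values -/

open scoped Classical in
/-- A truth value as a number. -/
noncomputable def bit (P : Prop) : ℕ := if P then 1 else 0

@[simp] theorem bit_ne_zero {P : Prop} : bit P ≠ 0 ↔ P := by simp [bit]

@[simp] theorem bit_eq_zero {P : Prop} : bit P = 0 ↔ ¬ P := by simp [bit]

@[simp] theorem bit_pos {P : Prop} : 0 < bit P ↔ P := by rw [Nat.pos_iff_ne_zero, bit_ne_zero]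

theorem bit_le_one (P : Prop) : bit P ≤ 1 := by unfold bit; split_ifs <;> omega

theorem bit_congr {P Q : Prop} (h : P ↔ Q) : bit P = bit Q := by rw [propext h]

namespace Expr

/-- Sum. -/
instance : Add Expr := ⟨op .add⟩

/-- Truncated difference. -/
instance : Sub Expr := ⟨op .sub⟩

/-- Product. -/
instance : Mul Expr := ⟨op .mul⟩

/-- Quotient. -/
instance : Div Expr := ⟨op .div⟩

/-- Remainder. -/
instance : Mod Expr := ⟨op .mod⟩

/-- If `c ≠ 0` then `p` else `q`. -/
def cond (c p q : Expr) : Expr := sel (lit 0) c p q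

/-- Comparison. -/
def lt (a b : Expr) : Expr := sel a b (lit 1) (lit 0)

/-- Equality test. -/
def eq (a b : Expr) : Expr := sel a b (lit 0) (sel b a (lit 0) (lit 1))

/-- Negation. -/
def not (a : Expr) : Expr := cond a (lit 0) (lit 1)

/-- Conjunction. -/
def and (a b : Expr) : Expr := cond a (cond b (lit 1) (lit 0)) (lit 0)

/-- Disjunction. -/
def or (a b : Expr) : Expr := cond a (lit 1) (cond b (lit 1) (lit 0))

/-- Whether `e` holds for some value `< N` of the variable `x`. -/
def ex (x : ℕ) (N e : Expr) : Expr := cond (sum x N e) (lit 1) (lit 0)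

/-- Whether `e` holds for all values `< N` of the variable `x`. -/
def all (x : ℕ) (N e : Expr) : Expr := cond (sum x N e.not) (lit 0) (lit 1)

/-- The smaller one of two values. -/
def min (a b : Expr) : Expr := sel a b a b

/-- The larger one of two values. -/
def max (a b : Expr) : Expr := sel a b b a

variable (a b c p q N e : Expr) (x : ℕ) (s : Env)

@[simp] theorem eval_var : (var x).eval s = s.var x := rfl

@[simp] theorem eval_lit (c : ℕ) : (lit c).eval s = c := rfl

@[simp] theorem eval_rd (α : Fin 16) : (rd α a).eval s = s.arr α (a.eval s) := rfl

@[simp] theorem eval_add : (a + b).eval s = a.eval s + b.eval s := rfl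

@[simp] theorem eval_sub : (a - b).eval s = a.eval s - b.eval s := rfl

@[simp] theorem eval_mul : (a * b).eval s = a.eval s * b.eval s := rfl

@[simp] theorem eval_div : (a / b).eval s = a.eval s / b.eval s := rfl

@[simp] theorem eval_mod : (a % b).eval s = a.eval s % b.eval s := rfl

@[simp] theorem eval_sum :
    (sum x N e).eval s = ∑ i ∈ Finset.range (N.eval s), e.eval (s.setVar x i) := rfl

@[simp] theorem eval_cond :
    (cond c p q).eval s = if c.eval s ≠ 0 then p.eval s else q.eval s := by
  simp [cond, eval, Nat.pos_iff_ne_zero]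

@[simp] theorem eval_lt : (lt a b).eval s = bit (a.eval s < b.eval s) := by
  simp [lt, eval, bit]

@[simp] theorem eval_eq : (eq a b).eval s = bit (a.eval s = b.eval s) := by
  simp only [eq, eval, bit]
  split_ifs <;> omega

@[simp] theorem eval_not : (not a).eval s = bit (a.eval s = 0) := by
  simp only [not, eval_cond, eval_lit, bit]
  split_ifs <;> omega

@[simp] theorem eval_and : (and a b).eval s = bit (a.eval s ≠ 0 ∧ b.eval s ≠ 0) := by
  simp only [and, eval_cond, eval_lit, bit]
  split_ifs <;> tauto

@[simp] theorem eval_or : (or a b).eval s = bit (a.eval s ≠ 0 ∨ b.eval s ≠ 0) := by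
  simp only [or, eval_cond, eval_lit, bit]
  split_ifs <;> tauto

@[simp] theorem eval_ex :
    (ex x N e).eval s = bit (∃ i < N.eval s, e.eval (s.setVar x i) ≠ 0) := by
  have : (sum x N e).eval s ≠ 0 ↔ ∃ i < N.eval s, e.eval (s.setVar x i) ≠ 0 := by
    rw [eval_sum, ne_eq, Finset.sum_eq_zero_iff]; simp
  simp only [ex, eval_cond, eval_lit, bit]
  by_cases h : (sum x N e).eval s ≠ 0
  · rw [if_pos h, if_pos (this.1 h)]
  · rw [if_neg h, if_neg (mt this.2 h)]

@[simp] theorem eval_all :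
    (all x N e).eval s = bit (∀ i < N.eval s, e.eval (s.setVar x i) ≠ 0) := by
  have : (sum x N e.not).eval s ≠ 0 ↔ ¬ ∀ i < N.eval s, e.eval (s.setVar x i) ≠ 0 := by
    rw [eval_sum, ne_eq, Finset.sum_eq_zero_iff]; simp
  simp only [all, eval_cond, eval_lit, bit]
  by_cases h : (sum x N e.not).eval s ≠ 0
  · rw [if_pos h, if_neg (this.1 h)]
  · rw [if_neg h, if_pos (not_not.1 (mt this.2 h))]

@[simp] theorem eval_min : (min a b).eval s = Min.min (a.eval s) (b.eval s) := by
  simp only [min, eval]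
  split_ifs <;> omega

@[simp] theorem eval_max : (max a b).eval s = Max.max (a.eval s) (b.eval s) := by
  simp only [max, eval]
  split_ifs <;> omega

/-! ### Running time and size of numbers -/

/-- Loop bounds: built from the variables below `8`, which are never assigned in a loop. -/
def Bound : Expr → Bool
  | var x => x < 8
  | lit _ => true
  | op _ a b => a.Bound && b.Bound
  | _ => false

/-- Every sum has a loop bound and its variable is not below `8`. -/
def Safe : Expr → Bool
  | var _ => true
  | lit _ => true
  | op _ a b => a.Safe && b.Safe
  | rd _ i => i.Safe
  | sel a b p q => a.Safe && b.Safe && p.Safe && q.Safe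
  | sum x N e => (8 ≤ x) && N.Bound && N.Safe && e.Safe

/-- The degree of the value of a loop bound, if the variable `x` has degree `d x`. -/
def valDeg (d : ℕ → ℕ) : Expr → ℕ
  | var x => d x
  | op .mul a b => a.valDeg d + b.valDeg d
  | op _ a b => Max.max (a.valDeg d) (b.valDeg d)
  | _ => 0

/-- The degree of the running time. -/
def deg (d : ℕ → ℕ) : Expr → ℕ
  | var _ => 0
  | lit _ => 0
  | op _ a b => Max.max (a.deg d) (b.deg d)
  | rd _ i => i.deg d
  | sel a b p q => Max.max (Max.max (a.deg d) (b.deg d)) (Max.max (p.deg d) (q.deg d))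
  | sum _ N e => Max.max (N.deg d) (N.valDeg d + e.deg d)

/-- The variables below `8` have the given degrees. -/
def _root_.ArrayLang.Env.HasDeg (K y : ℕ) (d : ℕ → ℕ) (s : Env) : Prop :=
  ∀ x < 8, s.var x ≤ K * y ^ d x

theorem le_mul_pow_of_le {C C' y d d' z : ℕ} (hy : 1 ≤ y) (h : z ≤ C * y ^ d) (hC : C ≤ C')
    (hd : d ≤ d') : z ≤ C' * y ^ d' :=
  h.trans (Nat.mul_le_mul hC (Nat.pow_le_pow_right hy hd))

theorem exists_eval_le (d : ℕ → ℕ) (K : ℕ) {e : Expr} (he : e.Bound) :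
    ∃ C, ∀ y, 1 ≤ y → ∀ s : Env, s.HasDeg K y d → e.eval s ≤ C * y ^ e.valDeg d := by
  induction e with
  | var x => exact ⟨K, fun y _ s h => h x (by simpa [Bound] using he)⟩
  | lit c => exact ⟨c, fun y _ s _ => by simp [valDeg]⟩
  | op o a b iha ihb =>
    simp only [Bound, Bool.and_eq_true] at he
    obtain ⟨A, hA⟩ := iha he.1
    obtain ⟨B, hB⟩ := ihb he.2
    by_cases ho : o = .mul
    · subst ho
      refine ⟨A * B, fun y hy s h => ?_⟩
      have := Nat.mul_le_mul (hA y hy s h) (hB y hy s h)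
      simp only [eval, valDeg, pow_add, Op.eval]
      linarith
    · refine ⟨A + B, fun y hy s h => ?_⟩
      have e1 : (op o a b).valDeg d = Max.max (a.valDeg d) (b.valDeg d) := by
        cases o <;> first | rfl | exact absurd rfl ho
      have h1 := le_mul_pow_of_le hy (hA y hy s h) le_rfl (le_max_left _ (b.valDeg d))
      have h2 := le_mul_pow_of_le hy (hB y hy s h) le_rfl (le_max_right (a.valDeg d) _)
      have h3 : (op o a b).eval s ≤ a.eval s + b.eval s := by
        cases o <;> simp only [eval, Op.eval]
        · exact le_rfl
        · omega
        · exact absurd rfl ho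
        · exact (Nat.div_le_self _ _).trans (by omega)
        · exact (Nat.mod_le _ _).trans (by omega)
      rw [e1, add_mul]
      omega
  | _ => simp [Bound] at he

theorem _root_.ArrayLang.Env.HasDeg.setVar {K y : ℕ} {d : ℕ → ℕ} {s : Env} (h : s.HasDeg K y d)
    {x v : ℕ} (hx : 8 ≤ x) : (s.setVar x v).HasDeg K y d := fun z hz => by
  rw [Env.setVar_var, if_neg (by omega)]
  exact h z hz

/-- Every sum multiplies the cost by its loop bound, whose degree is fixed because it involves only
variables below `8`. The constant does not depend on `y` or on the environment, so it is uniform in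
all inputs. -/
theorem exists_cost_le (d : ℕ → ℕ) (K : ℕ) {e : Expr} (he : e.Safe) :
    ∃ C, ∀ y, 1 ≤ y → ∀ s : Env, s.HasDeg K y d → e.cost s ≤ C * y ^ e.deg d := by
  induction e with
  | var x => exact ⟨1, fun y _ s _ => by simp [cost, deg]⟩
  | lit c => exact ⟨1, fun y _ s _ => by simp [cost, deg]⟩
  | op o a b iha ihb =>
    simp only [Safe, Bool.and_eq_true] at he
    obtain ⟨A, hA⟩ := iha he.1
    obtain ⟨B, hB⟩ := ihb he.2
    refine ⟨A + B + 1, fun y hy s h => ?_⟩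
    have h1 := le_mul_pow_of_le hy (hA y hy s h) le_rfl (le_max_left _ (b.deg d))
    have h2 := le_mul_pow_of_le hy (hB y hy s h) le_rfl (le_max_right (a.deg d) _)
    have h3 : 1 ≤ y ^ (op o a b).deg d := Nat.one_le_pow _ _ hy
    simp only [cost, deg] at h3 ⊢
    nlinarith
  | rd α i ih =>
    obtain ⟨A, hA⟩ := ih he
    refine ⟨A + 5, fun y hy s h => ?_⟩
    have h1 := hA y hy s h
    have h3 : 1 ≤ y ^ (rd α i).deg d := Nat.one_le_pow _ _ hy
    simp only [cost, deg] at h3 ⊢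
    nlinarith
  | sel a b p q iha ihb ihp ihq =>
    simp only [Safe, Bool.and_eq_true] at he
    obtain ⟨A, hA⟩ := iha he.1.1.1
    obtain ⟨B, hB⟩ := ihb he.1.1.2
    obtain ⟨P, hP⟩ := ihp he.1.2
    obtain ⟨Q, hQ⟩ := ihq he.2
    refine ⟨A + B + P + Q + 1, fun y hy s h => ?_⟩
    set D := (sel a b p q).deg d with hD
    simp only [deg] at hD
    have h1 := le_mul_pow_of_le hy (hA y hy s h) le_rfl (show _ ≤ D by omega)
    have h2 := le_mul_pow_of_le hy (hB y hy s h) le_rfl (show _ ≤ D by omega)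
    have h3 := le_mul_pow_of_le hy (hP y hy s h) le_rfl (show _ ≤ D by omega)
    have h4 := le_mul_pow_of_le hy (hQ y hy s h) le_rfl (show _ ≤ D by omega)
    have h5 : 1 ≤ y ^ D := Nat.one_le_pow _ _ hy
    simp only [cost]
    linarith
  | sum x N e ihN ihe =>
    simp only [Safe, Bool.and_eq_true, decide_eq_true_eq] at he
    obtain ⟨A, hA⟩ := ihN he.1.2
    obtain ⟨B, hB⟩ := exists_eval_le d K he.1.1.2
    obtain ⟨C, hC⟩ := ihe he.2
    refine ⟨A + B * (C + 4) + 6, fun y hy s h => ?_⟩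
    set D := (sum x N e).deg d with hD
    simp only [deg] at hD
    have h1 := le_mul_pow_of_le hy (hA y hy s h) le_rfl (show _ ≤ D by omega)
    have h2 : ∀ i ∈ Finset.range (N.eval s), e.cost (s.setVar x i) + 4 ≤ (C + 4) * y ^ e.deg d := by
      intro i _
      have h3 := hC y hy _ (h.setVar (v := i) he.1.1.1)
      have h4 : 1 ≤ y ^ e.deg d := Nat.one_le_pow _ _ hy
      nlinarith
    have h3 := Finset.sum_le_card_nsmul _ _ _ h2
    rw [Finset.card_range, smul_eq_mul] at h3
    have h4 : N.eval s * ((C + 4) * y ^ e.deg d) ≤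
        B * (C + 4) * y ^ (N.valDeg d + e.deg d) := by
      rw [pow_add]
      calc _ ≤ B * y ^ N.valDeg d * ((C + 4) * y ^ e.deg d) :=
            Nat.mul_le_mul_right _ (hB y hy s h)
        _ = _ := by ring
    have h6 := le_mul_pow_of_le hy (h3.trans h4) le_rfl (show _ ≤ D by omega)
    have h5 : 1 ≤ y ^ D := Nat.one_le_pow _ _ hy
    simp only [cost]
    linarith

theorem bnd_mono (e : Expr) {M M' : ℕ} (h : M ≤ M') : e.bnd M ≤ e.bnd M' := by
  induction e generalizing M M' with
  | var x => exact h
  | lit c => exact le_rfl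
  | op o a b iha ihb =>
    exact Nat.mul_le_mul (Nat.add_le_add_right (iha h) 1) (Nat.add_le_add_right (ihb h) 1)
  | rd α i ih => simp only [bnd]; have := ih h; omega
  | sel a b p q iha ihb ihp ihq =>
    simp only [bnd]
    have := iha h
    have := ihb h
    have := ihp h
    have := ihq h
    omega
  | sum x N e ihN ihe =>
    simp only [bnd]
    have h1 := ihN h
    have h2 := ihe (show M + N.bnd M ≤ M' + N.bnd M' by omega)
    have := Nat.mul_le_mul (Nat.add_le_add_right h1 1) (Nat.add_le_add_right h2 1)
    omega

theorem add_pow_le_pow {y a b u v : ℕ} (hy : 2 ≤ y) (hu : u ≤ y ^ a) (hv : v ≤ y ^ b) :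
    u + v ≤ y ^ (a + b + 1) := by
  have h1 := Nat.pow_le_pow_right (by omega : 0 < y) (show a ≤ a + b by omega)
  have h2 := Nat.pow_le_pow_right (by omega : 0 < y) (show b ≤ a + b by omega)
  have h3 := Nat.mul_le_mul_left (y ^ (a + b)) hy
  rw [pow_succ]
  omega

theorem lit_le_pow {y : ℕ} (hy : 2 ≤ y) (c : ℕ) : c ≤ y ^ c :=
  (Nat.lt_pow_self hy).le

/-- Ensures that words of `O(log n)` bits suffice: if the stored values are polynomially bounded,
then so are the intermediate ones. With `y ≥ 2`, constants and sums are absorbed by a larger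
exponent. -/
theorem exists_bnd_le (e : Expr) (a : ℕ) : ∃ c, ∀ y, 2 ≤ y → e.bnd (y ^ a) ≤ y ^ c := by
  induction e generalizing a with
  | var x => exact ⟨a, fun y _ => le_rfl⟩
  | lit c => exact ⟨c, fun y hy => lit_le_pow hy c⟩
  | op o p q ihp ihq =>
    obtain ⟨c, hc⟩ := ihp a
    obtain ⟨d, hd⟩ := ihq a
    refine ⟨(c + 1 + 1) + (d + 1 + 1), fun y hy => ?_⟩
    rw [pow_add]
    exact Nat.mul_le_mul (add_pow_le_pow hy (hc y hy) (lit_le_pow hy 1))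
      (add_pow_le_pow hy (hd y hy) (lit_le_pow hy 1))
  | rd α i ih =>
    obtain ⟨c, hc⟩ := ih a
    have h1 : ∀ y, 2 ≤ y → 2 * y ^ a ≤ y ^ (2 + a) := fun y hy => by
      rw [pow_add]; exact Nat.mul_le_mul_right _ (lit_le_pow hy 2)
    have h2 : ∀ y, 2 ≤ y → 16 * i.bnd (y ^ a) ≤ y ^ (16 + c) := fun y hy => by
      rw [pow_add]; exact Nat.mul_le_mul (lit_le_pow hy 16) (hc y hy)
    exact ⟨_, fun y hy => add_pow_le_pow hy (add_pow_le_pow hy (h1 y hy) (h2 y hy))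
      (lit_le_pow hy 16)⟩
  | sel p q r t ihp ihq ihr iht =>
    obtain ⟨c1, h1⟩ := ihp a
    obtain ⟨c2, h2⟩ := ihq a
    obtain ⟨c3, h3⟩ := ihr a
    obtain ⟨c4, h4⟩ := iht a
    exact ⟨_, fun y hy => add_pow_le_pow hy (add_pow_le_pow hy (add_pow_le_pow hy (h1 y hy)
      (h2 y hy)) (h3 y hy)) (h4 y hy)⟩
  | sum x N e ihN ihe =>
    obtain ⟨c, hc⟩ := ihN a
    obtain ⟨d, hd⟩ := ihe (a + c + 1)
    have key : ∀ y, 2 ≤ y → (N.bnd (y ^ a) + 1) * (e.bnd (y ^ a + N.bnd (y ^ a)) + 1) ≤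
        y ^ ((c + 1 + 1) + (d + 1 + 1)) := by
      intro y hy
      have h1 : e.bnd (y ^ a + N.bnd (y ^ a)) ≤ y ^ d :=
        (e.bnd_mono (add_pow_le_pow hy le_rfl (hc y hy))).trans (hd y hy)
      rw [pow_add]
      exact Nat.mul_le_mul (add_pow_le_pow hy (hc y hy) (lit_le_pow hy 1))
        (add_pow_le_pow hy h1 (lit_le_pow hy 1))
    exact ⟨_, fun y hy => add_pow_le_pow hy (add_pow_le_pow hy (add_pow_le_pow hy (key y hy)
      (hc y hy)) le_rfl) (lit_le_pow hy 1)⟩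

end Expr

/-! ### Running time and size of numbers for statements -/

namespace Stmt

/-- Every loop has a loop bound and no variable below `8` is assigned. -/
def Safe : Stmt → Bool
  | assign x e => (8 ≤ x) && e.Safe
  | write _ i e => i.Safe && e.Safe
  | emit e => e.Safe
  | seq p q => p.Safe && q.Safe
  | when a b p => a.Safe && b.Safe && p.Safe
  | loop x N p => (8 ≤ x) && N.Bound && N.Safe && p.Safe

/-- The degree of the running time. -/
def deg (d : ℕ → ℕ) : Stmt → ℕ
  | assign _ e => e.deg d
  | write _ i e => max (i.deg d) (e.deg d)
  | emit e => e.deg d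
  | seq p q => max (p.deg d) (q.deg d)
  | when a b p => max (max (a.deg d) (b.deg d)) (p.deg d)
  | loop _ N p => max (N.deg d) (N.valDeg d + p.deg d)

theorem iter_var {f : ℕ → Env → Env} {x : ℕ} (hf : ∀ i s, (f i s).var x = s.var x) (n : ℕ)
    (s : Env) : (iter f n s).var x = s.var x := by
  induction n with
  | zero => rfl
  | succ n ih => exact (hf _ _).trans ih

/-- The reason for reserving the variables below `8`: loop bounds built from them stay the same
during the whole run, so their degrees may be fixed beforehand. -/
theorem run_var {p : Stmt} (hp : p.Safe) {x : ℕ} (hx : x < 8) (s : Env) :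
    (p.run s).var x = s.var x := by
  induction p generalizing s with
  | assign y e =>
    simp only [Safe, Bool.and_eq_true, decide_eq_true_eq] at hp
    simp only [run, Env.setVar_var]
    rw [if_neg (by omega)]
  | write α i e => rfl
  | emit e => rfl
  | seq p q ihp ihq =>
    simp only [Safe, Bool.and_eq_true] at hp
    exact (ihq hp.2 _).trans (ihp hp.1 _)
  | when a b p ih =>
    simp only [Safe, Bool.and_eq_true] at hp
    simp only [run]
    split_ifs
    exacts [ih hp.2 s, rfl]
  | loop y N p ih =>
    simp only [Safe, Bool.and_eq_true, decide_eq_true_eq] at hp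
    refine iter_var (fun i s => ?_) _ _
    rw [ih hp.2, Env.setVar_var, if_neg (by omega)]

theorem hasDeg_run {K y : ℕ} {d : ℕ → ℕ} {p : Stmt} (hp : p.Safe) {s : Env}
    (h : s.HasDeg K y d) : (p.run s).HasDeg K y d := fun x hx => by
  rw [run_var hp hx]; exact h x hx

theorem exists_cost_le (d : ℕ → ℕ) (K : ℕ) {p : Stmt} (hp : p.Safe) :
    ∃ C, ∀ y, 1 ≤ y → ∀ s : Env, s.HasDeg K y d → p.cost s ≤ C * y ^ p.deg d := by
  induction p with
  | assign x e =>
    simp only [Safe, Bool.and_eq_true] at hp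
    obtain ⟨A, hA⟩ := Expr.exists_cost_le d K hp.2
    refine ⟨A + 1, fun y hy s h => ?_⟩
    have h1 := hA y hy s h
    have h3 : 1 ≤ y ^ (assign x e).deg d := Nat.one_le_pow _ _ hy
    simp only [cost, deg] at h3 ⊢
    nlinarith
  | write α i e =>
    simp only [Safe, Bool.and_eq_true] at hp
    obtain ⟨A, hA⟩ := Expr.exists_cost_le d K hp.1
    obtain ⟨B, hB⟩ := Expr.exists_cost_le d K hp.2
    refine ⟨A + B + 5, fun y hy s h => ?_⟩
    have h1 := Expr.le_mul_pow_of_le hy (hA y hy s h) le_rfl (le_max_left _ (e.deg d))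
    have h2 := Expr.le_mul_pow_of_le hy (hB y hy s h) le_rfl (le_max_right (i.deg d) _)
    have h3 : 1 ≤ y ^ (write α i e).deg d := Nat.one_le_pow _ _ hy
    simp only [cost, deg] at h3 ⊢
    nlinarith
  | emit e =>
    obtain ⟨A, hA⟩ := Expr.exists_cost_le d K (e := e) hp
    refine ⟨A + 1, fun y hy s h => ?_⟩
    have h1 := hA y hy s h
    have h3 : 1 ≤ y ^ (emit e).deg d := Nat.one_le_pow _ _ hy
    simp only [cost, deg] at h3 ⊢
    nlinarith
  | seq p q ihp ihq =>
    simp only [Safe, Bool.and_eq_true] at hp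
    obtain ⟨A, hA⟩ := ihp hp.1
    obtain ⟨B, hB⟩ := ihq hp.2
    refine ⟨A + B, fun y hy s h => ?_⟩
    have h1 := Expr.le_mul_pow_of_le hy (hA y hy s h) le_rfl (le_max_left _ (q.deg d))
    have h2 := Expr.le_mul_pow_of_le hy (hB y hy _ (hasDeg_run hp.1 h)) le_rfl
      (le_max_right (p.deg d) _)
    simp only [cost, deg, add_mul]
    omega
  | when a b p ih =>
    simp only [Safe, Bool.and_eq_true] at hp
    obtain ⟨A, hA⟩ := Expr.exists_cost_le d K hp.1.1
    obtain ⟨B, hB⟩ := Expr.exists_cost_le d K hp.1.2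
    obtain ⟨C, hC⟩ := ih hp.2
    refine ⟨A + B + C + 2, fun y hy s h => ?_⟩
    set D := (when a b p).deg d with hD
    simp only [deg] at hD
    have h1 := Expr.le_mul_pow_of_le hy (hA y hy s h) le_rfl (show _ ≤ D by omega)
    have h2 := Expr.le_mul_pow_of_le hy (hB y hy s h) le_rfl (show _ ≤ D by omega)
    have h3 := Expr.le_mul_pow_of_le hy (hC y hy s h) le_rfl (show _ ≤ D by omega)
    have h5 : 1 ≤ y ^ D := Nat.one_le_pow _ _ hy
    simp only [cost]
    linarith
  | loop x N p ih =>
    simp only [Safe, Bool.and_eq_true, decide_eq_true_eq] at hp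
    obtain ⟨A, hA⟩ := Expr.exists_cost_le d K hp.1.2
    obtain ⟨B, hB⟩ := Expr.exists_eval_le d K hp.1.1.2
    obtain ⟨C, hC⟩ := ih hp.2
    refine ⟨A + B * (C + 3) + 2, fun y hy s h => ?_⟩
    set D := (loop x N p).deg d with hD
    simp only [deg] at hD
    have h0 : ∀ i, (iter (fun i s => p.run (s.setVar x i)) i s).HasDeg K y d := by
      intro i
      induction i with
      | zero => exact h
      | succ i ihi => exact hasDeg_run hp.2 (ihi.setVar hp.1.1.1)
    have h1 := Expr.le_mul_pow_of_le hy (hA y hy s h) le_rfl (show _ ≤ D by omega)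
    have h2 : ∀ i ∈ Finset.range (N.eval s),
        p.cost ((iter (fun i s => p.run (s.setVar x i)) i s).setVar x i) + 3 ≤
          (C + 3) * y ^ p.deg d := by
      intro i _
      have h3 := hC y hy _ ((h0 i).setVar (v := i) hp.1.1.1)
      have h4 : 1 ≤ y ^ p.deg d := Nat.one_le_pow _ _ hy
      nlinarith
    have h3 := Finset.sum_le_card_nsmul _ _ _ h2
    rw [Finset.card_range, smul_eq_mul] at h3
    have h4 : N.eval s * ((C + 3) * y ^ p.deg d) ≤
        B * (C + 3) * y ^ (N.valDeg d + p.deg d) := by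
      rw [pow_add]
      calc _ ≤ B * y ^ N.valDeg d * ((C + 3) * y ^ p.deg d) :=
            Nat.mul_le_mul_right _ (hB y hy s h)
        _ = _ := by ring
    have h6 := Expr.le_mul_pow_of_le hy (h3.trans h4) le_rfl (show _ ≤ D by omega)
    have h5 : 1 ≤ y ^ D := Nat.one_le_pow _ _ hy
    simp only [cost]
    linarith

theorem exists_bnd_le (p : Stmt) (a : ℕ) : ∃ c, ∀ y, 2 ≤ y → p.bnd (y ^ a) ≤ y ^ c := by
  induction p with
  | assign x e => exact e.exists_bnd_le a
  | write α i e =>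
    obtain ⟨c, hc⟩ := (Expr.rd α i).exists_bnd_le a
    obtain ⟨d, hd⟩ := e.exists_bnd_le a
    exact ⟨_, fun y hy => Expr.add_pow_le_pow hy (hc y hy) (hd y hy)⟩
  | emit e => exact e.exists_bnd_le a
  | seq p q ihp ihq =>
    obtain ⟨c, hc⟩ := ihp
    obtain ⟨d, hd⟩ := ihq
    exact ⟨_, fun y hy => Expr.add_pow_le_pow hy (hc y hy) (hd y hy)⟩
  | when p q r ih =>
    obtain ⟨c, hc⟩ := p.exists_bnd_le a
    obtain ⟨d, hd⟩ := q.exists_bnd_le a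
    obtain ⟨f, hf⟩ := ih
    exact ⟨_, fun y hy => Expr.add_pow_le_pow hy (Expr.add_pow_le_pow hy (hc y hy) (hd y hy))
      (hf y hy)⟩
  | loop x N p ih =>
    obtain ⟨c, hc⟩ := N.exists_bnd_le a
    obtain ⟨d, hd⟩ := ih
    exact ⟨_, fun y hy => Expr.add_pow_le_pow hy (Expr.add_pow_le_pow hy (hc y hy) (hd y hy))
      (Expr.lit_le_pow hy 1)⟩

end Stmt

end ArrayLang

/-! ### Rules for the verification of statements -/

namespace ArrayLang

/-- Replace an array. -/
def Env.setTbl (s : Env) (α : Fin 16) (f : ℕ → ℕ) : Env :=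
  { s with arr := Function.update s.arr α f }

@[simp] theorem Env.setTbl_var (s : Env) (α : Fin 16) (f : ℕ → ℕ) :
    (s.setTbl α f).var = s.var := rfl

@[simp] theorem Env.setTbl_out (s : Env) (α : Fin 16) (f : ℕ → ℕ) :
    (s.setTbl α f).out = s.out := rfl

@[simp] theorem Env.setTbl_arr (s : Env) (α : Fin 16) (f : ℕ → ℕ) (β : Fin 16) :
    (s.setTbl α f).arr β = if β = α then f else s.arr β := by
  unfold setTbl
  by_cases h : β = α
  · subst h; simp
  · simp [h]

/-- Replace the output. -/
def Env.setOut (s : Env) (l : List ℕ) : Env := { s with out := l }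

@[simp] theorem Env.setOut_var (s : Env) (l : List ℕ) : (s.setOut l).var = s.var := rfl

@[simp] theorem Env.setOut_arr (s : Env) (l : List ℕ) : (s.setOut l).arr = s.arr := rfl

@[simp] theorem Env.setOut_out (s : Env) (l : List ℕ) : (s.setOut l).out = l := rfl

/-- The statement assigns values up to `M` only, and ends in a state with property `Q`. -/
def WP (M : ℕ) (p : Stmt) (s : Env) (Q : Env → Prop) : Prop := p.Ok M s ∧ Q (p.run s)

namespace WP

variable {M x : ℕ} {p q : Stmt} {s : Env} {Q R : Env → Prop} {e : Expr}

theorem mono (h : WP M p s R) (hQ : ∀ s', R s' → Q s') : WP M p s Q := ⟨h.1, hQ _ h.2⟩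

theorem seq (h : WP M p s fun s' => WP M q s' Q) : WP M (.seq p q) s Q := ⟨⟨h.1, h.2.1⟩, h.2.2⟩

theorem assign {v : ℕ} (he : e.eval s = v) (hv : v ≤ M) (h : Q (s.setVar x v)) :
    WP M (.assign x e) s Q := by
  subst he
  exact ⟨hv, h⟩

theorem when {c : Prop} {a b : Expr} (hc : a.eval s < b.eval s ↔ c) (h : c → WP M p s Q)
    (h' : ¬ c → Q s) : WP M (.when a b p) s Q := by
  by_cases hab : a.eval s < b.eval s
  · have := h (hc.1 hab)
    exact ⟨fun _ => this.1, by simpa [Stmt.run, hab] using this.2⟩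
  · exact ⟨fun h => absurd h hab, by simpa [Stmt.run, hab] using h' (mt hc.2 hab)⟩

theorem loop {N : Expr} (n : ℕ) (I : ℕ → Env → Prop) (hN : N.eval s = n) (hM : n ≤ M)
    (h0 : I 0 s) (hp : ∀ i < n, ∀ s', I i s' → WP M p (s'.setVar x i) (I (i + 1)))
    (hQ : ∀ s', I n s' → Q s') : WP M (.loop x N p) s Q := by
  subst hN
  have : ∀ i ≤ N.eval s, I i (iter (fun i s => p.run (s.setVar x i)) i s) := by
    intro i
    induction i with
    | zero => exact fun _ => h0
    | succ i ih => exact fun hi => (hp i hi _ (ih (by omega))).2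
  exact ⟨⟨hM, fun i hi => (hp i hi _ (this i hi.le)).1⟩, hQ _ (this _ le_rfl)⟩

/-- A loop that writes the cells of an array from `o` on, each of which may depend on the previous
ones. -/
theorem fill {N ix : Expr} {α : Fin 16} (n o : ℕ) (G : ℕ → ℕ) (hN : N.eval s = n) (hM : n ≤ M)
    (hG : ∀ i < n, G i ≤ M)
    (hix : ∀ i < n, ∀ f, ix.eval ((s.setVar x i).setTbl α f) = o + i)
    (he : ∀ i < n, ∀ f, (∀ j < i, f (o + j) = G j) → e.eval ((s.setVar x i).setTbl α f) = G i)
    (hQ : ∀ t f, (∀ i < n, f (o + i) = G i) → (∀ y, (∀ i < n, y ≠ o + i) → f y = s.arr α y) →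
      Q ((s.setVar x t).setTbl α f)) :
    WP M (.loop x N (.write α ix e)) s Q := by
  refine loop n (fun i s' => ∃ t f, (∀ j < i, f (o + j) = G j) ∧
    (∀ y, (∀ j < n, y ≠ o + j) → f y = s.arr α y) ∧ s' = (s.setVar x t).setTbl α f) hN hM
    ⟨s.var x, s.arr α, fun _ h => absurd h (by omega), fun _ _ => rfl, ?_⟩ ?_ ?_
  · simp [Env.setVar, Env.setTbl]
  · rintro i hi _ ⟨t, f, h1, h2, rfl⟩
    have e1 : ((s.setVar x t).setTbl α f).setVar x i = (s.setVar x i).setTbl α f := by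
      simp [Env.setVar, Env.setTbl]
    rw [e1]
    refine ⟨(he i hi f h1).trans_le (hG i hi), i, Function.update f (o + i) (G i), ?_, ?_, ?_⟩
    · intro j hj
      by_cases hji : j = i
      · subst hji; simp
      · rw [Function.update_of_ne (by omega)]
        exact h1 j (by omega)
    · intro y hy
      rw [Function.update_of_ne (hy i hi)]
      exact h2 y hy
    · simp only [Stmt.run, hix i hi f, he i hi f h1]
      simp [Env.setTbl, Env.setArr]
  · rintro _ ⟨t, f, h1, h2, rfl⟩
    exact hQ t f h1 h2

/-- A loop that writes an array from cell `0` on. -/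
theorem fill_zero {N : Expr} {α : Fin 16} (n : ℕ) (G : ℕ → ℕ) (hN : N.eval s = n) (hM : n ≤ M)
    (hG : ∀ i < n, G i ≤ M)
    (he : ∀ i < n, ∀ f, (∀ j < i, f j = G j) → e.eval ((s.setVar x i).setTbl α f) = G i)
    (hQ : ∀ t f, (∀ i < n, f i = G i) → Q ((s.setVar x t).setTbl α f)) :
    WP M (.loop x N (.write α (.var x) e)) s Q := by
  refine fill n 0 G hN hM hG (fun i _ f => by simp) (fun i hi f h => he i hi f fun j hj => ?_)
    fun t f h _ => hQ t f fun i hi => ?_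
  · simpa using h j hj
  · simpa using h i hi

/-- A loop that emits a list. -/
theorem emit_loop {N : Expr} (n : ℕ) (G : ℕ → ℕ) (hN : N.eval s = n) (hM : n ≤ M)
    (he : ∀ i < n, ∀ l, e.eval ((s.setVar x i).setOut l) = G i)
    (hQ : ∀ t, Q ((s.setVar x t).setOut (s.out ++ (List.range n).map G))) :
    WP M (.loop x N (.emit e)) s Q := by
  refine loop n (fun i s' => ∃ t, s' = (s.setVar x t).setOut (s.out ++ (List.range i).map G))
    hN hM ⟨s.var x, ?_⟩ ?_ ?_
  · simp [Env.setVar, Env.setOut]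
  · rintro i hi _ ⟨t, rfl⟩
    refine ⟨trivial, i, ?_⟩
    have e1 : ((s.setVar x t).setOut (s.out ++ (List.range i).map G)).setVar x i =
        (s.setVar x i).setOut (s.out ++ (List.range i).map G) := by
      simp [Env.setVar, Env.setOut]
    rw [e1, Stmt.run, he i hi]
    simp [Env.emit, Env.setOut, List.range_succ]
  · rintro _ ⟨t, rfl⟩
    exact hQ t

end WP

end ArrayLang

/-! ### Sets coded by numbers

A set of numbers below `n` is coded by its elements, increased by one, as the digits to the base
`n + 1`. -/

/-- The set of the numbers `v` such that `v + 1` is a digit of `c`. -/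
def codeSet (n c : ℕ) : Finset (Fin n) :=
  Finset.univ.filter fun v => ∃ z ∈ Finset.range c, c / (n + 1) ^ z % (n + 1) = v + 1

/-- The digits are decreasing, except for leading zeros. -/
def Canonical (n c : ℕ) : Prop :=
  ∀ z, c / (n + 1) ^ (z + 1) % (n + 1) = 0 ∨
    c / (n + 1) ^ (z + 1) % (n + 1) < c / (n + 1) ^ z % (n + 1)

theorem digit_eq_zero_of_lt {b c m z : ℕ} (hb : 1 ≤ b) (hc : c < b ^ m) (hz : m ≤ z) :
    c / b ^ z % b = 0 := by
  rw [Nat.div_eq_of_lt (hc.trans_le (Nat.pow_le_pow_right hb hz)), Nat.zero_mod]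

section

variable {n : ℕ}

/-- The range of digit positions in the definition is no restriction: if there is any chord, then `c
< (n + 1) ^ c`, so all digits from position `c` on vanish. -/
theorem mem_codeSet {c : ℕ} {v : Fin n} :
    v ∈ codeSet n c ↔ ∃ z, c / (n + 1) ^ z % (n + 1) = v + 1 := by
  simp only [codeSet, Finset.mem_filter, Finset.mem_univ, true_and, Finset.mem_range]
  refine ⟨fun ⟨z, _, h⟩ => ⟨z, h⟩, fun ⟨z, h⟩ => ⟨z, ?_, h⟩⟩
  by_contra hz
  have hn : 2 ≤ n + 1 := by have := v.isLt; omega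
  rw [digit_eq_zero_of_lt (by omega) (Nat.lt_pow_self hn) (by omega)] at h
  omega

theorem mem_codeSet_of_lt {c m : ℕ} (hc : c < (n + 1) ^ m) {v : Fin n} :
    v ∈ codeSet n c ↔ ∃ z < m, c / (n + 1) ^ z % (n + 1) = v + 1 := by
  rw [mem_codeSet]
  refine ⟨fun ⟨z, h⟩ => ⟨z, ?_, h⟩, fun ⟨z, _, h⟩ => ⟨z, h⟩⟩
  by_contra hz
  rw [digit_eq_zero_of_lt (by omega) hc (by omega)] at h
  omega

theorem codeSet_zero : codeSet n 0 = ∅ := by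
  ext v
  simp [codeSet]

theorem digit_cons_zero {b c d : ℕ} (hd : d < b) : (c * b + d) / b ^ 0 % b = d := by
  rw [pow_zero, Nat.div_one, mul_comm, Nat.mul_add_mod, Nat.mod_eq_of_lt hd]

theorem digit_cons_succ {b c d : ℕ} (hd : d < b) (z : ℕ) :
    (c * b + d) / b ^ (z + 1) % b = c / b ^ z % b := by
  rw [pow_succ', ← Nat.div_div_eq_div_mul]
  congr 2
  rw [mul_comm, Nat.mul_add_div (by omega), Nat.div_eq_of_lt hd, add_zero]

theorem codeSet_cons {c : ℕ} (v : Fin n) :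
    codeSet n (c * (n + 1) + (v + 1)) = insert v (codeSet n c) := by
  have hv : (v : ℕ) + 1 < n + 1 := by omega
  ext u
  rw [Finset.mem_insert, mem_codeSet, mem_codeSet]
  constructor
  · rintro ⟨z | z, h⟩
    · rw [digit_cons_zero hv] at h
      left; omega
    · rw [digit_cons_succ hv] at h
      exact Or.inr ⟨z, h⟩
  · rintro (rfl | ⟨z, h⟩)
    · exact ⟨0, digit_cons_zero hv⟩
    · exact ⟨z + 1, by rw [digit_cons_succ hv, h]⟩

theorem Canonical.lt {c : ℕ} (h : Canonical n c) {y z : ℕ} (hyz : y < z) :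
    c / (n + 1) ^ z % (n + 1) = 0 ∨ c / (n + 1) ^ z % (n + 1) < c / (n + 1) ^ y % (n + 1) := by
  obtain ⟨d, rfl⟩ : ∃ d, z = y + 1 + d := ⟨z - (y + 1), by omega⟩
  clear hyz
  induction d with
  | zero => exact h y
  | succ d ih =>
    have := h (y + 1 + d)
    rw [show y + 1 + (d + 1) = y + 1 + d + 1 by ring]
    omega

/-- At the first position where the digits might differ, suppose the digit of `c` is larger. The
element it stands for also occurs in `c'`. At an earlier position of `c'` it would repeat an earlier
digit of `c`, and at a later one it would have to be smaller than the digit of `c'` at `z`; both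
contradict monotonicity. -/
theorem Canonical.digit_le {c c' : ℕ} (h : Canonical n c) (h' : Canonical n c')
    (hs : codeSet n c ⊆ codeSet n c') {z : ℕ}
    (hz : ∀ y < z, c / (n + 1) ^ y % (n + 1) = c' / (n + 1) ^ y % (n + 1)) :
    c / (n + 1) ^ z % (n + 1) ≤ c' / (n + 1) ^ z % (n + 1) := by
  by_contra! hlt
  have hd : c / (n + 1) ^ z % (n + 1) < n + 1 := Nat.mod_lt _ (by omega)
  have hv : (⟨c / (n + 1) ^ z % (n + 1) - 1, by omega⟩ : Fin n) ∈ codeSet n c :=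
    mem_codeSet.2 ⟨z, by dsimp only; omega⟩
  obtain ⟨y, hy⟩ := mem_codeSet.1 (hs hv)
  dsimp only at hy
  rcases lt_trichotomy y z with hyz | rfl | hyz
  · have := h.lt hyz
    have := hz y hyz
    omega
  · omega
  · have := h'.lt hyz
    omega

theorem Canonical.digit_eq {c c' : ℕ} (h : Canonical n c) (h' : Canonical n c')
    (hs : codeSet n c = codeSet n c') (z : ℕ) :
    c / (n + 1) ^ z % (n + 1) = c' / (n + 1) ^ z % (n + 1) := by
  induction z using Nat.strong_induction_on with
  | _ z ih =>
    exact le_antisymm (h.digit_le h' hs.subset ih)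
      (h'.digit_le h hs.symm.subset fun y hy => (ih y hy).symm)

theorem eq_of_digit_eq {b m c c' : ℕ} (hc : c < b ^ m) (hc' : c' < b ^ m)
    (h : ∀ z < m, c / b ^ z % b = c' / b ^ z % b) : c = c' := by
  induction m generalizing c c' with
  | zero => rw [pow_zero] at hc hc'; omega
  | succ m ih =>
    have h0 := h 0 (by omega)
    rw [pow_zero, Nat.div_one, Nat.div_one] at h0
    have h1 : c / b = c' / b := by
      refine ih (Nat.div_lt_of_lt_mul (by rwa [← pow_succ'])) (Nat.div_lt_of_lt_mul
        (by rwa [← pow_succ'])) fun z hz => ?_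
      have := h (z + 1) (by omega)
      rwa [pow_succ', ← Nat.div_div_eq_div_mul, ← Nat.div_div_eq_div_mul] at this
    rw [← Nat.div_add_mod c b, ← Nat.div_add_mod c' b, h0, h1]

theorem Canonical.eq {m c c' : ℕ} (h : Canonical n c) (h' : Canonical n c')
    (hc : c < (n + 1) ^ m) (hc' : c' < (n + 1) ^ m) (hs : codeSet n c = codeSet n c') : c = c' :=
  eq_of_digit_eq hc hc' fun z _ => h.digit_eq h' hs z

theorem cons_lt {c d m b : ℕ} (hc : c < b ^ m) (hd : d < b) : c * b + d < b ^ (m + 1) := by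
  rw [pow_succ]
  nlinarith

/-- Induction by adding a new maximum, which becomes the digit at position `0`. Together with
uniqueness of canonical codes this lets the main loop treat each outer boundary exactly once. -/
theorem exists_canonical (X : Finset (Fin n)) :
    ∃ c < (n + 1) ^ X.card, codeSet n c = X ∧ Canonical n c := by
  induction X using Finset.induction_on_max with
  | empty => exact ⟨0, by simp, codeSet_zero, fun z => by simp⟩
  | insert a X ha ih =>
    obtain ⟨c, h1, h2, h3⟩ := ih
    have hv : (a : ℕ) + 1 < n + 1 := by omega
    refine ⟨c * (n + 1) + (a + 1), ?_, by rw [codeSet_cons, h2], fun z => ?_⟩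
    · rw [Finset.card_insert_of_notMem fun h => (ha a h).false]
      exact cons_lt h1 hv
    · rcases z with _ | z
      · rw [digit_cons_succ hv, digit_cons_zero hv]
        by_contra! h
        have hd : c / (n + 1) ^ 0 % (n + 1) < n + 1 := Nat.mod_lt _ (by omega)
        have := ha ⟨c / (n + 1) ^ 0 % (n + 1) - 1, by omega⟩
          (h2 ▸ mem_codeSet.2 ⟨0, by dsimp only; omega⟩)
        rw [Fin.lt_def] at this
        dsimp only at this
        omega
      · rw [digit_cons_succ hv, digit_cons_succ hv]
        exact h3 z

theorem exists_canonical_lt {m : ℕ} {X : Finset (Fin n)} (hX : X.card ≤ m) :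
    ∃ c < (n + 1) ^ m, codeSet n c = X ∧ Canonical n c := by
  obtain ⟨c, h1, h2⟩ := exists_canonical X
  exact ⟨c, h1.trans_le (Nat.pow_le_pow_right (by omega) hX), h2⟩

end

/-! ### Pruning an outer boundary to a bounded number of chords -/

namespace PolygonModel

variable {k n : ℕ} (J : PolygonModel k n)

/-- `d - 1` is a chord that intersects or equals `v`. -/
def LinkDigit (d : ℕ) (v : Fin n) : Prop := ∃ u : Fin n, d = u + 1 ∧ J.link u v = 1

variable {J}

theorem not_linkDigit_zero {v : Fin n} : ¬ J.LinkDigit 0 v := by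
  rintro ⟨u, h, -⟩
  omega

theorem linkDigit_succ {u v : Fin n} : J.LinkDigit (u + 1) v ↔ J.link u v = 1 := by
  constructor
  · rintro ⟨u', h, h'⟩
    rwa [show u = u' from Fin.ext (by omega)]
  · exact fun h => ⟨u, rfl, h⟩

theorem exists_linkDigit_iff {c : ℕ} {v : Fin n} :
    (∃ z, J.LinkDigit (c / (n + 1) ^ z % (n + 1)) v) ↔ ∃ u ∈ codeSet n c, J.link u v = 1 := by
  simp only [LinkDigit, mem_codeSet]
  constructor
  · rintro ⟨z, u, h⟩; exact ⟨u, ⟨z, h.1⟩, h.2⟩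
  · rintro ⟨u, ⟨z, h⟩, h'⟩; exact ⟨z, u, h, h'⟩

variable (J)

/-- Some chord between `i` and `j` is linked to digit `z` of `c`, but neither to a later digit nor
to a digit of `a`. -/
def Needed (i j : Fin k) (c a z : ℕ) : Prop :=
  ∃ v ∈ J.between i j, J.LinkDigit (c / (n + 1) ^ z % (n + 1)) v ∧
    (∀ y, ¬ J.LinkDigit (a / (n + 1) ^ y % (n + 1)) v) ∧
    ∀ y, z < y → ¬ J.LinkDigit (c / (n + 1) ^ y % (n + 1)) v

open scoped Classical in
/-- The code of those of the first digits of `c` that are needed to dominate the chords between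
`i` and `j`. -/
noncomputable def prune (i j : Fin k) (c : ℕ) : ℕ → ℕ
  | 0 => 0
  | z + 1 =>
    if J.Needed i j c (prune i j c z) z then prune i j c z * (n + 1) + c / (n + 1) ^ z % (n + 1)
    else prune i j c z

variable {J} {i j : Fin k} {c m : ℕ}

theorem prune_succ_of_needed {z : ℕ} (h : J.Needed i j c (J.prune i j c z) z) :
    ∃ u : Fin n, c / (n + 1) ^ z % (n + 1) = u + 1 ∧ u ∉ codeSet n (J.prune i j c z) ∧
      J.prune i j c (z + 1) = J.prune i j c z * (n + 1) + (u + 1) := by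
  have h' := h
  obtain ⟨v, -, ⟨u, hu, hl⟩, h2, -⟩ := h'
  refine ⟨u, hu, fun hmem => ?_, by rw [prune, if_pos h, hu]⟩
  obtain ⟨y, hy⟩ := exists_linkDigit_iff.2 ⟨u, hmem, hl⟩
  exact h2 y hy

/-- A digit is kept only if its chord has not been kept before, so the code has as many digits as
the set has elements. Thus a bound on the cardinality bounds the code, and the code can index a
table. -/
theorem prune_lt (z : ℕ) :
    J.prune i j c z < (n + 1) ^ (codeSet n (J.prune i j c z)).card := by
  classical
  induction z with
  | zero => simp [prune, codeSet_zero]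
  | succ z ih =>
    by_cases h : J.Needed i j c (J.prune i j c z) z
    · obtain ⟨u, -, hu, e⟩ := prune_succ_of_needed h
      rw [e, codeSet_cons, Finset.card_insert_of_notMem hu]
      exact cons_lt ih (by omega)
    · rw [prune, if_neg h]
      exact ih

theorem prune_lt_pow (z : ℕ) : J.prune i j c z < (n + 1) ^ z := by
  classical
  induction z with
  | zero => simp [prune]
  | succ z ih =>
    rw [prune]
    split_ifs
    · exact cons_lt ih (Nat.mod_lt _ (by omega))
    · exact ih.trans_le (Nat.pow_le_pow_right (by omega) (by omega))

theorem codeSet_prune_subset_codeSet (z : ℕ) : codeSet n (J.prune i j c z) ⊆ codeSet n c := by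
  classical
  induction z with
  | zero => simp [prune, codeSet_zero]
  | succ z ih =>
    by_cases h : J.Needed i j c (J.prune i j c z) z
    · obtain ⟨u, hu, -, e⟩ := prune_succ_of_needed h
      rw [e, codeSet_cons]
      exact Finset.insert_subset (mem_codeSet.2 ⟨z, hu⟩) ih
    · rw [prune, if_neg h]
      exact ih

theorem mem_codeSet_prune {z y : ℕ} (hzy : z ≤ y) {u : Fin n}
    (hu : u ∈ codeSet n (J.prune i j c y)) :
    u ∈ codeSet n (J.prune i j c z) ∨ ∃ x, z ≤ x ∧ x < y ∧ c / (n + 1) ^ x % (n + 1) = u + 1 := by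
  classical
  induction y with
  | zero => exact Or.inl (by rwa [show z = 0 by omega])
  | succ y ih =>
    by_cases hz : z = y + 1
    · exact Or.inl (hz ▸ hu)
    by_cases h : J.Needed i j c (J.prune i j c y) y
    · obtain ⟨u', hu', -, e⟩ := prune_succ_of_needed h
      rw [e, codeSet_cons, Finset.mem_insert] at hu
      rcases hu with rfl | hu
      · exact Or.inr ⟨y, by omega, by omega, hu'⟩
      · rcases ih (by omega) hu with h | ⟨x, h1, h2, h3⟩
        exacts [Or.inl h, Or.inr ⟨x, h1, by omega, h3⟩]
    · rw [prune, if_neg h] at hu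
      rcases ih (by omega) hu with h | ⟨x, h1, h2, h3⟩
      exacts [Or.inl h, Or.inr ⟨x, h1, by omega, h3⟩]

/-- The invariant of the greedy pass: whatever `c` dominates between the two sides is dominated by
the digits kept so far or by one still to come. A digit is dropped only if this remains true without
it. -/
theorem link_prune_of_link {v : Fin n} (hv : v ∈ J.between i j) {z y : ℕ}
    (h : J.LinkDigit (c / (n + 1) ^ y % (n + 1)) v) :
    (∃ u ∈ codeSet n (J.prune i j c z), J.link u v = 1) ∨
      ∃ x, z ≤ x ∧ J.LinkDigit (c / (n + 1) ^ x % (n + 1)) v := by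
  classical
  induction z with
  | zero => exact Or.inr ⟨y, by omega, h⟩
  | succ z ih =>
    have ih' : (∃ u ∈ codeSet n (J.prune i j c z), J.link u v = 1) ∨
        J.LinkDigit (c / (n + 1) ^ z % (n + 1)) v ∨
        ∃ x, z + 1 ≤ x ∧ J.LinkDigit (c / (n + 1) ^ x % (n + 1)) v := by
      rcases ih with h | ⟨x, h1, h2⟩
      · exact Or.inl h
      · by_cases hx : x = z
        · exact Or.inr (Or.inl (hx ▸ h2))
        · exact Or.inr (Or.inr ⟨x, by omega, h2⟩)
    by_cases hn : J.Needed i j c (J.prune i j c z) z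
    · obtain ⟨u, hu, -, e⟩ := prune_succ_of_needed hn
      rw [e, codeSet_cons]
      rcases ih' with ⟨u', h1, h2⟩ | h1 | h1
      · exact Or.inl ⟨u', Finset.mem_insert_of_mem h1, h2⟩
      · rw [hu, linkDigit_succ] at h1
        exact Or.inl ⟨u, Finset.mem_insert_self _ _, h1⟩
      · exact Or.inr h1
    · rw [prune, if_neg hn]
      rcases ih' with h1 | h1 | h1
      · exact Or.inl h1
      · by_contra! hc
        refine hn ⟨v, hv, h1, fun y hy => ?_, fun y hy => hc.2 y hy⟩
        obtain ⟨u, hu, hl⟩ := exists_linkDigit_iff.1 ⟨y, hy⟩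
        exact hc.1 u hu hl
      · exact Or.inr h1

theorem exists_link_prune_iff (hc : c < (n + 1) ^ m) {v : Fin n} (hv : v ∈ J.between i j) :
    (∃ u ∈ codeSet n (J.prune i j c m), J.link u v = 1) ↔ ∃ u ∈ codeSet n c, J.link u v = 1 := by
  refine ⟨fun ⟨u, h1, h2⟩ => ⟨u, codeSet_prune_subset_codeSet m h1, h2⟩, fun h => ?_⟩
  obtain ⟨y, hy⟩ := exists_linkDigit_iff.2 h
  rcases link_prune_of_link hv (z := m) hy with h | ⟨x, h1, h2⟩
  · exact h
  · rw [digit_eq_zero_of_lt (by omega) hc h1] at h2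
    exact absurd h2 not_linkDigit_zero

/-- The chord `v` that caused `u` to be kept stays private to `u`: by `Needed` it is linked neither
to the digits kept earlier nor to any later digit of `c`. -/
theorem prune_minimal {z : ℕ} {u : Fin n} (hu : u ∈ codeSet n (J.prune i j c z)) :
    ∃ v ∈ J.between i j, J.link u v = 1 ∧
      ∀ u' ∈ codeSet n (J.prune i j c z), u' ≠ u → J.link u' v ≠ 1 := by
  classical
  have : ∃ x < z, J.Needed i j c (J.prune i j c x) x ∧ c / (n + 1) ^ x % (n + 1) = u + 1 := by
    induction z with
    | zero => simp [prune, codeSet_zero] at hu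
    | succ z ih =>
      by_cases h : J.Needed i j c (J.prune i j c z) z
      · obtain ⟨u', hu', -, e⟩ := prune_succ_of_needed h
        rw [e, codeSet_cons, Finset.mem_insert] at hu
        rcases hu with rfl | hu
        · exact ⟨z, by omega, h, hu'⟩
        · obtain ⟨x, h1, h2⟩ := ih hu
          exact ⟨x, by omega, h2⟩
      · rw [prune, if_neg h] at hu
        obtain ⟨x, h1, h2⟩ := ih hu
        exact ⟨x, by omega, h2⟩
  obtain ⟨x, hx, ⟨v, hv, h1, h2, h3⟩, hxu⟩ := this
  rw [hxu, linkDigit_succ] at h1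
  refine ⟨v, hv, h1, fun u' hu' hne hl => ?_⟩
  rcases mem_codeSet_prune hx.le hu' with h | ⟨y, hy, -, hyu⟩
  · obtain ⟨y, hy⟩ := exists_linkDigit_iff.2 ⟨u', h, hl⟩
    exact h2 y hy
  · rcases hy.eq_or_lt with rfl | hy
    · exact hne (Fin.ext (by omega))
    · exact h3 y hy (by rw [hyu, linkDigit_succ]; exact hl)

variable (J)

/-- `c` is the code of a possible outer boundary. -/
def ValidCode (c : ℕ) : Prop :=
  Canonical n c ∧ ∀ v ∈ codeSet n c, J.IsExtreme (codeSet n c) v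

/-- The number of digits of the codes of outer boundaries. -/
def boundarySize (k : ℕ) : ℕ := 2 * (k * (k - 2))

/-- The number of digits of the codes of the relevant parts of outer boundaries. -/
def pruneSize (k : ℕ) : ℕ := if k < 4 then 4 else 9

/-- The iteration for the outer boundary with code `c`. -/
noncomputable def iterationOf (c : ℕ) : Iteration k n where
  boundary := codeSet n c
  sub i j := J.optSub (codeSet n (J.prune i j c (boundarySize k))) i j

variable {J}

/-- The pruned set is a subset of an outer boundary in which every chord has a private chord to
dominate, so `card_le_of_minimal` applies. -/
theorem prune_lt_of_validCode (hk : 3 ≤ k) (hv : J.ValidCode c) (hij : i < j) :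
    J.prune i j c m < (n + 1) ^ pruneSize k := by
  obtain ⟨E, hE⟩ := (J.exists_outerBoundary_eq_iff hk).2 hv.2
  refine (prune_lt m).trans_le (Nat.pow_le_pow_right (by omega) ?_)
  refine J.card_le_of_minimal hk hij (E := E) ?_ fun u hu => prune_minimal hu
  rw [hE]
  exact codeSet_prune_subset_codeSet m

theorem isMinSub_congr {O O' X : Finset (Fin n)} (h : J.undominated O i j = J.undominated O' i j)
    (hX : J.IsMinSub O i j X) : J.IsMinSub O' i j X := by
  unfold IsMinSub at *
  rwa [← h]

/-- The optimal set is computed for the pruned boundary, but the subproblem sees only which chords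
of `J_ij` are dominated, and pruning does not change that. -/
theorem isMinSub_iterationOf (hk : 3 ≤ k) (hc : c < (n + 1) ^ boundarySize k) (hij : i < j) :
    J.IsMinSub (J.iterationOf c).boundary i j ((J.iterationOf c).sub i j) := by
  refine isMinSub_congr ?_ (J.isMinSub_optSub hk _ hij)
  ext v
  simp only [undominated, Finset.mem_sdiff, J.mem_closedNbhd hk]
  exact and_congr_right fun hv => not_congr (exists_link_prune_iff hc hv)

open scoped Classical in
-- Runs through all codes in increasing order. No boundary is treated twice by uniqueness of
-- canonical codes, and none is missed because of the bound on the size of an outer boundary.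
theorem isRun_of_codes (hk : 3 ≤ k) {D : Finset (Fin n)} {c₀ : ℕ}
    (hc : c₀ < (n + 1) ^ boundarySize k) (hv : J.ValidCode c₀)
    (hD : D = (J.iterationOf c₀).candidate)
    (hle : ∀ c < (n + 1) ^ boundarySize k, J.ValidCode c →
      D.card ≤ (J.iterationOf c).candidate.card) :
    J.IsRun (((List.range ((n + 1) ^ boundarySize k)).filter fun c => J.ValidCode c).map
      J.iterationOf) D := by
  have hmem : ∀ a, a ∈ ((List.range ((n + 1) ^ boundarySize k)).filter fun c =>
      J.ValidCode c).map J.iterationOf ↔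
      ∃ c < (n + 1) ^ boundarySize k, J.ValidCode c ∧ J.iterationOf c = a := by
    intro a
    simp [and_assoc]
  have hdom : ∀ c < (n + 1) ^ boundarySize k,
      J.closedNbhd (J.iterationOf c).candidate = Finset.univ := fun c hc =>
    J.closedNbhd_candidate fun i j hij => isMinSub_iterationOf hk hc hij
  refine ⟨?_, fun O => ?_, ?_, ?_, ?_⟩
  · rw [List.map_map]
    refine List.Nodup.map_on ?_ (List.nodup_range.filter _)
    intro c h c' h' e
    simp only [List.mem_filter, List.mem_range, decide_eq_true_eq] at h h'
    exact h.2.1.eq h'.2.1 h.1 h'.1 e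
  · rw [List.mem_map]
    simp only [hmem]
    constructor
    · rintro ⟨_, ⟨c, -, h, rfl⟩, rfl⟩
      exact (J.exists_outerBoundary_eq_iff hk).2 h.2
    · rintro ⟨E, hE⟩
      obtain ⟨c, h1, h2, h3⟩ := exists_canonical_lt (hE ▸ J.card_outerBoundary_le hk E :
        O.card ≤ boundarySize k)
      refine ⟨_, ⟨c, h1, ⟨h3, ?_⟩, rfl⟩, h2⟩
      rw [h2]
      exact (J.exists_outerBoundary_eq_iff hk).1 ⟨E, hE⟩
  · intro a ha i j hij
    obtain ⟨c, h, -, rfl⟩ := (hmem a).1 ha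
    exact isMinSub_iterationOf hk h hij
  · exact ⟨_, (hmem _).2 ⟨c₀, hc, hv, rfl⟩, hdom c₀ hc, hD⟩
  · intro a ha _
    obtain ⟨c, h, h', rfl⟩ := (hmem a).1 ha
    exact hle c h h'

theorem validCode_zero : J.ValidCode 0 :=
  ⟨fun z => by simp, fun v hv => by simp [codeSet_zero] at hv⟩

end PolygonModel

/-! ### The program

Variables `0` to `6` hold `k`, `n`, the numbers of digits of the codes of outer boundaries and of
their relevant parts, the numbers of codes of the latter and of the former kind, and `2 n + 2`.
Array `0` holds the input, arrays `1` to `4` hold, for every label, the chord, the label of the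
other endpoint, the side, and the side of the other endpoint; array `5` holds the powers of
`n + 1`, and array `6` the results of the dynamic programs. -/

namespace ArrayLang

open ArrayLang.Expr

/-- The label of endpoint `b` of chord `u`. -/
def labE (u b : Expr) : Expr := rd 0 (u * lit 4 + b * lit 2 + lit 2)

/-- The side of endpoint `b` of chord `u`. -/
def sideE (u b : Expr) : Expr := rd 0 (u * lit 4 + b * lit 2 + lit 3)

/-- Whether the chords `u` and `v` are equal or intersect. -/
def linkE (u v : Expr) : Expr :=
  ((labE u (lit 0)).lt (labE v (lit 0)) + (labE u (lit 0)).lt (labE v (lit 1)) +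
    (labE u (lit 1)).lt (labE v (lit 0)) + (labE u (lit 1)).lt (labE v (lit 1))) % lit 2

/-- Digit `z` of the code `c`. -/
def digE (c z : Expr) : Expr := c / rd 5 z % (var 1 + lit 1)

/-- Whether the chord with digit `d` is linked to `v`. -/
def linkDigE (d v : Expr) : Expr := d.and ((linkE (d - lit 1) v).eq (lit 1))

/-- The sum of the values `f`, depending on the chord `10` and the endpoint `11`, over the endpoint
with label `l`. -/
def atE (f l : Expr) : Expr :=
  sum 10 (var 1) (sum 11 (lit 2) (cond ((labE (var 10) (var 11)).eq l) f (lit 0)))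

/-- Computes the first variables, and the powers of `n + 1`. -/
def setupProg : Stmt :=
  .seq (.assign 0 (rd 0 (lit 0))) <|
  .seq (.assign 1 (rd 0 (lit 1))) <|
  .seq (.assign 2 (lit 2 * (var 0 * (var 0 - lit 2)))) <|
  .seq (.assign 3 (cond ((var 0).lt (lit 4)) (lit 4) (lit 9))) <|
  .seq (.assign 6 (lit 2 * var 1 + lit 2)) <|
  .seq (.loop 9 (var 2 + lit 1) (.write 5 (var 9)
    (cond (var 9) (rd 5 (var 9 - lit 1) * (var 1 + lit 1)) (lit 1)))) <|
  .seq (.assign 4 (rd 5 (var 3))) (.assign 5 (rd 5 (var 2)))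

/-- Computes the tables for the labels. -/
def tablesProg : Stmt :=
  .seq (.loop 9 (var 6 - lit 1) (.write 1 (var 9) (atE (var 10) (var 9)))) <|
  .seq (.loop 9 (var 6 - lit 1) (.write 2 (var 9)
    (atE (labE (var 10) (lit 1 - var 11)) (var 9)))) <|
  .seq (.loop 9 (var 6 - lit 1) (.write 3 (var 9) (atE (sideE (var 10) (var 11)) (var 9))))
    (.loop 9 (var 6 - lit 1) (.write 4 (var 9)
      (atE (sideE (var 10) (lit 1 - var 11)) (var 9))))

/-- Whether a chord has its endpoint labelled `l` on side `i` and the other one on side `j`. -/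
def hasE (i j l : Expr) : Expr := ((rd 3 l).eq i).and ((rd 4 l).eq j)

/-- `takeRest`. -/
def takeRestE (x r : Expr) : Expr := cond (r.lt x) (lit 0) r

/-- `skipRest`. -/
def skipRestE (u x q r : Expr) : Expr := cond (u.and (q.lt x).not) (r.max x) r

/-- `costToGo` from the table in array `8`. -/
def cellE (z q r : Expr) : Expr := rd 8 ((z * var 6 + q) * var 6 + r)

/-- `Takes` at the position `l`. -/
def takesE (i j l q r : Expr) : Expr :=
  (hasE i j l).and ((lit 1 + cellE (var 6 - lit 2 - l) (q.min (rd 2 l)) (takeRestE (rd 2 l) r)).lt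
    (cellE (var 6 - lit 2 - l) q (skipRestE (rd 7 l) (rd 2 l) q r)))

/-- The entry of the table of `costToGo` for `z` remaining positions, first position `l`. -/
def costE (i j z q r l : Expr) : Expr :=
  cond z (cond (hasE i j l)
    ((lit 1 + cellE (z - lit 1) (q.min (rd 2 l)) (takeRestE (rd 2 l) r)).min
      (cellE (z - lit 1) q (skipRestE (rd 7 l) (rd 2 l) q r)))
    (cellE (z - lit 1) q r)) (cond r (var 6 - lit 1) (lit 0))

/-- The state after position `l`, from the state before it. -/
def stateE (i j l st : Expr) : Expr :=
  cond (hasE i j l) (cond (takesE i j l (st / var 6) (st % var 6))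
    ((st / var 6).min (rd 2 l) * var 6 + takeRestE (rd 2 l) (st % var 6))
    (st / var 6 * var 6 + skipRestE (rd 7 l) (rd 2 l) (st / var 6) (st % var 6))) st

/-- The dynamic program for the code and the sides that the variable `8` stands for. -/
def dynProg : Stmt :=
  .seq (.loop 9 (var 6 - lit 1) (.write 7 (var 9) ((var 9).and
    (all 10 (var 3) (linkDigE (digE (var 8 / var 0 / var 0) (var 10)) (rd 1 (var 9))).not)))) <|
  .seq (.loop 9 ((var 6 - lit 1) * var 6 * var 6) (.write 8 (var 9)
    (costE (var 8 / var 0 % var 0) (var 8 % var 0) (var 9 / var 6 / var 6) (var 9 / var 6 % var 6)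
      (var 9 % var 6) (var 6 - lit 1 - var 9 / var 6 / var 6)))) <|
  .seq (.loop 9 (var 6 - lit 1) (.write 9 (var 9) (cond (var 9)
    (stateE (var 8 / var 0 % var 0) (var 8 % var 0) (var 9) (rd 9 (var 9 - lit 1)))
    ((var 6 - lit 1) * var 6))))
  (.loop 9 (var 1) (.write 6 (var 8 * var 1 + var 9) (ex 10 (lit 2)
    (((sideE (var 9) (var 10)).eq (var 8 / var 0 % var 0)).and
      (((sideE (var 9) (lit 1 - var 10)).eq (var 8 % var 0)).and
        (takesE (var 8 / var 0 % var 0) (var 8 % var 0) (labE (var 9) (var 10))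
          (rd 9 (labE (var 9) (var 10) - lit 1) / var 6)
          (rd 9 (labE (var 9) (var 10) - lit 1) % var 6)))))))

/-- All dynamic programs. -/
def dynLoop : Stmt := .loop 8 (var 4 * var 0 * var 0) dynProg

/-- `Canonical`. -/
def canonicalE (c : Expr) : Expr :=
  all 9 (var 2) ((digE c (var 9 + lit 1)).not.or ((digE c (var 9 + lit 1)).lt (digE c (var 9))))

/-- The next side. -/
def nextE (i : Expr) : Expr := cond ((i + lit 1).lt (var 0)) (i + lit 1) (lit 0)

/-- Whether `p` holds for all endpoints `12` of chords `u`, with digit `11` of `c`, that are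
parallel to endpoint `b` of `v`. -/
def parallelE (c v b : Expr) (p : Expr → Expr) : Expr :=
  all 11 (var 2) ((digE c (var 11)).not.or (all 12 (lit 2)
    (((sideE (digE c (var 11) - lit 1) (var 12)).eq (sideE v b)).not.or
      (((sideE (digE c (var 11) - lit 1) (lit 1 - var 12)).eq (sideE v (lit 1 - b))).not.or
        (p (digE c (var 11) - lit 1))))))

/-- `IsExtreme`. -/
def extremeE (c v : Expr) : Expr :=
  ex 10 (lit 2)
    ((((sideE v (var 10)).eq (nextE (sideE v (lit 1 - var 10)))).not.and
      (parallelE c v (var 10) fun u => ((labE u (var 12)).lt (labE v (var 10))).not)).or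
    (((sideE v (lit 1 - var 10)).eq (nextE (sideE v (var 10)))).not.and
      (parallelE c v (var 10) fun u => ((labE v (var 10)).lt (labE u (var 12))).not)))

/-- `ValidCode`. -/
def validE (c : Expr) : Expr :=
  (canonicalE c).and (all 9 (var 2) ((digE c (var 9)).not.or (extremeE c (digE c (var 9) - lit 1))))

/-- Whether `v` belongs to the set with code `c`. -/
def memE (c v : Expr) : Expr := ex 10 (var 2) ((digE c (var 10)).eq (v + lit 1))

/-- `Needed`. -/
def neededE (i j c a z : Expr) : Expr :=
  ex 10 (var 1)
    (((ex 11 (lit 2) ((sideE (var 10) (var 11)).eq i)).and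
      (ex 11 (lit 2) ((sideE (var 10) (var 11)).eq j))).and
    ((linkDigE (digE c z) (var 10)).and
      ((all 11 (var 2) (linkDigE (digE a (var 11)) (var 10)).not).and
        (all 11 (var 2) ((z.lt (var 11)).not.or (linkDigE (digE c (var 11)) (var 10)).not)))))

/-- One more step of `prune`. -/
def pruneE (i j c a z : Expr) : Expr :=
  cond (neededE i j c a z) (a * (var 1 + lit 1) + digE c z) a

/-- Fills array `10` with the values of `prune`. -/
def pruneProg : Stmt :=
  .loop 9 (var 0 * var 0 * (var 2 + lit 1)) (.write 10 (var 9)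
    (cond (var 9 % (var 2 + lit 1))
      (pruneE (var 9 / (var 2 + lit 1) / var 0 % var 0) (var 9 / (var 2 + lit 1) % var 0) (var 8)
        (rd 10 (var 9 - lit 1)) (var 9 % (var 2 + lit 1) - lit 1)) (lit 0)))

/-- Whether `v` belongs to the minimum set for the sides `i` and `j`. -/
def subE (i j v : Expr) : Expr :=
  rd 6 (((rd 10 ((i * var 0 + j) * (var 2 + lit 1) + var 2) * var 0 + i) * var 0 + j) * var 1 + v)

/-- Writes out the iteration for the outer boundary with code `8`. -/
def reportProg : Stmt :=
  .seq (.loop 9 (var 1) (.emit (memE (var 8) (var 9)))) <|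
  .seq pruneProg <|
  .loop 11 (var 0) (.loop 12 (var 0) (.when (var 11) (var 12)
    (.loop 9 (var 1) (.emit (subE (var 11) (var 12) (var 9))))))

/-- Keeps the candidate if it is the smallest one so far. -/
def selectProg : Stmt :=
  .seq (.loop 9 (var 1) (.write 11 (var 9) ((memE (var 8) (var 9)).or
    (ex 11 (var 0) (ex 12 (var 0) (((var 11).lt (var 12)).and
      (subE (var 11) (var 12) (var 9)))))))) <|
  .seq (.assign 13 (sum 9 (var 1) (rd 11 (var 9))))
    (.when (var 13) (var 14) (.seq (.assign 14 (var 13))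
      (.loop 9 (var 1) (.write 12 (var 9) (rd 11 (var 9))))))

/-- The main loop. -/
def mainLoop : Stmt :=
  .loop 8 (var 5) (.when (lit 0) (validE (var 8)) (.seq reportProg selectProg))

/-- The program after the setup. -/
def mainProg : Stmt :=
  .seq tablesProg <| .seq dynLoop <| .seq (.assign 14 (var 1 + lit 1)) <|
  .seq mainLoop (.loop 9 (var 1) (.emit (rd 12 (var 9))))

theorem safe_mainProg : mainProg.Safe := by decide +kernel

/-- The degrees of the first variables, for codes of `w` and `m` digits. -/
def degs (w m : ℕ) : ℕ → ℕ
  | 1 => 1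
  | 4 => w
  | 5 => m
  | 6 => 1
  | _ => 0

section

variable (d : ℕ → ℕ) (a b : Expr)

theorem deg_sub : (a - b).deg d = Max.max (a.deg d) (b.deg d) := rfl

theorem deg_div : (a / b).deg d = Max.max (a.deg d) (b.deg d) := rfl

theorem valDeg_sub : (a - b).valDeg d = Max.max (a.valDeg d) (b.valDeg d) := rfl

end

/-- The precomputation has degree `w + 3`: codes with `w` digits times a cubic table. The main loop
has degree `m + 1`: codes with `m` digits times linear work. The label tables have degree `2`. -/
theorem deg_mainProg_le (w m : ℕ) (h : w + 3 ≤ m + 1) (hm : 2 ≤ m + 1) :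
    mainProg.deg (degs w m) ≤ m + 1 := by
  simp only [mainProg, tablesProg, dynLoop, dynProg, mainLoop, reportProg, selectProg, pruneProg,
    subE, pruneE, neededE, memE, validE, extremeE, parallelE, nextE, canonicalE, stateE, costE,
    takesE, cellE, skipRestE, takeRestE, hasE, atE, linkDigE, digE, linkE, sideE, labE,
    Expr.cond, Expr.lt, Expr.eq, Expr.not, Expr.and, Expr.or, ex, all, Expr.min, Expr.max,
    Stmt.deg, Expr.deg, valDeg, deg_sub, deg_div, valDeg_sub, degs, max_self,
    zero_max, max_zero, zero_add, add_zero]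
  omega

end ArrayLang

/-! ### Expressions as tests of propositions -/

namespace ArrayLang

open ArrayLang.Expr

/-- The expression is not zero if and only if the proposition holds. -/
def Tests (e : Expr) (s : Env) (P : Prop) : Prop := e.eval s ≠ 0 ↔ P

namespace Tests

variable {a b e N : Expr} {s : Env} {P Q : Prop} {x n : ℕ}

theorem eq_bit (h : Tests e s P) (h' : e.eval s ≤ 1) : e.eval s = bit P := by
  unfold Tests at h
  unfold bit
  split_ifs with hP
  · have := h.2 hP; omega
  · exact not_not.1 (mt h.1 hP)

theorem congr (h : Tests e s P) (h' : P ↔ Q) : Tests e s Q := Iff.trans h h'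

theorem and (ha : Tests a s P) (hb : Tests b s Q) : Tests (a.and b) s (P ∧ Q) := by
  unfold Tests at *; simp [← ha, ← hb]

theorem or (ha : Tests a s P) (hb : Tests b s Q) : Tests (a.or b) s (P ∨ Q) := by
  unfold Tests at *; rw [eval_or, bit_ne_zero, ha, hb]

theorem not (ha : Tests a s P) : Tests a.not s (¬ P) := by
  unfold Tests at *; simp [← ha]

theorem imp (ha : Tests a s P) (hb : Tests b s Q) : Tests (a.not.or b) s (P → Q) :=
  (ha.not.or hb).congr (by tauto)

theorem lt {u v : ℕ} (ha : a.eval s = u) (hb : b.eval s = v) : Tests (a.lt b) s (u < v) := by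
  unfold Tests; simp [ha, hb]

theorem eq {u v : ℕ} (ha : a.eval s = u) (hb : b.eval s = v) : Tests (a.eq b) s (u = v) := by
  unfold Tests; simp [ha, hb]

theorem ne_zero {u : ℕ} (ha : a.eval s = u) : Tests a s (u ≠ 0) := by
  unfold Tests; rw [ha]

theorem ex {P : ℕ → Prop} (hN : N.eval s = n) (h : ∀ i < n, Tests e (s.setVar x i) (P i)) :
    Tests (Expr.ex x N e) s (∃ i < n, P i) := by
  unfold Tests at *
  rw [eval_ex, bit_ne_zero, hN]
  exact exists_congr fun i => and_congr_right fun hi => h i hi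

theorem all {P : ℕ → Prop} (hN : N.eval s = n) (h : ∀ i < n, Tests e (s.setVar x i) (P i)) :
    Tests (Expr.all x N e) s (∀ i < n, P i) := by
  unfold Tests at *
  rw [eval_all, bit_ne_zero, hN]
  exact forall_congr' fun i => forall_congr' fun hi => h i hi

theorem exFin {P : Fin n → Prop} (hN : N.eval s = n)
    (h : ∀ i : Fin n, Tests e (s.setVar x i) (P i)) : Tests (Expr.ex x N e) s (∃ i, P i) :=
  (ex (P := fun i => ∃ h : i < n, P ⟨i, h⟩) hN fun i hi => (h ⟨i, hi⟩).congr (by simp [hi])).congr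
    (by simp [Fin.exists_iff])

theorem allFin {P : Fin n → Prop} (hN : N.eval s = n)
    (h : ∀ i : Fin n, Tests e (s.setVar x i) (P i)) : Tests (Expr.all x N e) s (∀ i, P i) :=
  (all (P := fun i => ∀ h : i < n, P ⟨i, h⟩) hN fun i hi => (h ⟨i, hi⟩).congr (by simp [hi])).congr
    (by simp [Fin.forall_iff])

end Tests

theorem val_one_sub (b : Fin 2) : ((1 - b : Fin 2) : ℕ) = 1 - (b : ℕ) := by
  revert b; decide

end ArrayLang

/-! ### Evaluation of the basic expressions on a model -/

namespace PolygonModel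

open ArrayLang ArrayLang.Expr

variable {k n : ℕ} (J : PolygonModel k n)

/-- The first variables, the input and the powers are in place. -/
structure Base (s : Env) : Prop where
  var0 : s.var 0 = k
  var1 : s.var 1 = n
  var2 : s.var 2 = boundarySize k
  var3 : s.var 3 = pruneSize k
  var4 : s.var 4 = (n + 1) ^ pruneSize k
  var5 : s.var 5 = (n + 1) ^ boundarySize k
  var6 : s.var 6 = 2 * n + 2
  label_eq : ∀ (v : Fin n) (b : Fin 2), s.arr 0 (v * 4 + b * 2 + 2) = J.label v b
  side_eq : ∀ (v : Fin n) (b : Fin 2), s.arr 0 (v * 4 + b * 2 + 3) = J.side v b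
  pow_eq : ∀ z ≤ boundarySize k, s.arr 5 z = (n + 1) ^ z

variable {J}

namespace Base

variable {s s' : Env}

theorem congr (h : J.Base s) (hv : ∀ x < 8, s'.var x = s.var x)
    (ha : ∀ α : Fin 16, α = 0 ∨ α = 5 → s'.arr α = s.arr α) : J.Base s' where
  var0 := by rw [hv 0 (by omega), h.var0]
  var1 := by rw [hv 1 (by omega), h.var1]
  var2 := by rw [hv 2 (by omega), h.var2]
  var3 := by rw [hv 3 (by omega), h.var3]
  var4 := by rw [hv 4 (by omega), h.var4]
  var5 := by rw [hv 5 (by omega), h.var5]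
  var6 := by rw [hv 6 (by omega), h.var6]
  label_eq v b := by rw [ha 0 (Or.inl rfl), h.label_eq]
  side_eq v b := by rw [ha 0 (Or.inl rfl), h.side_eq]
  pow_eq z hz := by rw [ha 5 (Or.inr rfl), h.pow_eq z hz]

theorem setVar (h : J.Base s) {x v : ℕ} (hx : 8 ≤ x) : J.Base (s.setVar x v) :=
  h.congr (fun y hy => by rw [Env.setVar_var, if_neg (by omega)]) fun _ _ => rfl

theorem setTbl (h : J.Base s) {α : Fin 16} {f : ℕ → ℕ} (hα : α ≠ 0 ∧ α ≠ 5) :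
    J.Base (s.setTbl α f) :=
  h.congr (fun _ _ => rfl) fun β hβ => by
    rw [Env.setTbl_arr, if_neg]
    rintro rfl
    tauto

variable {eu ev eb ec ed ez ei ej ea : Expr}

theorem eval_labE (h : J.Base s) {u : Fin n} {b : Fin 2} (hu : eu.eval s = u)
    (hb : eb.eval s = b) : (labE eu eb).eval s = J.label u b := by
  simp only [labE, eval_rd, eval_add, eval_mul, eval_lit, hu, hb, h.label_eq]

theorem eval_sideE (h : J.Base s) {u : Fin n} {b : Fin 2} (hu : eu.eval s = u)
    (hb : eb.eval s = b) : (sideE eu eb).eval s = J.side u b := by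
  simp only [sideE, eval_rd, eval_add, eval_mul, eval_lit, hu, hb, h.side_eq]

theorem eval_linkE (h : J.Base s) {u v : Fin n} (hu : eu.eval s = u) (hv : ev.eval s = v) :
    (linkE eu ev).eval s = J.link u v := by
  have e0 : (lit 0).eval s = ((0 : Fin 2) : ℕ) := rfl
  have e1 : (lit 1).eval s = ((1 : Fin 2) : ℕ) := rfl
  simp only [linkE, eval_mod, eval_add, eval_lt, h.eval_labE hu e0, h.eval_labE hu e1,
    h.eval_labE hv e0, h.eval_labE hv e1, link, linkNum, bit]
  rfl

theorem eval_digE (h : J.Base s) {z : ℕ} (hz : ez.eval s = z) (hm : z ≤ boundarySize k) :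
    (digE ec ez).eval s = ec.eval s / (n + 1) ^ z % (n + 1) := by
  simp only [digE, eval_mod, eval_div, eval_rd, eval_add, eval_var, eval_lit, hz, h.var1,
    h.pow_eq z hm]

theorem digit_le (c z : ℕ) : c / (n + 1) ^ z % (n + 1) ≤ n :=
  Nat.lt_succ_iff.1 (Nat.mod_lt _ (by omega))

theorem tests_linkDigE (h : J.Base s) {d : ℕ} {v : Fin n} (hd : ed.eval s = d) (hn : d ≤ n)
    (hv : ev.eval s = v) : Tests (linkDigE ed ev) s (J.LinkDigit d v) := by
  rcases d with _ | d
  · have : (linkDigE ed ev).eval s = 0 := by simp [linkDigE, hd]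
    simp [Tests, this, not_linkDigit_zero]
  · have h1 : (linkE (ed - lit 1) ev).eval s = J.link ⟨d, hn⟩ v :=
      h.eval_linkE (by simp [hd]) hv
    refine ((Tests.ne_zero hd).and (Tests.eq h1 (eval_lit s 1))).congr ?_
    have h2 := linkDigit_succ (J := J) (u := ⟨d, hn⟩) (v := v)
    dsimp only at h2
    rw [h2]
    simp

theorem tests_linkDigE_digE (h : J.Base s) {z : ℕ} {v : Fin n} (hz : ez.eval s = z)
    (hm : z ≤ boundarySize k) (hv : ev.eval s = v) :
    Tests (linkDigE (digE ec ez) ev) s (J.LinkDigit (ec.eval s / (n + 1) ^ z % (n + 1)) v) :=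
  h.tests_linkDigE (h.eval_digE hz hm) (digit_le _ _) hv

theorem tests_memE (h : J.Base s) {c : ℕ} (hc : ∀ i, ec.eval (s.setVar 10 i) = c)
    (hv : ∀ i, ev.eval (s.setVar 10 i) = ev.eval s) (hm : c < (n + 1) ^ boundarySize k) :
    Tests (memE ec ev) s (∃ v ∈ codeSet n c, (v : ℕ) = ev.eval s) := by
  refine (Tests.ex (P := fun z => c / (n + 1) ^ z % (n + 1) = ev.eval s + 1)
    (by simpa using h.var2) fun z hz => ?_).congr ?_
  · have h' := h.setVar (x := 10) (v := z) (by omega)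
    have := Tests.eq (h'.eval_digE (ec := ec) (ez := var 10) (z := z) (by simp) hz.le)
      (b := ev + lit 1) rfl
    rwa [hc, eval_add, hv] at this
  · simp only [mem_codeSet_of_lt hm]
    constructor
    · rintro ⟨z, hz, e⟩
      have := digit_le (n := n) c z
      exact ⟨⟨ev.eval s, by omega⟩, ⟨z, hz, e⟩, rfl⟩
    · rintro ⟨v, ⟨z, hz, e⟩, e'⟩
      exact ⟨z, hz, by rw [e, e']⟩

theorem tests_canonicalE (h : J.Base s) {c : ℕ} (hc : ∀ i, ec.eval (s.setVar 9 i) = c)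
    (hm : c < (n + 1) ^ boundarySize k) : Tests (canonicalE ec) s (Canonical n c) := by
  refine (Tests.all (P := fun z => c / (n + 1) ^ (z + 1) % (n + 1) = 0 ∨
    c / (n + 1) ^ (z + 1) % (n + 1) < c / (n + 1) ^ z % (n + 1)) (by simpa using h.var2)
    fun z hz => ?_).congr ?_
  · have h' := h.setVar (x := 9) (v := z) (by omega)
    have e1 := h'.eval_digE (ec := ec) (ez := var 9 + lit 1) (z := z + 1) (by simp) hz
    have e2 := h'.eval_digE (ec := ec) (ez := var 9) (z := z) (by simp) hz.le
    rw [hc] at e1 e2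
    exact ((Tests.ne_zero e1).not.congr not_not).or (Tests.lt e1 e2)
  · refine ⟨fun h z => ?_, fun h z _ => h z⟩
    by_cases hz : z < boundarySize k
    · exact h z hz
    · exact Or.inl (digit_eq_zero_of_lt (by omega) hm (by omega))

/-- Quantification over the elements of a coded set. -/
theorem tests_forall_mem (h : J.Base s) {c x : ℕ} {e : Expr} {P : Fin n → Prop} (hx : 8 ≤ x)
    (hc : ∀ i, ec.eval (s.setVar x i) = c) (hm : c < (n + 1) ^ boundarySize k)
    (he : ∀ i < boundarySize k, ∀ u : Fin n, (digE ec (var x)).eval (s.setVar x i) = u + 1 →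
      Tests e (s.setVar x i) (P u)) :
    Tests (all x (var 2) ((digE ec (var x)).not.or e)) s (∀ u ∈ codeSet n c, P u) := by
  refine (Tests.all (P := fun z => ∀ u : Fin n, c / (n + 1) ^ z % (n + 1) = u + 1 → P u)
    (by simpa using h.var2) fun z hz => ?_).congr ?_
  · have e1 := (h.setVar (v := z) hx).eval_digE (ec := ec) (ez := var x) (z := z) (by simp) hz.le
    have e2 := e1
    rw [hc] at e2
    rcases hd : c / (n + 1) ^ z % (n + 1) with _ | d
    · rw [hd] at e2
      refine iff_of_true ?_ fun u h => absurd h (by omega)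
      simp [e2]
    · have hdn : d + 1 ≤ n := hd ▸ digit_le c z
      rw [hd] at e2
      refine ((Tests.ne_zero e2).imp (he z hz ⟨d, hdn⟩ e2)).congr ?_
      refine ⟨fun h u hu => ?_, fun h _ => h _ rfl⟩
      rw [show u = ⟨d, hdn⟩ from Fin.ext (by simp; omega)]
      exact h (by omega)
  · simp only [mem_codeSet_of_lt hm]
    exact ⟨fun h u ⟨z, hz, e⟩ => h z hz u e, fun h z hz u e => h u ⟨z, hz, e⟩⟩

theorem eval_nextE (h : J.Base s) {i : Fin k} (hi : ei.eval s = i) :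
    (nextE ei).eval s = finRotate k i := by
  rw [finRotate_val]
  simp [nextE, hi, h.var0]

end Base

end PolygonModel

/-! ### Tests for valid codes and needed digits -/

namespace PolygonModel.Base

open ArrayLang ArrayLang.Expr

variable {k n : ℕ} {J : PolygonModel k n} {s : Env} {eu ev eb ec ed ez ei ej ea : Expr}

theorem tests_side_eq (h : J.Base s) {u v : Fin n} {a b : Fin 2} (hu : eu.eval s = u)
    (ha : ea.eval s = a) (hv : ev.eval s = v) (hb : eb.eval s = b) :
    Tests ((sideE eu ea).eq (sideE ev eb)) s (J.side u a = J.side v b) :=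
  (Tests.eq (h.eval_sideE hu ha) (h.eval_sideE hv hb)).congr Fin.ext_iff.symm

theorem eval_one_sub {b : Fin 2} (hb : eb.eval s = b) :
    (lit 1 - eb).eval s = ((1 - b : Fin 2) : ℕ) := by
  rw [val_one_sub, eval_sub, eval_lit, hb]

theorem tests_parallelE (h : J.Base s) {c : ℕ} {v : Fin n} {b : Fin 2} {p : Expr → Expr}
    {P : Fin n → Fin 2 → Prop} (hm : c < (n + 1) ^ boundarySize k)
    (hc : ∀ i, ec.eval (s.setVar 11 i) = c)
    (hc' : ∀ i j, ec.eval ((s.setVar 11 i).setVar 12 j) = c)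
    (hv : ∀ i j, ev.eval ((s.setVar 11 i).setVar 12 j) = v)
    (hb : ∀ i j, eb.eval ((s.setVar 11 i).setVar 12 j) = b)
    (hp : ∀ (u : Fin n) (i : ℕ) (a : Fin 2) (eu : Expr),
      eu.eval ((s.setVar 11 i).setVar 12 a) = u →
      Tests (p eu) ((s.setVar 11 i).setVar 12 a) (P u a)) :
    Tests (parallelE ec ev eb p) s (∀ u ∈ codeSet n c, ∀ a, J.side u a = J.side v b →
      J.side u (1 - a) = J.side v (1 - b) → P u a) := by
  refine h.tests_forall_mem (by omega) hc hm fun i hi u hu => Tests.allFin (eval_lit _ 2) fun a => ?_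
  have h1 := h.setVar (x := 11) (v := i) (by omega)
  have h2 := h1.setVar (x := 12) (v := a) (by omega)
  have eu : (digE ec (var 11) - lit 1).eval ((s.setVar 11 i).setVar 12 a) = u := by
    rw [h1.eval_digE (z := i) (by simp) hi.le, hc] at hu
    rw [eval_sub, h2.eval_digE (z := i) (by simp) hi.le, hc', hu, eval_lit]
    omega
  have e12 : (var 12).eval ((s.setVar 11 i).setVar 12 (a : ℕ)) = a := by simp
  exact (h2.tests_side_eq eu e12 (hv i a) (hb i a)).imp ((h2.tests_side_eq eu (eval_one_sub e12)
    (hv i a) (eval_one_sub (hb i a))).imp (hp u i a _ eu))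

theorem tests_extremeE (h : J.Base s) {c i : ℕ} {v : Fin n} (hi : i ≤ boundarySize k)
    (h8 : s.var 8 = c) (h9 : s.var 9 = i) (hm : c < (n + 1) ^ boundarySize k)
    (hv : c / (n + 1) ^ i % (n + 1) = v + 1) :
    Tests (extremeE (var 8) (digE (var 8) (var 9) - lit 1)) s (J.IsExtreme (codeSet n c) v) := by
  refine Tests.exFin (eval_lit _ 2) fun b => ?_
  have h1 := h.setVar (x := 10) (v := b) (by omega)
  have ev : ∀ s', J.Base s' → s'.var 8 = c → s'.var 9 = i →
      (digE (var 8) (var 9) - lit 1).eval s' = v := by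
    intro s' h' h8' h9'
    rw [eval_sub, h'.eval_digE (ez := var 9) h9' hi, eval_var, h8', hv, eval_lit]
    omega
  have e1 := ev _ h1 (by simpa using h8) (by simpa using h9)
  have e10 : (var 10).eval (s.setVar 10 (b : ℕ)) = b := by simp
  have hside : ∀ {a a' : Fin 2} {x x' : Expr}, x.eval (s.setVar 10 b) = a →
      x'.eval (s.setVar 10 b) = a' →
      Tests ((sideE (digE (var 8) (var 9) - lit 1) x).eq
        (nextE (sideE (digE (var 8) (var 9) - lit 1) x'))).not (s.setVar 10 b)
        (J.side v a ≠ finRotate k (J.side v a')) := fun hx hx' =>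
    ((Tests.eq (h1.eval_sideE e1 hx) (h1.eval_nextE (h1.eval_sideE e1 hx'))).congr
      Fin.ext_iff.symm).not
  have e2 : ∀ j l, (digE (var 8) (var 9) - lit 1).eval
      (((s.setVar 10 b).setVar 11 j).setVar 12 l) = v := fun j l =>
    ev _ ((h1.setVar (by omega)).setVar (by omega)) (by simpa using h8) (by simpa using h9)
  refine ((hside e10 (eval_one_sub e10)).and (h1.tests_parallelE
    (P := fun u a => J.label v b ≤ J.label u a) hm
    (fun j => by simpa using h8) (fun j l => by simpa using h8) e2 (fun j l => by simp)
    fun u j a eu hu => ?_)).or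
    ((hside (eval_one_sub e10) e10).and (h1.tests_parallelE
    (P := fun u a => J.label u a ≤ J.label v b) hm
    (fun j => by simpa using h8) (fun j l => by simpa using h8) e2 (fun j l => by simp)
    fun u j a eu hu => ?_))
  all_goals
    have h3 := (h1.setVar (x := 11) (v := j) (by omega)).setVar (x := 12) (v := a) (by omega)
    have e3 := h3.eval_labE (eb := var 12) (b := a) hu (by simp)
    have e4 := h3.eval_labE (eb := var 10) (b := b) (e2 j a) (by simp)
  · exact (Tests.lt e3 e4).not.congr not_lt
  · exact (Tests.lt e4 e3).not.congr not_lt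

theorem eval_validE (h : J.Base s) {c : ℕ} (h8 : s.var 8 = c)
    (hm : c < (n + 1) ^ boundarySize k) : (validE (var 8)).eval s = bit (J.ValidCode c) := by
  have h1 : ∀ i, (var 8).eval (s.setVar 9 i) = c := fun i => by simpa using h8
  have : Tests (validE (var 8)) s (J.ValidCode c) := by
    refine (h.tests_canonicalE h1 hm).and (h.tests_forall_mem (by omega) h1 hm fun i hi u hu => ?_)
    have h2 := h.setVar (x := 9) (v := i) (by omega)
    refine h2.tests_extremeE hi.le (by simpa using h8) (by simp) hm ?_
    rwa [h2.eval_digE (z := i) (by simp) hi.le, h1] at hu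
  exact this.eq_bit (by rw [validE, eval_and]; exact bit_le_one _)

theorem tests_neededE (h : J.Base s) {i j : Fin k} {c a z : ℕ} (hz : z ≤ boundarySize k)
    (hc : c < (n + 1) ^ boundarySize k) (ha : a < (n + 1) ^ boundarySize k)
    (ei_eq : ∀ v y, ei.eval ((s.setVar 10 v).setVar 11 y) = i)
    (ej_eq : ∀ v y, ej.eval ((s.setVar 10 v).setVar 11 y) = j)
    (ec_eq : ∀ v, ec.eval (s.setVar 10 v) = c)
    (ec_eq' : ∀ v y, ec.eval ((s.setVar 10 v).setVar 11 y) = c)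
    (ea_eq : ∀ v y, ea.eval ((s.setVar 10 v).setVar 11 y) = a)
    (ez_eq : ∀ v, ez.eval (s.setVar 10 v) = z)
    (ez_eq' : ∀ v y, ez.eval ((s.setVar 10 v).setVar 11 y) = z) :
    Tests (neededE ei ej ec ea ez) s (J.Needed i j c a z) := by
  refine Tests.exFin (by simpa using h.var1) fun v => ?_
  have h1 := h.setVar (x := 10) (v := v) (by omega)
  have h2 : ∀ y, J.Base ((s.setVar 10 v).setVar 11 y) := fun y => h1.setVar (by omega)
  have e10 : ∀ y, (var 10).eval ((s.setVar 10 (v : ℕ)).setVar 11 y) = v := fun y => by simp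
  have hbet : Tests (((ex 11 (lit 2) ((sideE (var 10) (var 11)).eq ei)).and
      (ex 11 (lit 2) ((sideE (var 10) (var 11)).eq ej)))) (s.setVar 10 v) (v ∈ J.between i j) := by
    refine (Tests.and (Tests.exFin (P := fun b => J.side v b = i) (eval_lit _ 2) fun b => ?_)
      (Tests.exFin (P := fun b => J.side v b = j) (eval_lit _ 2) fun b => ?_)).congr
      (by simp [between])
    · exact (Tests.eq ((h2 b).eval_sideE (e10 b) (by simp)) (ei_eq v b)).congr Fin.ext_iff.symm
    · exact (Tests.eq ((h2 b).eval_sideE (e10 b) (by simp)) (ej_eq v b)).congr Fin.ext_iff.symm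
  -- The program inspects only finitely many digits; all further digits vanish and stand for no
  -- chord.
  have hfar : ∀ {x y}, x < (n + 1) ^ boundarySize k → ¬ y < boundarySize k →
      ¬ J.LinkDigit (x / (n + 1) ^ y % (n + 1)) v := by
    intro x y hx hy
    rw [digit_eq_zero_of_lt (by omega) hx (by omega)]
    exact not_linkDigit_zero
  have hz' := h1.tests_linkDigE_digE (ec := ec) (ev := var 10) (ez_eq v) hz (v := v) (by simp)
  rw [ec_eq] at hz'
  refine hbet.and (hz'.and (Tests.and ((Tests.all
    (P := fun y => ¬ J.LinkDigit (a / (n + 1) ^ y % (n + 1)) v) (by simpa using h1.var2)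
    fun y hy => ?_).congr ?_) ((Tests.all
    (P := fun y => z < y → ¬ J.LinkDigit (c / (n + 1) ^ y % (n + 1)) v) (by simpa using h1.var2)
    fun y hy => ?_).congr ?_)))
  · have := (h2 y).tests_linkDigE_digE (ec := ea) (ez := var 11) (z := y) (by simp) hy.le (e10 y)
    rw [ea_eq] at this
    exact this.not
  · refine ⟨fun h y => ?_, fun h y _ => h y⟩
    by_cases hy : y < boundarySize k
    exacts [h y hy, hfar ha hy]
  · have := (h2 y).tests_linkDigE_digE (ec := ec) (ez := var 11) (z := y) (by simp) hy.le (e10 y)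
    rw [ec_eq'] at this
    exact (Tests.lt (ez_eq' v y) (v := y) (by simp)).imp this.not
  · refine ⟨fun h y hy' => ?_, fun h y _ => h y⟩
    by_cases hy : y < boundarySize k
    exacts [h y hy hy', hfar hc hy]

end PolygonModel.Base

/-! ### Layout of the input, setup, and tables for the labels -/

theorem length_flatMap_finRange {d n : ℕ} {f : Fin n → List ℕ} (hf : ∀ v, (f v).length = d) :
    ((List.finRange n).flatMap f).length = d * n := by
  simp [List.length_flatMap, hf, mul_comm]

theorem getD_flatMap_finRange {d n : ℕ} {f : Fin n → List ℕ} (hf : ∀ v, (f v).length = d)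
    (v : Fin n) {r : ℕ} (hr : r < d) :
    ((List.finRange n).flatMap f).getD (v * d + r) 0 = (f v).getD r 0 := by
  induction n with
  | zero => exact v.elim0
  | succ n ih =>
    rw [List.finRange_succ, List.flatMap_cons]
    refine Fin.cases ?_ (fun u => ?_) v
    · rw [List.getD_append _ _ _ _ (by simp [hf, hr])]
      simp
    · rw [List.getD_append_right _ _ _ _ (by simp [hf]; nlinarith), List.flatMap_map]
      rw [← ih (f := fun u => f u.succ) (fun _ => hf _) u]
      congr 1
      simp only [hf, Fin.val_succ, add_mul]
      omega

namespace PolygonModel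

open ArrayLang ArrayLang.Expr

variable {k n : ℕ} (J : PolygonModel k n)

theorem length_input : J.input.length = 4 * n + 2 := by
  rw [input, List.length_cons, List.length_cons, length_flatMap_finRange (d := 4) fun _ => rfl]

theorem getD_input_add (v : Fin n) {r : ℕ} (hr : r < 4) : J.input.getD (v * 4 + r + 2) 0 =
    [J.label v 0, (J.side v 0 : ℕ), J.label v 1, (J.side v 1 : ℕ)].getD r 0 := by
  rw [input, List.getD_cons_succ, List.getD_cons_succ]
  exact getD_flatMap_finRange (d := 4) (fun _ => rfl) v hr

theorem getD_input_label (v : Fin n) (b : Fin 2) :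
    J.input.getD (v * 4 + b * 2 + 2) 0 = J.label v b := by
  have : b = 0 ∨ b = 1 := by omega
  rcases this with rfl | rfl
  · exact J.getD_input_add v (r := 0) (by omega)
  · exact J.getD_input_add v (r := 2) (by omega)

theorem getD_input_side (v : Fin n) (b : Fin 2) :
    J.input.getD (v * 4 + b * 2 + 3) 0 = J.side v b := by
  have : b = 0 ∨ b = 1 := by omega
  rcases this with rfl | rfl
  · exact J.getD_input_add v (r := 1) (by omega)
  · exact J.getD_input_add v (r := 3) (by omega)

/-- `M` is large enough for all numbers that the program stores. -/
structure Large (k n M : ℕ) : Prop where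
  pow : (n + 1) ^ (boundarySize k + 1) * (k * k * (boundarySize k + 1)) ≤ M
  cube : (2 * n + 2) * (2 * n + 2) * (2 * n + 2) ≤ M

namespace Large

variable {M : ℕ}

theorem mul_mul_le (h : Large k n M) : k * k * (boundarySize k + 1) ≤ M :=
  (Nat.le_mul_of_pos_left _ (Nat.pow_pos (by omega))).trans h.pow

theorem pow_mul_mul_le (h : Large k n M) {z : ℕ} (hz : z ≤ boundarySize k + 1) :
    (n + 1) ^ z * k * k ≤ M := by
  rw [mul_assoc]
  exact (Nat.mul_le_mul (Nat.pow_le_pow_right (by omega) hz)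
    (Nat.le_mul_of_pos_right _ (by omega))).trans h.pow

theorem pow_le (h : Large k n M) (hk : 3 ≤ k) {z : ℕ} (hz : z ≤ boundarySize k + 1) :
    (n + 1) ^ z ≤ M :=
  (Nat.le_mul_of_pos_right _ (by positivity)).trans
    ((mul_assoc _ k k).symm.le.trans (h.pow_mul_mul_le hz))

theorem size_le (h : Large k n M) (hk : 3 ≤ k) : boundarySize k + 1 ≤ M :=
  (Nat.le_mul_of_pos_left _ (by positivity)).trans h.mul_mul_le

theorem mul_self_le (h : Large k n M) : k * k ≤ M :=
  (Nat.le_mul_of_pos_right _ (by omega)).trans h.mul_mul_le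

theorem square_le (h : Large k n M) : (2 * n + 2) * (2 * n + 2) ≤ M :=
  (Nat.le_mul_of_pos_right _ (by omega)).trans h.cube

theorem twice_le (h : Large k n M) : 2 * (2 * n + 2) ≤ M :=
  (Nat.mul_le_mul_right _ (by omega)).trans h.square_le

end Large

theorem pruneSize_le (hk : 3 ≤ k) : pruneSize k ≤ boundarySize k := by
  unfold pruneSize boundarySize
  obtain ⟨y, rfl⟩ : ∃ y, k = y + 3 := ⟨k - 3, by omega⟩
  rw [show y + 3 - 2 = y + 1 by omega]
  split_ifs
  · nlinarith
  · obtain ⟨z, rfl⟩ : ∃ z, y = z + 1 := ⟨y - 1, by omega⟩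
    nlinarith

theorem wp_setupProg {M : ℕ} (hk : 3 ≤ k) (hM : Large k n M) :
    WP M setupProg (initEnv J.input) fun s => J.Base s ∧ s.out = [] ∧ s.var 7 = 0 := by
  have b1 := hM.mul_self_le
  have b2 := hM.size_le hk
  have b3 := hM.twice_le
  have hpos : pruneSize k ≤ boundarySize k := pruneSize_le hk
  have e0 : J.input.getD 0 0 = k := rfl
  have e1 : J.input.getD 1 0 = n := rfl
  refine WP.seq (WP.assign (v := k) (by simp [initEnv]; exact e0) (by nlinarith) ?_)
  refine WP.seq (WP.assign (v := n) (by simp [initEnv]; exact e1) (by omega) ?_)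
  refine WP.seq (WP.assign (v := boundarySize k) (by simp [boundarySize]) (by omega) ?_)
  refine WP.seq (WP.assign (v := pruneSize k) ?_ (by omega) ?_)
  · simp [pruneSize]
  refine WP.seq (WP.assign (v := 2 * n + 2) (by simp) (by omega) ?_)
  refine WP.seq (WP.fill_zero (boundarySize k + 1) (fun z => (n + 1) ^ z) (by simp) b2
    (fun z hz => hM.pow_le hk hz.le) (fun z hz f hf => ?_) fun t f hf => ?_)
  · rcases z with _ | z
    · simp
    · simp [hf z (by omega), pow_succ]
  refine WP.seq (WP.assign (v := (n + 1) ^ pruneSize k) (by simp [hf _ (Nat.lt_succ_of_le hpos)])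
    (hM.pow_le hk (by omega)) ?_)
  refine WP.assign (v := (n + 1) ^ boundarySize k) (by simp [hf _ (Nat.lt_succ_self _)])
    (hM.pow_le hk (by omega)) ?_
  refine ⟨⟨by simp, by simp, by simp, by simp, by simp, by simp, by simp, fun v b => ?_,
    fun v b => ?_, fun z hz => ?_⟩, rfl, by simp [initEnv]⟩
  · simpa [initEnv] using J.getD_input_label v b
  · simpa [initEnv] using J.getD_input_side v b
  · simpa using hf z (by omega)

/-- The sum of `f v b` over the endpoints with label `l`. -/
noncomputable def sumAt (f : Fin n → Fin 2 → ℕ) (l : ℕ) : ℕ :=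
  ∑ v, ∑ b, if J.label v b = l then f v b else 0

variable {J}

/-- Labels are injective, so only one term can be nonzero; a sum thus serves as the search for the
endpoint with a given label. -/
theorem sumAt_label (f : Fin n → Fin 2 → ℕ) (v : Fin n) (b : Fin 2) :
    J.sumAt f (J.label v b) = f v b := by
  rw [sumAt, Finset.sum_eq_single v, Finset.sum_eq_single b]
  · simp
  · intro c _ hc
    exact if_neg fun h => hc (J.label_inj.1 h).2
  · simp
  · intro u _ hu
    exact Finset.sum_eq_zero fun c _ => if_neg fun h => hu (J.label_inj.1 h).1
  · simp

theorem sumAt_le {f : Fin n → Fin 2 → ℕ} {F : ℕ} (hf : ∀ v b, f v b ≤ F) (l : ℕ) :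
    J.sumAt f l ≤ F := by
  by_cases h : ∃ v b, J.label v b = l
  · obtain ⟨v, b, rfl⟩ := h
    rw [sumAt_label]
    exact hf v b
  · push Not at h
    rw [sumAt, Finset.sum_eq_zero fun v _ => Finset.sum_eq_zero fun b _ => if_neg (h v b)]
    exact Nat.zero_le _

theorem Base.eval_atE {s : Env} (h : J.Base s) {ef el : Expr} {f : Fin n → Fin 2 → ℕ} {l : ℕ}
    (hl : ∀ v b, el.eval ((s.setVar 10 v).setVar 11 b) = l)
    (hf : ∀ (v : Fin n) (b : Fin 2), ef.eval ((s.setVar 10 v).setVar 11 b) = f v b) :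
    (atE ef el).eval s = J.sumAt f l := by
  rw [atE, eval_sum, eval_var, h.var1, Finset.sum_range, sumAt]
  refine Finset.sum_congr rfl fun v _ => ?_
  rw [eval_sum, eval_lit, Finset.sum_range]
  refine Finset.sum_congr rfl fun b _ => ?_
  have h1 := (h.setVar (x := 10) (v := v) (by omega)).setVar (x := 11) (v := b) (by omega)
  rw [eval_cond, eval_eq, h1.eval_labE (u := v) (b := b) (by simp) (by simp), hl, hf, eval_lit]
  simp

variable (J)

/-- The tables for the labels are in place, too. -/
structure Tables (s : Env) : Prop extends J.Base s where
  chord_eq : ∀ v b, s.arr 1 (J.label v b) = v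
  other_eq : ∀ v b, s.arr 2 (J.label v b) = J.label v (1 - b)
  sideAt_eq : ∀ v b, s.arr 3 (J.label v b) = J.side v b
  otherSide_eq : ∀ v b, s.arr 4 (J.label v b) = J.side v (1 - b)

variable {J}

namespace Tables

variable {s s' : Env}

theorem congr (h : J.Tables s) (hv : ∀ x < 8, s'.var x = s.var x)
    (ha : ∀ α : Fin 16, α < 6 → s'.arr α = s.arr α) : J.Tables s' where
  toBase := h.toBase.congr hv fun α hα => ha α (by rcases hα with rfl | rfl <;> decide)
  chord_eq v b := by rw [ha 1 (by decide), h.chord_eq]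
  other_eq v b := by rw [ha 2 (by decide), h.other_eq]
  sideAt_eq v b := by rw [ha 3 (by decide), h.sideAt_eq]
  otherSide_eq v b := by rw [ha 4 (by decide), h.otherSide_eq]

theorem setVar (h : J.Tables s) {x v : ℕ} (hx : 8 ≤ x) : J.Tables (s.setVar x v) :=
  h.congr (fun y hy => by rw [Env.setVar_var, if_neg (by omega)]) fun _ _ => rfl

theorem setTbl (h : J.Tables s) {α : Fin 16} {f : ℕ → ℕ} (hα : 6 ≤ α) :
    J.Tables (s.setTbl α f) :=
  h.congr (fun _ _ => rfl) fun β hβ => by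
    rw [Env.setTbl_arr, if_neg]
    rintro rfl
    exact absurd hβ (not_lt.2 hα)

theorem setOut (h : J.Tables s) {l : List ℕ} : J.Tables (s.setOut l) :=
  h.congr (fun _ _ => rfl) fun _ _ => rfl

end Tables

theorem wp_tablesProg {M : ℕ} (hM : Large k n M) {s : Env} (h : J.Base s) :
    WP M tablesProg s fun s' => J.Tables s' ∧ s'.out = s.out := by
  have b1 := hM.mul_self_le
  have b3 := hM.twice_le
  have hkM : k ≤ M := by nlinarith
  have hlab : ∀ v b, J.label v b ≤ M := fun v b => (J.label_le v b).trans (by omega)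
  have hN : ∀ s', J.Base s' → (var 6 - lit 1).eval s' = 2 * n + 1 := fun s' h' => by
    simp [h'.var6]
  refine WP.seq (WP.fill_zero (2 * n + 1) (J.sumAt fun v _ => v) (hN _ h) (by omega)
    (fun l _ => sumAt_le (fun v b => by omega) l)
    (fun l _ f _ => ((h.setVar (by omega)).setTbl (by decide)).eval_atE (fun v b => by simp)
      fun v b => by simp) fun t1 f1 h1 => ?_)
  have g1 := (h.setVar (x := 9) (v := t1) (by omega)).setTbl (α := 1) (f := f1) (by decide)
  refine WP.seq (WP.fill_zero (2 * n + 1) (J.sumAt fun v b => J.label v (1 - b)) (hN _ g1)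
    (by omega) (fun l _ => sumAt_le (fun v b => hlab _ _) l) (fun l _ f _ =>
      ((g1.setVar (by omega)).setTbl (by decide)).eval_atE (fun v b => by simp) fun v b => ?_)
    fun t2 f2 h2 => ?_)
  · refine Base.eval_labE (((((g1.setVar (by omega)).setTbl (by decide)).setVar
      (by omega)).setVar (by omega))) (by simp) (Base.eval_one_sub (by simp))
  have g2 := (g1.setVar (x := 9) (v := t2) (by omega)).setTbl (α := 2) (f := f2) (by decide)
  refine WP.seq (WP.fill_zero (2 * n + 1) (J.sumAt fun v b => J.side v b) (hN _ g2)
    (by omega) (fun l _ => sumAt_le (fun v b => by omega) l) (fun l _ f _ =>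
      ((g2.setVar (by omega)).setTbl (by decide)).eval_atE (fun v b => by simp) fun v b => ?_)
    fun t3 f3 h3 => ?_)
  · refine Base.eval_sideE (((((g2.setVar (by omega)).setTbl (by decide)).setVar
      (by omega)).setVar (by omega))) (by simp) (by simp)
  have g3 := (g2.setVar (x := 9) (v := t3) (by omega)).setTbl (α := 3) (f := f3) (by decide)
  refine WP.fill_zero (2 * n + 1) (J.sumAt fun v b => J.side v (1 - b)) (hN _ g3)
    (by omega) (fun l _ => sumAt_le (fun v b => by omega) l) (fun l _ f _ =>
      ((g3.setVar (by omega)).setTbl (by decide)).eval_atE (fun v b => by simp) fun v b => ?_)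
    fun t4 f4 h4 => ?_
  · refine Base.eval_sideE (((((g3.setVar (by omega)).setTbl (by decide)).setVar
      (by omega)).setVar (by omega))) (by simp) (Base.eval_one_sub (by simp))
  have g4 := (g3.setVar (x := 9) (v := t4) (by omega)).setTbl (α := 4) (f := f4) (by decide)
  have hl : ∀ v b, J.label v b < 2 * n + 1 := fun v b => Nat.lt_succ_of_le (J.label_le v b)
  refine ⟨⟨g4, fun v b => ?_, fun v b => ?_, fun v b => ?_, fun v b => ?_⟩, rfl⟩
  · simpa [sumAt_label] using h1 _ (hl v b)
  · simpa [sumAt_label] using h2 _ (hl v b)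
  · simpa [sumAt_label] using h3 _ (hl v b)
  · simpa [sumAt_label] using h4 _ (hl v b)

end PolygonModel

/-! ### Evaluation of the expressions of the dynamic program -/

namespace PolygonModel

open ArrayLang ArrayLang.Expr

variable {k n : ℕ} (J : PolygonModel k n)

/-- The indicator function of a set of chords. -/
noncomputable def ind (X : Finset (Fin n)) (v : ℕ) : ℕ := bit (∃ u ∈ X, (u : ℕ) = v)

theorem ind_fin (X : Finset (Fin n)) (v : Fin n) : ind X v = bit (v ∈ X) :=
  bit_congr ⟨fun ⟨_, hu, h⟩ => Fin.ext h ▸ hu, fun h => ⟨v, h, rfl⟩⟩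

theorem encodeSet_eq (X : Finset (Fin n)) : encodeSet X = (List.range n).map (ind X) := by
  rw [encodeSet, ← List.map_coe_finRange_eq_range, List.map_map, ← List.ofFn_eq_map]
  congr 1
  funext v
  rw [Function.comp_apply, ind_fin]
  simp [bit]

/-- The labels that still have to be dominated. -/
abbrev UndAt (O : Finset (Fin n)) : ℕ → Prop := J.ChordAt (J.closedNbhd O)ᶜ

open scoped Classical in
/-- The table of the dynamic program. -/
noncomputable def dynCost (O : Finset (Fin n)) (i j : Fin k) : ℕ → ℕ → ℕ → ℕ :=
  costToGo (2 * n) (J.HasAt i j) (J.UndAt O) J.otherAt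

open scoped Classical in
/-- The states of the dynamic program. -/
noncomputable def dynState (O : Finset (Fin n)) (i j : Fin k) : ℕ → ℕ × ℕ :=
  optState (2 * n) (J.HasAt i j) (J.UndAt O) J.otherAt

open scoped Classical in
/-- The decisions of the dynamic program. -/
def DynTakes (O : Finset (Fin n)) (i j : Fin k) (z : ℕ) (st : ℕ × ℕ) : Prop :=
  Takes (2 * n) (J.HasAt i j) (J.UndAt O) J.otherAt z st

variable {J} {O : Finset (Fin n)} {i j : Fin k}

theorem mem_optSub {v : Fin n} : v ∈ J.optSub O i j ↔ ∃ b, J.side v b = i ∧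
    J.side v (1 - b) = j ∧ J.DynTakes O i j (J.label v b - 1)
      (J.dynState O i j (J.label v b - 1)) :=
  J.mem_chordsOf

/-- Both components fit into digits to the base `2 n + 2`, so a state can be packed into one array
cell. -/
theorem dynState_le (z : ℕ) : (J.dynState O i j z).1 ≤ 2 * n + 1 ∧ (J.dynState O i j z).2 ≤ 2 * n := by
  classical
  rw [dynState, ← scan_optTakes]
  exact ⟨scan_fst_le _ z, scan_snd_le (fun l hl => (J.otherAt_spec l hl).2) _ z⟩

theorem dynCost_le (z q r : ℕ) : J.dynCost O i j z q r ≤ 2 * n + 1 + z := by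
  classical
  exact costToGo_le z q r

theorem otherAt_le (l : ℕ) : J.otherAt l ≤ 2 * n := by
  by_cases h : ∃ v b, J.label v b = l
  · obtain ⟨v, b, rfl⟩ := h
    rw [otherAt_label]
    exact J.label_le _ _
  · rw [otherAt, dif_neg fun ⟨e, he⟩ => h ⟨e.1, e.2, he⟩]
    exact Nat.zero_le _

theorem undAt_label (hk : 3 ≤ k) {v : Fin n} {b : Fin 2} :
    J.UndAt O (J.label v b) ↔ ∀ u ∈ O, J.link u v ≠ 1 := by
  rw [UndAt, chordAt_label, Finset.mem_compl, J.mem_closedNbhd hk]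
  push Not
  rfl

namespace Tables

variable {s : Env} {ei ej el eq er ez est : Expr} {l z q r : ℕ}

theorem tests_hasE (h : J.Tables s) (hi : ei.eval s = i) (hj : ej.eval s = j)
    (hl : el.eval s = l) (h1 : 1 ≤ l) (h2 : l ≤ 2 * n) :
    Tests (hasE ei ej el) s (J.HasAt i j l) := by
  obtain ⟨v, b, rfl⟩ := J.exists_label_eq h1 h2
  rw [hasAt_label]
  refine (Tests.eq (u := J.side v b) ?_ hi).congr Fin.ext_iff.symm |>.and
    ((Tests.eq (u := J.side v (1 - b)) ?_ hj).congr Fin.ext_iff.symm)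
  · rw [eval_rd, hl, h.sideAt_eq]
  · rw [eval_rd, hl, h.otherSide_eq]

theorem eval_other (h : J.Tables s) (hl : el.eval s = l) (h1 : 1 ≤ l) (h2 : l ≤ 2 * n) :
    (rd 2 el).eval s = J.otherAt l := by
  obtain ⟨v, b, rfl⟩ := J.exists_label_eq h1 h2
  rw [eval_rd, hl, h.other_eq, otherAt_label]

theorem eval_takeRestE {x : ℕ} {ex : Expr} (hx : ex.eval s = x) (hr : er.eval s = r) :
    (takeRestE ex er).eval s = takeRest x r := by
  simp [takeRestE, takeRest, hx, hr]

theorem eval_skipRestE {x : ℕ} {ex eu : Expr} {P : Prop} [Decidable P] (hu : Tests eu s P)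
    (hx : ex.eval s = x) (hq : eq.eval s = q) (hr : er.eval s = r) :
    (skipRestE eu ex eq er).eval s = skipRest P x q r := by
  unfold Tests at hu
  simp only [skipRestE, skipRest, eval_cond, eval_and, eval_not, eval_lt, eval_max, bit_ne_zero,
    bit_eq_zero, hx, hq, hr]
  exact if_congr (and_congr_left fun _ => hu) rfl rfl

theorem eval_cellE (h : J.Tables s) (hz : ez.eval s = z) (hq : eq.eval s = q)
    (hr : er.eval s = r) :
    (cellE ez eq er).eval s = s.arr 8 ((z * (2 * n + 2) + q) * (2 * n + 2) + r) := by
  simp [cellE, hz, hq, hr, h.var6]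

/-- Layer `z` of the table of the dynamic program is in place. -/
def Layer (J : PolygonModel k n) (O : Finset (Fin n)) (i j : Fin k) (s : Env) (z : ℕ) : Prop :=
  ∀ q r, q ≤ 2 * n + 1 → r ≤ 2 * n + 1 →
    s.arr 8 ((z * (2 * n + 2) + q) * (2 * n + 2) + r) = J.dynCost O i j z q r

theorem eval_cell_take (h : J.Tables s) (hL : Layer J O i j s z) (hz : ez.eval s = z)
    (hl : el.eval s = l) (h1 : 1 ≤ l) (h2 : l ≤ 2 * n) (hq : eq.eval s = q) (hr : er.eval s = r)
    (hq' : q ≤ 2 * n + 1) (hr' : r ≤ 2 * n + 1) :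
    (cellE ez (eq.min (rd 2 el)) (takeRestE (rd 2 el) er)).eval s =
      J.dynCost O i j z (min q (J.otherAt l)) (takeRest (J.otherAt l) r) := by
  have ho := h.eval_other hl h1 h2
  rw [h.eval_cellE hz (by rw [eval_min, hq, ho]) (eval_takeRestE ho hr)]
  refine hL _ _ ((min_le_left _ _).trans hq') ?_
  unfold takeRest
  split_ifs <;> omega

open scoped Classical in
theorem eval_cell_skip (h : J.Tables s) (hL : Layer J O i j s z) (hz : ez.eval s = z)
    (hU : s.arr 7 l = bit (J.UndAt O l))
    (hl : el.eval s = l) (h1 : 1 ≤ l) (h2 : l ≤ 2 * n) (hq : eq.eval s = q) (hr : er.eval s = r)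
    (hq' : q ≤ 2 * n + 1) (hr' : r ≤ 2 * n + 1) :
    (cellE ez eq (skipRestE (rd 7 el) (rd 2 el) eq er)).eval s =
      J.dynCost O i j z q (skipRest (J.UndAt O l) (J.otherAt l) q r) := by
  have ho := h.eval_other hl h1 h2
  have hu : Tests (rd 7 el) s (J.UndAt O l) := by
    unfold Tests; rw [eval_rd, hl, hU, bit_ne_zero]
  rw [h.eval_cellE hz hq (eval_skipRestE hu ho hq hr)]
  refine hL _ _ hq' ?_
  have := otherAt_le (J := J) l
  unfold skipRest
  split_ifs <;> omega

theorem tests_takesE (h : J.Tables s) (hL : Layer J O i j s (2 * n - (z + 1)))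
    (hU : s.arr 7 (z + 1) = bit (J.UndAt O (z + 1))) (hi : ei.eval s = i) (hj : ej.eval s = j)
    (hl : el.eval s = z + 1) (h2 : z + 1 ≤ 2 * n) (hq : eq.eval s = q) (hr : er.eval s = r)
    (hq' : q ≤ 2 * n + 1) (hr' : r ≤ 2 * n + 1) :
    Tests (takesE ei ej el eq er) s (J.DynTakes O i j z (q, r)) := by
  classical
  have hz : (var 6 - lit 2 - el).eval s = 2 * n - (z + 1) := by
    simp [h.var6, hl]
  have e1 := h.eval_cell_take hL hz hl (by omega) h2 hq hr hq' hr'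
  have e2 := h.eval_cell_skip hL hz hU hl (by omega) h2 hq hr hq' hr'
  refine (h.tests_hasE hi hj hl (by omega) h2).and (Tests.lt ?_ ?_)
  · rw [eval_add, eval_lit, e1]
    rfl
  · rw [e2]
    unfold dynCost
    -- Only the instances of decidability differ.
    congr!

/-- A new layer needs the previous one only. With `z` positions left the next one is `2 n + 1 - z`;
for `z = 0` this value is not used. -/
theorem eval_costE (h : J.Tables s) (hL : ∀ y, z = y + 1 → Layer J O i j s y)
    (hU : ∀ l ≤ 2 * n, s.arr 7 l = bit (J.UndAt O l)) (hi : ei.eval s = i) (hj : ej.eval s = j)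
    (hl : el.eval s = 2 * n + 1 - z) (hz : ez.eval s = z) (h2 : z ≤ 2 * n) (hq : eq.eval s = q)
    (hr : er.eval s = r) (hq' : q ≤ 2 * n + 1) (hr' : r ≤ 2 * n + 1) :
    (costE ei ej ez eq er el).eval s = J.dynCost O i j z q r := by
  classical
  rw [costE, eval_cond, hz]
  rcases z with _ | z
  · rw [if_neg (by simp), eval_cond, hr, dynCost, costToGo]
    simp only [eval_sub, eval_var, eval_lit, h.var6]
    split_ifs <;> first | rfl | omega
  · have hl' : el.eval s = 2 * n - z := by rw [hl]; omega
    have hz' : (ez - lit 1).eval s = z := by rw [eval_sub, hz]; rfl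
    have hL' := hL z rfl
    have e1 := h.eval_cell_take hL' hz' hl' (by omega) (by omega) hq hr hq' hr'
    have e2 := h.eval_cell_skip hL' hz' (hU _ (by omega)) hl' (by omega) (by omega) hq hr hq' hr'
    rw [if_pos (by omega), eval_cond, eval_min, eval_add, eval_lit, e1, e2, h.eval_cellE hz' hq hr,
      hL' q r hq' hr', dynCost, costToGo]
    refine if_congr (h.tests_hasE hi hj hl' (by omega) (by omega)) ?_ rfl
    congr!

/-- The code of a state. -/
def encodeState (n : ℕ) (p : ℕ × ℕ) : ℕ := p.1 * (2 * n + 2) + p.2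

theorem encodeState_div {p : ℕ × ℕ} (hp : p.2 ≤ 2 * n) : encodeState n p / (2 * n + 2) = p.1 := by
  rw [encodeState, mul_comm, Nat.mul_add_div (by omega), Nat.div_eq_of_lt (by omega), add_zero]

theorem encodeState_mod {p : ℕ × ℕ} (hp : p.2 ≤ 2 * n) : encodeState n p % (2 * n + 2) = p.2 := by
  rw [encodeState, mul_comm, Nat.mul_add_mod, Nat.mod_eq_of_lt (by omega)]

theorem encodeState_le {p : ℕ × ℕ} (hp : p.1 ≤ 2 * n + 1) (hp' : p.2 ≤ 2 * n) :
    encodeState n p ≤ (2 * n + 2) * (2 * n + 2) := by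
  unfold encodeState
  nlinarith

theorem eval_stateE (h : J.Tables s) (hL : Layer J O i j s (2 * n - (z + 1)))
    (hU : s.arr 7 (z + 1) = bit (J.UndAt O (z + 1))) (hi : ei.eval s = i) (hj : ej.eval s = j)
    (hl : el.eval s = z + 1) (h2 : z + 1 ≤ 2 * n)
    (hst : est.eval s = encodeState n (J.dynState O i j z)) :
    (stateE ei ej el est).eval s = encodeState n (J.dynState O i j (z + 1)) := by
  classical
  obtain ⟨b1, b2⟩ := dynState_le (J := J) (O := O) (i := i) (j := j) z
  have hq : (est / var 6).eval s = (J.dynState O i j z).1 := by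
    rw [eval_div, hst, eval_var, h.var6, encodeState_div b2]
  have hr : (est % var 6).eval s = (J.dynState O i j z).2 := by
    rw [eval_mod, hst, eval_var, h.var6, encodeState_mod b2]
  have ho := h.eval_other hl (by omega) h2
  have hu : Tests (rd 7 el) s (J.UndAt O (z + 1)) := by
    unfold Tests; rw [eval_rd, hl, hU, bit_ne_zero]
  have ht := h.tests_takesE hL hU hi hj hl h2 hq hr b1 (by omega)
  rw [stateE, eval_cond, eval_cond, eval_add, eval_add, eval_mul, eval_mul, eval_min, ho, hq,
    eval_takeRestE ho hr, eval_skipRestE hu ho hq hr, hst, eval_var, h.var6]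
  have e : J.dynState O i j (z + 1) = scanStep (J.HasAt i j) (J.UndAt O) J.otherAt
    (J.DynTakes O i j z (J.dynState O i j z)) (z + 1) (J.dynState O i j z) := by
    rw [dynState, optState]
    unfold DynTakes
    congr!
  rw [e, scanStep, apply_ite (encodeState n), apply_ite (encodeState n)]
  exact if_congr (h.tests_hasE hi hj hl (by omega) h2) (if_congr ht rfl rfl) rfl

end Tables

end PolygonModel

/-! ### Correctness of the precomputation -/

namespace PolygonModel

open ArrayLang ArrayLang.Expr

variable {k n : ℕ} {J : PolygonModel k n} {M : ℕ} {s : Env}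

theorem Tables.eval_und (hk : 3 ≤ k) (h : J.Tables s) {c l : ℕ} (h9 : s.var 9 = l)
    (hl : l ≤ 2 * n) {ec : Expr} (hc : ∀ z, ec.eval (s.setVar 10 z) = c)
    (hm : c < (n + 1) ^ pruneSize k) :
    ((var 9).and (all 10 (var 3) (linkDigE (digE ec (var 10)) (rd 1 (var 9))).not)).eval s =
      bit (J.UndAt (codeSet n c) l) := by
  have hps := pruneSize_le hk
  rcases l.eq_zero_or_pos with rfl | hpos
  · have : ¬ J.UndAt (codeSet n c) 0 := fun ⟨v, _, b, e⟩ => (J.label_pos v b).ne' e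
    simp [h9, bit, this]
  · obtain ⟨v, b, rfl⟩ := J.exists_label_eq hpos hl
    refine Tests.eq_bit ?_ (by rw [eval_and]; exact bit_le_one _)
    refine ((Tests.ne_zero (a := var 9) h9).and (Tests.all
      (P := fun z => ¬ J.LinkDigit (c / (n + 1) ^ z % (n + 1)) v) (by simpa using h.var3)
      fun z hz => ?_)).congr ?_
    · have := (h.setVar (x := 10) (v := z) (by omega)).tests_linkDigE_digE (ec := ec)
        (ez := var 10) (z := z) (ev := rd 1 (var 9)) (v := v) (by simp) (hz.le.trans hps)
        (by simpa [h9] using h.chord_eq v b)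
      rw [hc] at this
      exact this.not
    · rw [undAt_label hk]
      constructor
      · rintro ⟨-, h⟩ u hu hl
        obtain ⟨z, hz, hzu⟩ := (mem_codeSet_of_lt hm).1 hu
        exact h z hz ⟨u, hzu, hl⟩
      · refine fun h => ⟨hpos.ne', fun z _ hd => ?_⟩
        obtain ⟨x, hx, hxl⟩ := exists_linkDigit_iff.1 ⟨z, hd⟩
        exact h x hx hxl

variable [NeZero k]

/-- The result of the dynamic program with number `p`, which stands for a code and two sides. -/
noncomputable def resultAt (J : PolygonModel k n) (p v : ℕ) : ℕ :=
  ind (J.optSub (codeSet n (p / k / k)) (Fin.ofNat k (p / k)) (Fin.ofNat k p)) v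

theorem resultAt_eq {c v : ℕ} {i j : Fin k} :
    J.resultAt ((c * k + i) * k + j) v = ind (J.optSub (codeSet n c) i j) v := by
  have hk : 0 < k := Nat.pos_of_neZero k
  have e1 : ((c * k + i) * k + j) / k = c * k + i := by
    rw [mul_comm, Nat.mul_add_div hk, Nat.div_eq_of_lt j.isLt, add_zero]
  have e2 : (c * k + (i : ℕ)) / k = c := by
    rw [mul_comm, Nat.mul_add_div hk, Nat.div_eq_of_lt i.isLt, add_zero]
  have e3 : Fin.ofNat k (c * k + i) = i := Fin.ext (by simp [Nat.mod_eq_of_lt i.isLt])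
  have e4 : Fin.ofNat k ((c * k + i) * k + j) = j := Fin.ext (by simp [Nat.mod_eq_of_lt j.isLt])
  rw [resultAt, e1, e2, e3, e4]

/-- The number `p` is read as `(c k + i) k + j`. Results go to the cells from `p n` on, and earlier
results are left alone; this is what the loop over all `p` has to carry along. -/
theorem wp_dynProg (hk : 3 ≤ k) (hM : Large k n M) (hT : J.Tables s) {p : ℕ} (h8 : s.var 8 = p)
    (hp : p < (n + 1) ^ pruneSize k * k * k) :
    WP M dynProg s fun s' => J.Tables s' ∧ s'.out = s.out ∧
      (∀ v < n, s'.arr 6 (p * n + v) = J.resultAt p v) ∧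
      ∀ y < p * n, s'.arr 6 y = s.arr 6 y := by
  have b3 := hM.twice_le
  have b4 := hM.cube
  have hk0 : 0 < k := by omega
  set c := p / k / k with hc
  set i := Fin.ofNat k (p / k) with hi
  set j := Fin.ofNat k p with hj
  set O := codeSet n c with hO
  have hcm : c < (n + 1) ^ pruneSize k :=
    Nat.div_lt_of_lt_mul (Nat.div_lt_of_lt_mul (by rwa [mul_comm, mul_comm k]))
  have ec : ∀ s', J.Tables s' → s'.var 8 = p → (var 8 / var 0 / var 0).eval s' = c :=
    fun s' h h' => by simp [h.var0, h', hc]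
  have ei : ∀ s', J.Tables s' → s'.var 8 = p → (var 8 / var 0 % var 0).eval s' = i :=
    fun s' h h' => by simp [h.var0, h', hi]
  have ej : ∀ s', J.Tables s' → s'.var 8 = p → (var 8 % var 0).eval s' = j :=
    fun s' h h' => by simp [h.var0, h', hj]
  refine WP.seq (WP.fill_zero (2 * n + 1) (fun l => bit (J.UndAt O l)) (by simp [hT.var6])
    (by omega) (fun _ _ => (bit_le_one _).trans (by omega)) (fun l hl f _ => ?_)
    fun t1 f1 h1 => ?_)
  · have g := (hT.setVar (x := 9) (v := l) (by omega)).setTbl (α := 7) (f := f) (by decide)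
    exact g.eval_und hk (by simp) (by omega) (fun z => ec _ (g.setVar (by omega)) (by simpa)) hcm
  have g1 := (hT.setVar (x := 9) (v := t1) (by omega)).setTbl (α := 7) (f := f1) (by decide)
  have u1 : ∀ l ≤ 2 * n, ((s.setVar 9 t1).setTbl 7 f1).arr 7 l = bit (J.UndAt O l) :=
    fun l hl => by simpa using h1 l (by omega)
  have v1 : ((s.setVar 9 t1).setTbl 7 f1).var 8 = p := by simpa using h8
  generalize hs1 : (s.setVar 9 t1).setTbl 7 f1 = s1 at g1 u1 v1
  have o1 : s1.out = s.out := by rw [← hs1]; rfl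
  have a1 : s1.arr 6 = s.arr 6 := by rw [← hs1]; simp
  clear hs1
  -- A cell index of the three-dimensional table is a number with the digits `z`, `q`, `r`.
  have key : ∀ z q r, q < 2 * n + 2 → r < 2 * n + 2 →
      (((z * (2 * n + 2) + q) * (2 * n + 2) + r) / (2 * n + 2) / (2 * n + 2) = z ∧
      ((z * (2 * n + 2) + q) * (2 * n + 2) + r) / (2 * n + 2) % (2 * n + 2) = q ∧
      ((z * (2 * n + 2) + q) * (2 * n + 2) + r) % (2 * n + 2) = r) := by
    intro z q r hq hr
    have e1 : ((z * (2 * n + 2) + q) * (2 * n + 2) + r) / (2 * n + 2) = z * (2 * n + 2) + q := by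
      rw [mul_comm _ (2 * n + 2), Nat.mul_add_div (by omega), Nat.div_eq_of_lt hr, add_zero]
    rw [e1]
    refine ⟨?_, ?_, ?_⟩
    · rw [mul_comm, Nat.mul_add_div (by omega), Nat.div_eq_of_lt hq, add_zero]
    · rw [mul_comm, Nat.mul_add_mod, Nat.mod_eq_of_lt hq]
    · rw [mul_comm, Nat.mul_add_mod, Nat.mod_eq_of_lt hr]
  refine WP.seq (WP.fill_zero ((2 * n + 1) * (2 * n + 2) * (2 * n + 2)) (fun y => J.dynCost O i j
    (y / (2 * n + 2) / (2 * n + 2)) (y / (2 * n + 2) % (2 * n + 2)) (y % (2 * n + 2)))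
    (by simp [g1.var6]) ?_ (fun y hy => ?_) (fun y hy f hf => ?_) fun t2 f2 h2 => ?_)
  · exact (Nat.mul_le_mul_right _ (Nat.mul_le_mul_right _ (by omega))).trans b4
  · have : y / (2 * n + 2) / (2 * n + 2) < 2 * n + 1 := Nat.div_lt_of_lt_mul
      (Nat.div_lt_of_lt_mul (by rwa [mul_comm, mul_comm (2 * n + 2)]))
    exact (dynCost_le _ _ _).trans (by omega)
  · have hz : y / (2 * n + 2) / (2 * n + 2) < 2 * n + 1 := Nat.div_lt_of_lt_mul
      (Nat.div_lt_of_lt_mul (by rwa [mul_comm, mul_comm (2 * n + 2)]))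
    have hq : y / (2 * n + 2) % (2 * n + 2) < 2 * n + 2 := Nat.mod_lt _ (by omega)
    have hr : y % (2 * n + 2) < 2 * n + 2 := Nat.mod_lt _ (by omega)
    have g := (g1.setVar (x := 9) (v := y) (by omega)).setTbl (α := 8) (f := f) (by decide)
    have hv6 : s1.var 6 = 2 * n + 2 := g1.var6
    refine g.eval_costE (fun x hx q r hq' hr' => ?_) (fun l hl => by simpa using u1 l hl)
      (ei _ g (by simpa)) (ej _ g (by simpa)) ?_ ?_ (by omega) ?_ ?_ (by omega) (by omega)
    · obtain ⟨e1, e2, e3⟩ := key x q r (by omega) (by omega)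
      -- Cell `y` lies in layer `x + 1`, so every cell of layer `x` has a smaller index and is
      -- already filled.
      have hlt : (x * (2 * n + 2) + q) * (2 * n + 2) + r < y := by
        by_contra! hle
        have := Nat.div_le_div_right (c := 2 * n + 2) (Nat.div_le_div_right (c := 2 * n + 2) hle)
        rw [e1] at this
        omega
      simpa [e1, e2, e3] using hf _ hlt
    · simp [hv6]
    · simp [hv6]
    · simp [hv6]
    · simp [hv6]
  have g2 := (g1.setVar (x := 9) (v := t2) (by omega)).setTbl (α := 8) (f := f2) (by decide)
  have u2 : ∀ l ≤ 2 * n, ((s1.setVar 9 t2).setTbl 8 f2).arr 7 l = bit (J.UndAt O l) :=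
    fun l hl => by simpa using u1 l hl
  have v2 : ((s1.setVar 9 t2).setTbl 8 f2).var 8 = p := by simpa using v1
  have w2 : ∀ z ≤ 2 * n, Tables.Layer J O i j ((s1.setVar 9 t2).setTbl 8 f2) z := by
    intro z hz q r hq hr
    obtain ⟨e1, e2, e3⟩ := key z q r (by omega) (by omega)
    have hlt : (z * (2 * n + 2) + q) * (2 * n + 2) + r <
        (2 * n + 1) * (2 * n + 2) * (2 * n + 2) := by nlinarith
    simpa [e1, e2, e3] using h2 _ hlt
  generalize hs2 : (s1.setVar 9 t2).setTbl 8 f2 = s2 at g2 u2 v2 w2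
  have o2 : s2.out = s.out := by rw [← hs2]; exact o1
  have a2 : s2.arr 6 = s.arr 6 := by rw [← hs2]; simpa using a1
  clear hs2
  refine WP.seq (WP.fill_zero (2 * n + 1)
    (fun z => Tables.encodeState n (J.dynState O i j z)) (by simp [g2.var6]) (by omega)
    (fun z hz => ?_) (fun z hz f hf => ?_) fun t3 f3 h3 => ?_)
  · obtain ⟨c1, c2⟩ := dynState_le (J := J) (O := O) (i := i) (j := j) z
    exact (Tables.encodeState_le c1 c2).trans hM.square_le
  · have g := (g2.setVar (x := 9) (v := z) (by omega)).setTbl (α := 9) (f := f) (by decide)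
    rcases z with _ | z
    · simp [g2.var6, Tables.encodeState, dynState, optState]
    · have : ((s2.setVar 9 (z + 1)).setTbl 9 f).var 9 = z + 1 := by simp
      rw [eval_cond, eval_var, this, if_pos (by omega)]
      refine g.eval_stateE (fun q r hq hr => ?_) ?_ (ei _ g (by simpa)) (ej _ g (by simpa)) this
        (by omega) ?_
      · simpa using w2 (2 * n - (z + 1)) (by omega) q r hq hr
      · simpa using u2 _ (by omega)
      · simpa using hf z (by omega)
  have g3 := (g2.setVar (x := 9) (v := t3) (by omega)).setTbl (α := 9) (f := f3) (by decide)
  have u3 : ∀ l ≤ 2 * n, ((s2.setVar 9 t3).setTbl 9 f3).arr 7 l = bit (J.UndAt O l) :=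
    fun l hl => by simpa using u2 l hl
  have v3 : ((s2.setVar 9 t3).setTbl 9 f3).var 8 = p := by simpa using v2
  have w3 : ∀ z ≤ 2 * n, Tables.Layer J O i j ((s2.setVar 9 t3).setTbl 9 f3) z :=
    fun z hz q r hq hr => by simpa using w2 z hz q r hq hr
  have x3 : ∀ z ≤ 2 * n, ((s2.setVar 9 t3).setTbl 9 f3).arr 9 z =
      Tables.encodeState n (J.dynState O i j z) := fun z hz => by simpa using h3 z (by omega)
  generalize hs3 : (s2.setVar 9 t3).setTbl 9 f3 = s3 at g3 u3 v3 w3 x3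
  have o3 : s3.out = s.out := by rw [← hs3]; exact o2
  have a3 : s3.arr 6 = s.arr 6 := by rw [← hs3]; simpa using a2
  clear hs3
  refine WP.fill n (p * n) (fun v => J.resultAt p v) (by simpa using g3.var1) (by omega)
    (fun v hv => (bit_le_one _).trans (by omega)) (fun v hv f => ?_) (fun v hv f hf => ?_)
    fun t4 f4 h4 h4' => ?_
  · simp [v3, g3.var1]
  · have g := (g3.setVar (x := 9) (v := v) (by omega)).setTbl (α := 6) (f := f) (by decide)
    obtain ⟨v, rfl⟩ : ∃ u : Fin n, (u : ℕ) = v := ⟨⟨v, hv⟩, rfl⟩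
    rw [resultAt, ind_fin]
    refine Tests.eq_bit ((Tests.exFin (eval_lit _ 2) fun b => ?_).congr mem_optSub.symm)
      (by rw [eval_ex]; exact bit_le_one _)
    have g' := g.setVar (x := 10) (v := b) (by omega)
    have h9 : (var 9).eval (((s3.setVar 9 (v : ℕ)).setTbl 6 f).setVar 10 (b : ℕ)) = v := by simp
    have h10 : (var 10).eval (((s3.setVar 9 (v : ℕ)).setTbl 6 f).setVar 10 (b : ℕ)) = b := by simp
    have hei := ei _ g' (by simpa)
    have hej := ej _ g' (by simpa)
    have hlab := g'.eval_labE h9 h10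
    have hpos := J.label_pos v b
    have hle := J.label_le v b
    obtain ⟨c1, c2⟩ := dynState_le (J := J) (O := O) (i := i) (j := j) (J.label v b - 1)
    have hst : (rd 9 (labE (var 9) (var 10) - lit 1)).eval
        (((s3.setVar 9 (v : ℕ)).setTbl 6 f).setVar 10 (b : ℕ)) =
        Tables.encodeState n (J.dynState O i j (J.label v b - 1)) := by
      rw [eval_rd, eval_sub, hlab, eval_lit]
      simpa using x3 (J.label v b - 1) (by omega)
    refine ((Tests.eq (g'.eval_sideE h9 h10) hei).congr Fin.ext_iff.symm).and
      (((Tests.eq (g'.eval_sideE h9 (Base.eval_one_sub h10)) hej).congr Fin.ext_iff.symm).and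
      (g'.tests_takesE (O := O) (i := i) (j := j) (z := J.label v b - 1) (q := (J.dynState O i j (J.label v b - 1)).1)
        (r := (J.dynState O i j (J.label v b - 1)).2) (fun q r hq hr => ?_) ?_ hei hej ?_ (by omega)
        ?_ ?_ c1 (by omega)))
    · simpa using w3 (2 * n - (J.label v b - 1 + 1)) (by omega) q r hq hr
    · simpa using u3 _ (by omega)
    · rw [hlab]; omega
    · rw [eval_div, hst, eval_var, g'.var6, Tables.encodeState_div c2]
    · rw [eval_mod, hst, eval_var, g'.var6, Tables.encodeState_mod c2]
  · refine ⟨(g3.setVar (by omega)).setTbl (by decide), by simpa using o3, fun v hv => ?_,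
      fun y hy => ?_⟩
    · simpa using h4 v hv
    · rw [← a3]
      simpa using h4' y fun v _ => by omega

theorem wp_dynLoop (hk : 3 ≤ k) (hM : Large k n M) (hT : J.Tables s) :
    WP M dynLoop s fun s' => J.Tables s' ∧ s'.out = s.out ∧
      ∀ p < (n + 1) ^ pruneSize k * k * k, ∀ v < n, s'.arr 6 (p * n + v) = J.resultAt p v := by
  refine WP.loop ((n + 1) ^ pruneSize k * k * k) (fun p s' => J.Tables s' ∧ s'.out = s.out ∧
    ∀ p' < p, ∀ v < n, s'.arr 6 (p' * n + v) = J.resultAt p' v)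
    (by simp [hT.var4, hT.var0]) (hM.pow_mul_mul_le ((pruneSize_le hk).trans (Nat.le_succ _)))
    ⟨hT, rfl, fun p hp => absurd hp (by omega)⟩ ?_ fun s' h => h
  rintro p hp s' ⟨h1, h2, h3⟩
  refine (wp_dynProg hk hM (h1.setVar (by omega)) (by simp) hp).mono ?_
  rintro s'' ⟨h4, h5, h6, h7⟩
  refine ⟨h4, h5.trans h2, fun p' hp' v hv => ?_⟩
  rcases (Nat.lt_succ_iff.1 hp').eq_or_lt with rfl | hlt
  · exact h6 v hv
  · rw [h7 _ (by nlinarith)]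
    simpa using h3 p' hlt v hv

end PolygonModel

namespace ArrayLang.Tests

theorem and_of {a b : Expr} {s : Env} {P Q : Prop} (ha : Tests a s P) (hb : P → Tests b s Q) :
    Tests (a.and b) s (P ∧ Q) := by
  unfold Tests at *
  rw [Expr.eval_and, bit_ne_zero, ha]
  exact and_congr_right fun h => hb h

end ArrayLang.Tests

/-! ### Pruning by the program, and the report of an iteration -/

namespace PolygonModel

open ArrayLang ArrayLang.Expr

variable {k n : ℕ}

theorem flatMap_range_eq {α : Type*} (f : ℕ → List α) :
    (List.range k).flatMap f = (List.finRange k).flatMap fun i : Fin k => f i := by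
  rw [← List.map_coe_finRange_eq_range, List.flatMap_map]

theorem sum_ind (X : Finset (Fin n)) : ∑ v ∈ Finset.range n, ind X v = X.card := by
  classical
  rw [Finset.sum_range, Finset.card_eq_sum_ones, ← Finset.sum_subset X.subset_univ]
  · exact Finset.sum_congr rfl fun v hv => by rw [ind_fin]; simp [bit, hv]
  · intro v _ hv
    rw [ind_fin]
    simp [bit, hv]

variable [NeZero k] (J : PolygonModel k n)

/-- The tables and the results of the dynamic programs are in place, the variable `8` is `c`, and
the best set so far is stored in array `12`, its size in variable `14`. -/
structure Main (c b : ℕ) (f : ℕ → ℕ) (s : Env) : Prop extends J.Tables s where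
  results : ∀ p < (n + 1) ^ pruneSize k * k * k, ∀ v < n, s.arr 6 (p * n + v) = J.resultAt p v
  code : s.var 8 = c
  size : s.var 14 = b
  best : s.arr 12 = f

/-- The codes of the relevant parts of the outer boundary are in place. -/
def Pruned (c : ℕ) (s : Env) : Prop := ∀ i j : Fin k,
  s.arr 10 ((i * k + j) * (boundarySize k + 1) + boundarySize k) = J.prune i j c (boundarySize k)

variable {J} {c b M : ℕ} {f : ℕ → ℕ} {s : Env}

namespace Main

theorem setVar (h : J.Main c b f s) {x v : ℕ} (hx : 9 ≤ x) (hx' : x ≠ 14) :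
    J.Main c b f (s.setVar x v) where
  toTables := h.toTables.setVar (by omega)
  results := h.results
  code := by rw [Env.setVar_var, if_neg (by omega), h.code]
  size := by rw [Env.setVar_var, if_neg (by omega), h.size]
  best := h.best

theorem setTbl (h : J.Main c b f s) {α : Fin 16} {g : ℕ → ℕ} (hα : 7 ≤ α ∧ α ≠ 12) :
    J.Main c b f (s.setTbl α g) where
  toTables := h.toTables.setTbl (by omega)
  results := by
    rw [Env.setTbl_arr, if_neg (by omega)]
    exact h.results
  code := h.code
  size := h.size
  best := by rw [Env.setTbl_arr, if_neg (by omega), h.best]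

theorem setOut (h : J.Main c b f s) {l : List ℕ} : J.Main c b f (s.setOut l) where
  toTables := h.toTables.setOut
  results := h.results
  code := h.code
  size := h.size
  best := h.best

theorem eval_memE (h : J.Main c b f s) (hc : c < (n + 1) ^ boundarySize k) {v : ℕ}
    (h9 : s.var 9 = v) : (memE (var 8) (var 9)).eval s = ind (codeSet n c) v := by
  have := h.tests_memE (ec := var 8) (ev := var 9) (c := c) (fun i => by simpa using h.code)
    (fun i => by simp) hc
  rw [eval_var, h9] at this
  exact this.eq_bit (by rw [memE, eval_ex]; exact bit_le_one _)

/-- Here the precomputation pays off: as the code is valid, its pruned code is small enough to be an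
index of the table of results, and the minimum set is found by lookup. -/
theorem eval_subE (h : J.Main c b f s) (hk : 3 ≤ k) (hp : J.Pruned c s) (hv : J.ValidCode c)
    {i j : Fin k} (hij : i < j) {v : ℕ} (hvn : v < n) {ei ej ev : Expr} (hi : ei.eval s = i)
    (hj : ej.eval s = j) (hev : ev.eval s = v) :
    (subE ei ej ev).eval s = ind ((J.iterationOf c).sub i j) v := by
  have hlt : J.prune i j c (boundarySize k) < (n + 1) ^ pruneSize k := prune_lt_of_validCode hk hv hij
  simp only [subE, eval_rd, eval_add, eval_mul, eval_var, eval_lit, hi, hj, hev, h.var0, h.var1,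
    h.var2, hp i j]
  have hlt' : (J.prune i j c (boundarySize k) * k + i) * k + j <
      (n + 1) ^ pruneSize k * k * k := by
    have h1 : J.prune i j c (boundarySize k) * k + i < (n + 1) ^ pruneSize k * k := by
      nlinarith [i.isLt]
    nlinarith [j.isLt]
  rw [h.results _ hlt' v hvn, resultAt_eq]
  rfl

end Main

theorem wp_pruneProg (hk : 3 ≤ k) (hM : Large k n M) (h : J.Main c b f s)
    (hc : c < (n + 1) ^ boundarySize k) :
    WP M pruneProg s fun s' => J.Main c b f s' ∧ J.Pruned c s' ∧ s'.out = s.out := by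
  classical
  have hk0 : 0 < k := by omega
  set m := boundarySize k with hm
  refine WP.fill_zero (k * k * (m + 1)) (fun y => J.prune (Fin.ofNat k (y / (m + 1) / k))
    (Fin.ofNat k (y / (m + 1))) c (y % (m + 1))) (by simp [h.var0, h.var2, hm]) hM.mul_mul_le
    (fun y _ => ?_) (fun y hy g hg => ?_) fun t g hg => ?_
  · exact (prune_lt_pow _).le.trans (hM.pow_le hk (Nat.mod_lt _ (by omega)).le)
  · have h1 := (h.setVar (x := 9) (v := y) (by omega) (by omega)).setTbl (α := 10) (g := g)
      (by decide)
    have hmod : (var 9 % (var 2 + lit 1)).eval ((s.setVar 9 y).setTbl 10 g) = y % (m + 1) := by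
      simp [h.var2, hm]
    have hlt : y % (m + 1) < m + 1 := Nat.mod_lt _ (by omega)
    rw [eval_cond, hmod]
    rcases hz : y % (m + 1) with _ | z
    · simp [prune]
    · have hdm := Nat.div_add_mod y (m + 1)
      rw [hz] at hdm hlt
      -- Each pair of sides owns a block of `m + 1` cells, one for every stage of `prune`; inside a
      -- block the preceding cell holds the preceding stage.
      have hpred : y - 1 = z + (m + 1) * (y / (m + 1)) := by omega
      have e1 : (y - 1) / (m + 1) = y / (m + 1) := by
        rw [hpred, Nat.add_mul_div_left _ _ (by omega), Nat.div_eq_of_lt (by omega), zero_add]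
      have e2 : (y - 1) % (m + 1) = z := by
        rw [hpred, Nat.add_mul_mod_self_left, Nat.mod_eq_of_lt (by omega)]
      have ha := hg (y - 1) (by omega)
      rw [e1, e2] at ha
      set i := Fin.ofNat k (y / (m + 1) / k) with hi
      set j := Fin.ofNat k (y / (m + 1)) with hj
      have hlt' : J.prune i j c z < (n + 1) ^ m :=
        (prune_lt_pow z).trans_le (Nat.pow_le_pow_right (by omega) (by omega))
      have ht := h1.tests_neededE (i := i) (j := j) (a := J.prune i j c z) (z := z)
        (ei := var 9 / (var 2 + lit 1) / var 0 % var 0) (ej := var 9 / (var 2 + lit 1) % var 0)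
        (ec := var 8) (ea := rd 10 (var 9 - lit 1)) (ez := var 9 % (var 2 + lit 1) - lit 1)
        (by omega) hc hlt' (fun _ _ => by simp [h.var0, h.var2, hi, hm])
        (fun _ _ => by simp [h.var0, h.var2, hj, hm]) (fun _ => by simpa using h.code)
        (fun _ _ => by simpa using h.code) (fun _ _ => by simpa using ha)
        (fun _ => by simp [h.var2, ← hm, hz]) (fun _ _ => by simp [h.var2, ← hm, hz])
      rw [if_pos (by omega), pruneE, eval_cond, prune]
      refine if_congr ht ?_ (by simpa using ha)
      rw [eval_add, h1.eval_digE (z := z) (by simp [h.var2, ← hm, hz]) (by omega)]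
      simp [h.var1, h.code, ha]
  · refine ⟨(h.setVar (by omega) (by omega)).setTbl (by decide), fun i j => ?_, rfl⟩
    have e1 : ((i * k + j) * (m + 1) + m) / (m + 1) = i * k + j := by
      rw [mul_comm _ (m + 1), Nat.mul_add_div (by omega), Nat.div_eq_of_lt (by omega), add_zero]
    have e2 : ((i * k + j) * (m + 1) + m) % (m + 1) = m := by
      rw [mul_comm _ (m + 1), Nat.mul_add_mod, Nat.mod_eq_of_lt (by omega)]
    have e3 : (i * k + (j : ℕ)) / k = i := by
      rw [mul_comm, Nat.mul_add_div hk0, Nat.div_eq_of_lt j.isLt, add_zero]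
    have e4 : Fin.ofNat k (i * k + j) = j := Fin.ext (by simp [Nat.mod_eq_of_lt j.isLt])
    have e5 : Fin.ofNat k (i : ℕ) = i := Fin.ext (by simp)
    have h1 : i * k + (j : ℕ) + 1 ≤ k * k := by nlinarith [i.isLt, j.isLt]
    have := hg ((i * k + j) * (m + 1) + m) (by nlinarith)
    rw [e1, e2, e3, e4, e5] at this
    simpa using this

theorem wp_reportProg (hk : 3 ≤ k) (hM : Large k n M) (h : J.Main c b f s)
    (hc : c < (n + 1) ^ boundarySize k) (hv : J.ValidCode c) :
    WP M reportProg s fun s' => J.Main c b f s' ∧ J.Pruned c s' ∧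
      s'.out = s.out ++ (J.iterationOf c).encode := by
  have b3 := hM.twice_le
  have b4 := hM.mul_self_le
  have hkM : k ≤ M := by nlinarith
  refine WP.seq (WP.emit_loop n (ind (codeSet n c)) (by simpa using h.var1) (by omega)
    (fun i _ l => Main.eval_memE (((h.setVar (by omega) (by omega)).setOut)) hc (by simp))
    fun t => ?_)
  have g1 := (h.setVar (x := 9) (v := t) (by omega) (by omega)).setOut
    (l := s.out ++ (List.range n).map (ind (codeSet n c)))
  refine WP.seq ((wp_pruneProg hk hM g1 hc).mono ?_)
  rintro s1 ⟨g2, p2, o2⟩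
  let A : ℕ → ℕ → List ℕ := fun i j => if i < j then
    (List.range n).map (ind ((J.iterationOf c).sub (Fin.ofNat k i) (Fin.ofNat k j))) else []
  have hA : (J.iterationOf c).encode = (List.range n).map (ind (codeSet n c)) ++
      (List.range k).flatMap fun i => (List.range k).flatMap fun j => A i j := by
    rw [Iteration.encode, flatMap_range_eq]
    congr 1
    · exact encodeSet_eq _
    · refine List.flatMap_congr fun i _ => ?_
      rw [flatMap_range_eq]
      refine List.flatMap_congr fun j _ => ?_
      have e4 : Fin.ofNat k (j : ℕ) = j := Fin.ext (by simp)
      have e5 : Fin.ofNat k (i : ℕ) = i := Fin.ext (by simp)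
      simp only [A, e4, e5, encodeSet_eq]
      exact if_congr Fin.lt_def rfl rfl
  refine WP.loop k (fun i s' => J.Main c b f s' ∧ J.Pruned c s' ∧ s'.out = s1.out ++
    (List.range i).flatMap fun i => (List.range k).flatMap fun j => A i j)
    (by simpa using g2.var0) hkM ⟨g2, p2, by simp⟩ ?_ ?_
  · rintro i hi s2 ⟨g3, p3, o3⟩
    refine WP.loop k (fun j s' => J.Main c b f s' ∧ J.Pruned c s' ∧ s'.var 11 = i ∧
      s'.out = s2.out ++ (List.range j).flatMap fun j => A i j)
      (by simpa using g3.var0) hkM ⟨g3.setVar (by omega) (by omega), p3, by simp, by simp⟩ ?_ ?_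
    · rintro j hj s3 ⟨g4, p4, v4, o4⟩
      have g5 := g4.setVar (x := 12) (v := j) (by omega) (by omega)
      refine WP.when (c := i < j) (by simp [v4]) (fun hij => ?_) fun hij => ?_
      · have hi' : ((Fin.ofNat k i : Fin k) : ℕ) = i := by simp [Nat.mod_eq_of_lt hi]
        have hj' : ((Fin.ofNat k j : Fin k) : ℕ) = j := by simp [Nat.mod_eq_of_lt hj]
        refine WP.emit_loop n (ind ((J.iterationOf c).sub (Fin.ofNat k i) (Fin.ofNat k j)))
          (by simpa using g5.var1) (by omega) (fun v hvn l => ?_) fun t => ?_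
        · refine Main.eval_subE (((g5.setVar (by omega) (by omega)).setOut)) hk p4 hv
            (i := Fin.ofNat k i) (j := Fin.ofNat k j) (Fin.lt_def.2 (by omega)) hvn ?_ ?_ ?_
          · rw [hi']; simpa using v4
          · rw [hj']; simp
          · simp
        · refine ⟨(g5.setVar (by omega) (by omega)).setOut, p4, by simpa using v4, ?_⟩
          rw [Env.setOut_out, Env.setVar_out, o4, List.range_succ, List.flatMap_append]
          simp [A, hij]
      · refine ⟨g5, p4, by simpa using v4, ?_⟩
        rw [Env.setVar_out, o4, List.range_succ, List.flatMap_append]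
        simp [A, hij]
    · rintro s3 ⟨g4, p4, -, o4⟩
      refine ⟨g4, p4, ?_⟩
      rw [o4, o3, List.range_succ, List.flatMap_append]
      simp
  · rintro s2 ⟨g3, p3, o3⟩
    refine ⟨g3, p3, ?_⟩
    rw [o3, o2, hA, Env.setOut_out, List.append_assoc]

end PolygonModel

/-! ### The search for the smallest candidate -/

namespace PolygonModel

open ArrayLang ArrayLang.Expr

variable {k n : ℕ} {J : PolygonModel k n} {c b M : ℕ} {f : ℕ → ℕ} {s : Env}

open scoped Classical in
/-- The codes of outer boundaries below `c`. -/
noncomputable def validCodes (J : PolygonModel k n) (c : ℕ) : List ℕ :=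
  (List.range c).filter fun c => J.ValidCode c

/-- The state of the search among the codes below `c`. -/
def Best (J : PolygonModel k n) (c b : ℕ) (f : ℕ → ℕ) : Prop :=
  (b = n + 1 ∧ ∀ c' < c, ¬ J.ValidCode c') ∨
    ∃ c₀ < c, J.ValidCode c₀ ∧ b = (J.iterationOf c₀).candidate.card ∧
      (∀ v < n, f v = ind (J.iterationOf c₀).candidate v) ∧
      ∀ c' < c, J.ValidCode c' → b ≤ (J.iterationOf c').candidate.card

theorem Best.update (h : J.Best c b f) (hv : J.ValidCode c) {g : ℕ → ℕ}
    (hlt : (J.iterationOf c).candidate.card < b)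
    (hg : ∀ v < n, g v = ind (J.iterationOf c).candidate v) :
    J.Best (c + 1) (J.iterationOf c).candidate.card g := by
  refine Or.inr ⟨c, by omega, hv, rfl, hg, fun c' hc' hv' => ?_⟩
  rcases (Nat.lt_succ_iff.1 hc').eq_or_lt with rfl | hlt'
  · exact le_rfl
  · rcases h with ⟨-, h⟩ | ⟨_, _, _, _, _, h⟩
    · exact absurd hv' (h c' hlt')
    · exact hlt.le.trans (h c' hlt' hv')

theorem Best.keep (h : J.Best c b f)
    (hle : J.ValidCode c → b ≤ (J.iterationOf c).candidate.card) : J.Best (c + 1) b f := by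
  rcases h with ⟨h1, h2⟩ | ⟨c₀, h1, h2, h3, h4, h5⟩
  · refine Or.inl ⟨h1, fun c' hc' hv' => ?_⟩
    rcases (Nat.lt_succ_iff.1 hc').eq_or_lt with rfl | hlt'
    -- The initial value `n + 1` exceeds the size of every candidate, so the first valid code always
    -- replaces it.
    · have := hle hv'
      have := (Finset.card_le_univ (J.iterationOf c').candidate)
      rw [Fintype.card_fin] at this
      omega
    · exact h2 c' hlt' hv'
  · refine Or.inr ⟨c₀, by omega, h2, h3, h4, fun c' hc' hv' => ?_⟩
    rcases (Nat.lt_succ_iff.1 hc').eq_or_lt with rfl | hlt'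
    · exact hle hv'
    · exact h5 c' hlt' hv'

/-- Code `0`, the empty outer boundary, is always valid, so the search cannot end without a
candidate. -/
theorem Best.isRun (hk : 3 ≤ k) (h : J.Best ((n + 1) ^ boundarySize k) b f) :
    ∃ D, J.IsRun ((J.validCodes ((n + 1) ^ boundarySize k)).map J.iterationOf) D ∧
      ∀ v < n, f v = ind D v := by
  rcases h with ⟨-, h⟩ | ⟨c₀, hc, hv, hb, hg, hle⟩
  · exact absurd validCode_zero (h 0 (Nat.pow_pos (by omega)))
  · exact ⟨(J.iterationOf c₀).candidate, isRun_of_codes hk hc hv rfl fun c hc hv =>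
      hb.symm.trans_le (hle c hc hv), hg⟩

variable [NeZero k]

theorem wp_selectProg (hk : 3 ≤ k) (hM : Large k n M) (h : J.Main c b f s) (hp : J.Pruned c s)
    (hc : c < (n + 1) ^ boundarySize k) (hv : J.ValidCode c) :
    WP M selectProg s fun s' => s'.out = s.out ∧
      if (J.iterationOf c).candidate.card < b then
        ∃ g, J.Main c (J.iterationOf c).candidate.card g s' ∧
          ∀ v < n, g v = ind (J.iterationOf c).candidate v
      else J.Main c b f s' := by
  classical
  have b3 := hM.twice_le
  set X := (J.iterationOf c).candidate with hX
  have hXn : X.card ≤ n := (Finset.card_le_univ X).trans (by simp)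
  refine WP.seq (WP.fill_zero n (ind X) (by simpa using h.var1) (by omega)
    (fun _ _ => (bit_le_one _).trans (by omega)) (fun v hvn g hg => ?_) fun t g hg => ?_)
  · have h1 := (h.setVar (x := 9) (v := v) (by omega) (by omega)).setTbl (α := 11) (g := g)
      (by decide)
    obtain ⟨v, rfl⟩ : ∃ u : Fin n, (u : ℕ) = v := ⟨⟨v, hvn⟩, rfl⟩
    have h2 := (Tests.ne_zero (h1.eval_memE hc (v := v) (by simp))).or
      (Tests.exFin (x := 11) (N := var 0) (n := k) (P := fun i => ∃ j, i < j ∧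
        v ∈ (J.iterationOf c).sub i j) (e := ex 12 (var 0) (((var 11).lt (var 12)).and
          (subE (var 11) (var 12) (var 9)))) (by simpa using h1.var0) fun i =>
        Tests.exFin (by simpa using h1.var0) fun j => ?_)
    · refine (h2.congr ?_).eq_bit (by rw [eval_or]; exact bit_le_one _) |>.trans (ind_fin X v).symm
      rw [hX, Iteration.candidate, Finset.mem_union, mem_unionPairs, ind_fin, bit_ne_zero, or_comm]
      rfl
    · have h3 := (h1.setVar (x := 11) (v := i) (by omega) (by omega)).setVar (x := 12) (v := j)
        (by omega) (by omega)
      refine ((Tests.lt (u := i) (v := j) (by simp) (by simp)).congr Fin.lt_def.symm).and_of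
        fun hij => ?_
      unfold Tests
      rw [h3.eval_subE hk (fun a b => by simpa using hp a b) hv hij v.isLt (by simp) (by simp)
        (by simp), ind_fin, bit_ne_zero]
  have h1 := (h.setVar (x := 9) (v := t) (by omega) (by omega)).setTbl (α := 11) (g := g)
    (by decide)
  have hsum : (sum 9 (var 1) (rd 11 (var 9))).eval ((s.setVar 9 t).setTbl 11 g) = X.card := by
    rw [eval_sum, eval_var, h1.var1, ← sum_ind]
    refine Finset.sum_congr rfl fun v hv => ?_
    simpa using hg v (Finset.mem_range.1 hv)
  refine WP.seq (WP.assign hsum (by omega) ?_)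
  have h2 := h1.setVar (x := 13) (v := X.card) (by omega) (by omega)
  have hg2 : ∀ v < n, (((s.setVar 9 t).setTbl 11 g).setVar 13 X.card).arr 11 v = ind X v :=
    fun v hv => by simpa using hg v hv
  have hv13 : (((s.setVar 9 t).setTbl 11 g).setVar 13 X.card).var 13 = X.card := by simp
  have ho : (((s.setVar 9 t).setTbl 11 g).setVar 13 X.card).out = s.out := rfl
  generalize ((s.setVar 9 t).setTbl 11 g).setVar 13 X.card = s2 at h2 hg2 hv13 ho
  refine WP.when (c := X.card < b) (by simp [hv13, h2.size]) (fun hlt => ?_) fun hlt => ?_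
  · refine WP.seq (WP.assign (v := X.card) (by simpa using hv13) (by omega) ?_)
    refine WP.fill_zero n (ind X) (by simpa using h2.var1) (by omega)
      (fun _ _ => (bit_le_one _).trans (by omega)) (fun v hvn g _ => by simpa using hg2 v hvn)
      fun t' g' hg' => ?_
    refine ⟨ho, ?_⟩
    rw [if_pos hlt]
    refine ⟨g', ⟨((h2.toTables.setVar (by omega)).setVar (by omega)).setTbl (by decide),
      fun p hp v hv => by simpa using h2.results p hp v hv, by simpa using h2.code, by simp,
      by simp⟩, hg'⟩
  · refine ⟨ho, ?_⟩
    rw [if_neg hlt]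
    exact h2

theorem wp_mainLoop (hk : 3 ≤ k) (hM : Large k n M) {c : ℕ} (h : J.Main c (n + 1) f s) :
    WP M mainLoop s fun s' => ∃ b g, J.Best ((n + 1) ^ boundarySize k) b g ∧ J.Tables s' ∧
      s'.arr 12 = g ∧ s'.out = s.out ++
        (J.validCodes ((n + 1) ^ boundarySize k)).flatMap fun c => (J.iterationOf c).encode := by
  classical
  -- Between two rounds the loop variable does not yet hold the next code; hence the separate `c'`.
  refine WP.loop ((n + 1) ^ boundarySize k) (fun c s' => ∃ c' b g, J.Best c b g ∧
    J.Main c' b g s' ∧ s'.out = s.out ++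
      (J.validCodes c).flatMap fun c => (J.iterationOf c).encode)
    (by simpa using h.var5) (hM.pow_le hk (by omega))
    ⟨c, n + 1, f, Or.inl ⟨rfl, fun c' hc' => absurd hc' (by omega)⟩, h, by simp [validCodes]⟩ ?_ ?_
  · rintro c hc s1 ⟨c', b, g, h1, h2, h3⟩
    have g1 : J.Main c b g (s1.setVar 8 c) := ⟨h2.toTables.setVar (by omega), h2.results, by simp,
      by simpa using h2.size, h2.best⟩
    refine WP.when (c := J.ValidCode c) ?_ (fun hv => ?_) fun hv => ?_
    · rw [eval_lit, g1.eval_validE g1.code hc, bit_pos]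
    · refine WP.seq ((wp_reportProg hk hM g1 hc hv).mono ?_)
      rintro s2 ⟨g2, p2, o2⟩
      refine (wp_selectProg hk hM g2 p2 hc hv).mono ?_
      rintro s3 ⟨o3, h4⟩
      have ho : s3.out = s.out ++
          (J.validCodes (c + 1)).flatMap fun c => (J.iterationOf c).encode := by
        rw [o3, o2, Env.setVar_out, h3]
        simp [validCodes, List.range_succ, hv]
      split_ifs at h4 with hlt
      · obtain ⟨g', h4, h5⟩ := h4
        exact ⟨c, _, g', h1.update hv hlt h5, h4, ho⟩
      · exact ⟨c, b, g, h1.keep fun _ => not_lt.1 hlt, h4, ho⟩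
    · refine ⟨c, b, g, h1.keep fun h => absurd h hv, g1, ?_⟩
      rw [Env.setVar_out, h3]
      simp [validCodes, List.range_succ, hv]
  · rintro s1 ⟨c', b, g, h1, h2, h3⟩
    exact ⟨b, g, h1, h2.toTables, h2.best, h3⟩

theorem wp_mainProg (hk : 3 ≤ k) (hM : Large k n M) (h : J.Base s) :
    WP M mainProg s fun s' => ∃ (L : List (Iteration k n)) (D : Finset (Fin n)), J.IsRun L D ∧
      s'.out = s.out ++ (L.flatMap Iteration.encode ++ encodeSet D) := by
  have b3 := hM.twice_le
  refine WP.seq ((wp_tablesProg hM h).mono ?_)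
  rintro s1 ⟨h1, o1⟩
  refine WP.seq ((wp_dynLoop hk hM h1).mono ?_)
  rintro s2 ⟨h2, o2, r2⟩
  refine WP.seq (WP.assign (v := n + 1) (by simp [h2.var1]) (by omega) ?_)
  have h3 : J.Main (s2.var 8) (n + 1) (s2.arr 12) (s2.setVar 14 (n + 1)) :=
    ⟨h2.setVar (by omega), r2, by simp, by simp, rfl⟩
  refine WP.seq ((wp_mainLoop hk hM h3).mono ?_)
  rintro s3 ⟨b, g, hb, h4, rfl, o4⟩
  obtain ⟨D, hD, hg⟩ := hb.isRun hk
  refine WP.emit_loop n (ind D) (by simpa using h4.var1) (by omega)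
    (fun v hvn l => by simpa using hg v hvn) fun t => ⟨_, D, hD, ?_⟩
  rw [Env.setOut_out, o4, Env.setVar_out, o2, o1, List.flatMap_map, encodeSet_eq,
    List.append_assoc]

end PolygonModel

/-! ### The running time -/

namespace ArrayLang

open ArrayLang.Expr

/-- The setup assigns the reserved variables and so is not `Safe`; its cost is estimated directly.
It is linear in the number of powers to be computed, and the constant is merely generous. -/
theorem exists_cost_setupProg_le : ∃ C, ∀ s : Env,
    setupProg.cost s ≤ C * (2 * (s.arr 0 0 * (s.arr 0 0 - 2)) + 1) + C := by
  refine ⟨1000, fun s => ?_⟩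
  have hsub (a b : Expr) (s : Env) : (a - b).cost s = a.cost s + b.cost s + 1 := rfl
  simp only [setupProg, Stmt.cost, Expr.cost, Expr.cond, Expr.lt, hsub, Finset.sum_const,
    Finset.card_range]
  simp [Stmt.run]
  omega

end ArrayLang

namespace PolygonModel

open ArrayLang ArrayLang.Expr WordRAM

theorem boundarySize_eq (k : ℕ) : boundarySize k = 2 * k ^ 2 - 4 * k := by
  rw [boundarySize, Nat.mul_sub, Nat.mul_sub, pow_two]
  omega

/-- The precomputation is not slower than the main loop. For `k = 3` both exponents are `7`, which
is why the bound `9` on the pruned size had to be improved to `4` for triangles. -/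
theorem pruneSize_add_le {k : ℕ} (hk : 3 ≤ k) : pruneSize k + 3 ≤ boundarySize k + 1 := by
  unfold pruneSize boundarySize
  obtain ⟨y, rfl⟩ : ∃ y, k = y + 3 := ⟨k - 3, by omega⟩
  rw [show y + 3 - 2 = y + 1 by omega]
  split_ifs
  · nlinarith
  · obtain ⟨z, rfl⟩ : ∃ z, y = z + 1 := ⟨y - 1, by omega⟩
    nlinarith

theorem exists_large (k : ℕ) : ∃ a, ∀ n, Large k n ((n + 2) ^ a) ∧ k ≤ (n + 2) ^ a := by
  refine ⟨boundarySize k + 1 + k * k * (boundarySize k + 1) + 6 + k, fun n => ?_⟩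
  have hy : 1 ≤ n + 2 := by omega
  have h2 : 2 * n + 2 ≤ (n + 2) ^ 2 := by nlinarith
  refine ⟨⟨?_, ?_⟩, ?_⟩
  · calc _ ≤ (n + 2) ^ (boundarySize k + 1) * (n + 2) ^ (k * k * (boundarySize k + 1)) :=
        Nat.mul_le_mul (Nat.pow_le_pow_left (by omega) _) (lit_le_pow (by omega) _)
      _ ≤ _ := by rw [← pow_add]; exact Nat.pow_le_pow_right hy (by omega)
  · calc _ ≤ (n + 2) ^ 2 * (n + 2) ^ 2 * (n + 2) ^ 2 :=
        Nat.mul_le_mul (Nat.mul_le_mul h2 h2) h2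
      _ ≤ _ := by rw [← pow_add, ← pow_add]; exact Nat.pow_le_pow_right hy (by omega)
  · exact (lit_le_pow (y := n + 2) (by omega) k).trans (Nat.pow_le_pow_right hy (by omega))

variable {k n : ℕ}

theorem le_of_mem_input {J : PolygonModel k n} {M a : ℕ} (hk : k ≤ M) (hn : 2 * n ≤ M)
    (ha : a ∈ J.input) : a ≤ M := by
  simp only [input, List.mem_cons, List.mem_flatMap, List.not_mem_nil, or_false] at ha
  rcases ha with rfl | rfl | ⟨v, -, rfl | rfl | rfl | rfl⟩
  · exact hk
  · omega
  · exact (J.label_le v 0).trans hn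
  · exact (J.side v 0).isLt.le.trans hk
  · exact (J.label_le v 1).trans hn
  · exact (J.side v 1).isLt.le.trans hk

theorem Base.hasDeg {J : PolygonModel k n} {s : Env} (h : J.Base s) (h7 : s.var 7 = 0) :
    s.HasDeg (k + boundarySize k + pruneSize k + 2) (n + 1)
      (degs (pruneSize k) (boundarySize k)) := by
  intro x hx
  interval_cases x
  · simp only [h.var0, degs, pow_zero]; omega
  · simp only [h.var1, degs, pow_one]; nlinarith
  · simp only [h.var2, degs, pow_zero]; omega
  · simp only [h.var3, degs, pow_zero]; omega
  · simp only [h.var4, degs]; exact Nat.le_mul_of_pos_left _ (by omega)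
  · simp only [h.var5, degs]; exact Nat.le_mul_of_pos_left _ (by omega)
  · simp only [h.var6, degs, pow_one]; nlinarith
  · simp [h7]

theorem exists_cost_mainProg_le (hk : 3 ≤ k) : ∃ C, ∀ (n : ℕ) (J : PolygonModel k n) (s : Env),
    J.Base s → s.var 7 = 0 → mainProg.cost s ≤ C * (n + 1) ^ (boundarySize k + 1) := by
  obtain ⟨C, hC⟩ := Stmt.exists_cost_le (degs (pruneSize k) (boundarySize k))
    (k + boundarySize k + pruneSize k + 2) safe_mainProg
  have h := pruneSize_add_le hk
  exact ⟨C, fun n J s hs h7 => le_mul_pow_of_le (by omega) (hC _ (by omega) s (hs.hasDeg h7)) le_rfl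
    (deg_mainProg_le _ _ h (by omega))⟩

/-- Uses `n + 1 ≤ 2 n`, and moves the power of `k² - k` into the constant. -/
theorem pow_le_bound (hk : 3 ≤ k) (hn : 1 ≤ n) {t C : ℕ}
    (ht : t ≤ C * (n + 1) ^ (boundarySize k + 1)) :
    (t : ℝ) ≤ C * 2 ^ (boundarySize k + 1) * ((k : ℝ) ^ 2 - k) ^ boundarySize k *
      (n * (n / ((k : ℝ) ^ 2 - k)) ^ boundarySize k) := by
  have hk' : (3 : ℝ) ≤ k := by exact_mod_cast hk
  have hq : (0 : ℝ) < (k : ℝ) ^ 2 - k := by nlinarith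
  have h : t ≤ C * (2 * n) ^ (boundarySize k + 1) :=
    ht.trans (Nat.mul_le_mul_left _ (Nat.pow_le_pow_left (by omega) _))
  have h' : (t : ℝ) ≤ C * (2 * n) ^ (boundarySize k + 1) := by exact_mod_cast h
  refine h'.trans_eq ?_
  generalize (k : ℝ) ^ 2 - k = q at hq
  rw [div_pow, mul_pow]
  field_simp
  ring

theorem isLittleO_bound (hk : 3 ≤ k) :
    (fun n : ℕ => (n : ℝ) * ((n : ℝ) / ((k : ℝ) ^ 2 - k)) ^ (2 * k ^ 2 - 4 * k))
      =o[Filter.atTop] fun n : ℕ => (n : ℝ) ^ (4 * k ^ 2 + 3) := by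
  have h : (fun x : ℝ => x ^ (2 * k ^ 2 - 4 * k + 1)) =o[Filter.atTop]
      fun x : ℝ => x ^ (4 * k ^ 2 + 3) :=
    Asymptotics.isLittleO_pow_pow_atTop_of_lt (by omega)
  have h1 := (h.comp_tendsto (tendsto_natCast_atTop_atTop (R := ℝ))).const_mul_left
    ((((k : ℝ) ^ 2 - k) ^ (2 * k ^ 2 - 4 * k))⁻¹)
  refine h1.congr_left fun n => ?_
  simp only [Function.comp_apply, div_pow, pow_succ]
  ring

/-- The word RAM program. -/
def program : Cmd := .seq prelude ((Stmt.seq setupProg mainProg).comp 4)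

theorem exists_computes_program (hk : 3 ≤ k) : ∃ c C : ℕ, ∀ (n : ℕ) (J : PolygonModel k n),
    ∃ (t : ℕ) (L : List (Iteration k n)) (D : Finset (Fin n)),
      Computes ((n + 2) ^ c) program J.input t (L.flatMap Iteration.encode ++ encodeSet D) ∧
        J.IsRun L D ∧ t ≤ C * (n + 1) ^ (boundarySize k + 1) := by
  have : NeZero k := ⟨by omega⟩
  obtain ⟨a, ha⟩ := exists_large k
  obtain ⟨b, hb⟩ := (Stmt.seq setupProg mainProg).exists_bnd_le a
  obtain ⟨A, hA⟩ := exists_cost_setupProg_le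
  obtain ⟨C, hC⟩ := exists_cost_mainProg_le hk
  -- The exponent of the modulus leaves room for stored values (`a`), for intermediate values (`b`),
  -- and for a factor `64` that covers `17 M + 17`. In the constant, `33` pays for the `24 n + 21`
  -- steps of the prelude, `A` for the setup and `C` for the rest.
  refine ⟨a + b + 6, A * (boundarySize k + 1) + A + C + 33, fun n J => ?_⟩
  obtain ⟨hM, hkM⟩ := ha n
  have h2 := hM.twice_le
  have hy : 1 ≤ n + 2 := by omega
  have ha1 : 1 ≤ (n + 2) ^ a := Nat.one_le_pow _ _ hy
  have hb1 : 1 ≤ (n + 2) ^ b := Nat.one_le_pow _ _ hy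
  have h64 : 64 ≤ (n + 2) ^ 6 := Nat.pow_le_pow_left (show 2 ≤ n + 2 by omega) 6
  have hB : (n + 2) ^ (a + b + 6) = (n + 2) ^ a * (n + 2) ^ b * (n + 2) ^ 6 := by
    rw [pow_add, pow_add]
  have hab1 : (n + 2) ^ a ≤ (n + 2) ^ a * (n + 2) ^ b := Nat.le_mul_of_pos_right _ hb1
  have hab2 : (n + 2) ^ b ≤ (n + 2) ^ a * (n + 2) ^ b := Nat.le_mul_of_pos_left _ ha1
  have hab3 := Nat.mul_le_mul_left ((n + 2) ^ a * (n + 2) ^ b) h64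
  have hset := J.wp_setupProg hk hM
  have hmain := wp_mainProg hk hM hset.2.1
  obtain ⟨L, D, hrun, hout⟩ := hmain.2
  obtain ⟨t, ht, hcomp⟩ := Stmt.exists_computes (Stmt.seq setupProg mainProg)
    (B := (n + 2) ^ (a + b + 6)) J.length_input rfl (M := (n + 2) ^ a) (by omega)
    (fun x hx => le_of_mem_input hkM (by omega) hx) (by omega) ⟨hset.1, hmain.1⟩
    ((hb (n + 2) (by omega)).trans_lt (by omega))
  refine ⟨t, L, D, ?_, hrun, ht.trans ?_⟩
  · rwa [Stmt.run, hout, hset.2.2.1, List.nil_append] at hcomp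
  · have h1 := hA (initEnv J.input)
    have h3 := hC n J _ hset.2.1 hset.2.2.2
    have h4 : n + 1 ≤ (n + 1) ^ (boundarySize k + 1) := Nat.le_self_pow (by omega) _
    have h5 : (initEnv J.input).arr 0 0 = k := rfl
    rw [h5] at h1
    have h6 := Nat.le_mul_of_pos_right (A * (boundarySize k + 1) + A)
      (show 0 < (n + 1) ^ (boundarySize k + 1) by positivity)
    change setupProg.cost (initEnv J.input) ≤ A * (boundarySize k + 1) + A at h1
    rw [Stmt.cost, add_mul, add_mul _ C]
    omega

end PolygonModel

theorem mainTheorem4 :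
    -- correctness: every run of the algorithm returns a minimum dominating set
    (∀ (k n : ℕ), 3 ≤ k → ∀ (G : SimpleGraph (Fin n)) (J : PolygonModel k n), J.IsModelOf G →
      ∀ (L : List (Iteration k n)) (D : Finset (Fin n)), J.IsRun L D → IsMinDominatingSet G D) ∧
    -- running time: one word RAM program carries the algorithm out, within the stated time
    (∃ P : WordRAM.Cmd, ∀ k : ℕ, 3 ≤ k → ∃ (c : ℕ) (C : ℝ),
      ∀ n : ℕ, 1 ≤ n → ∀ (G : SimpleGraph (Fin n)) (J : PolygonModel k n), J.IsModelOf G →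
        ∃ (t : ℕ) (L : List (Iteration k n)) (D : Finset (Fin n)),
          WordRAM.Computes ((n + 2) ^ c) P J.input t
            (L.flatMap Iteration.encode ++ encodeSet D) ∧
          J.IsRun L D ∧ IsMinDominatingSet G D ∧
          (t : ℝ) ≤ C * ((n : ℝ) * ((n : ℝ) / ((k : ℝ) ^ 2 - k)) ^ (2 * k ^ 2 - 4 * k))) ∧
    -- the time bound is of smaller order than the earlier bound
    (∀ k : ℕ, 3 ≤ k →
      (fun n : ℕ => (n : ℝ) * ((n : ℝ) / ((k : ℝ) ^ 2 - k)) ^ (2 * k ^ 2 - 4 * k))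
        =o[Filter.atTop] fun n : ℕ => (n : ℝ) ^ (4 * k ^ 2 + 3)) := by
  refine ⟨fun k n hk G J hG L D h => J.isMinDominatingSet_of_isRun hk hG h,
    ⟨PolygonModel.program, fun k hk => ?_⟩, fun k hk => PolygonModel.isLittleO_bound hk⟩
  obtain ⟨c, C, h⟩ := PolygonModel.exists_computes_program hk
  refine ⟨c, C * 2 ^ (PolygonModel.boundarySize k + 1) *
    ((k : ℝ) ^ 2 - k) ^ PolygonModel.boundarySize k, fun n hn G J hG => ?_⟩
  obtain ⟨t, L, D, hcomp, hrun, ht⟩ := h n J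
  refine ⟨t, L, D, hcomp, hrun, J.isMinDominatingSet_of_isRun hk hG hrun, ?_⟩
  rw [← PolygonModel.boundarySize_eq]
  exact PolygonModel.pow_le_bound hk hn ht
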